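/- **Notation.** Work over $\mathbb{K}=\mathbb{Q}(q,t)$. For a partition $\lambda=(\lambda_1,\lambda_2,\dots)$ put $n_\lambda=|\lambda|+\lambda_1$ and, for $n\ge n_\lambda$, $\lambda^{(n)}=(n-|\lambda|,\lambda_1,\lambda_2,\dots)$; let $\square_0$ be the box of $\lambda^{(n+1)}/\lambda^{(n)}$ and $\lambda^{(\infty)}=\bigcup_n\lambda^{(n)}$. The content $c(\square)$ is column minus row. For a diagram $\mu$ with $n$ boxes, $\mathrm{SYT}(\mu)$ is the set of standard tableaux, and $\mathrm{RSSYT}(\mu)$ is the set of labellings $T:\mu\to\mathbb{Z}_{\ge0}$ that decrease weakly along rows and strictly down columns. $\mathrm{PSYT}(\mu)$ is the set of labellings $\tau$ of the boxes of $\mu$ by formal products $jq^b$ ($1\le j\le n$, $b\ge0$), each $j$ used exactly once, strictly increasing along rows and columns, where $jq^m<kq^\ell$ iff $m>\ell$, or $m=\ell$ and $j<k$; it contains $\mathrm{SYT}(\mu)$ as the labellings with all exponents $0$. If $\tau(\square)=iq^b$ then $c_\tau(i)=c(\square)$, $w_\tau(i)=b$; $\mathrm{PSYT}(\mu;T)$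 consists of the $\tau$ whose exponents are given by $T$. $s_i(\tau)$ exchanges the numbers $i,i+1$, leaving the exponents in place (when the result is in $\mathrm{PSYT}(\mu)$). $\Psi(\tau)$ replaces $kq^a$ by $(k-1)q^a$ for $k\ge2$ and $1q^a$ by $nq^{a+1}$. The partial order on $\mathrm{PSYT}(\mu)$ is generated by $\Psi(\tau)>\tau$, and $s_i(\tau)>\tau$ when $w_\tau(i)<w_\tau(i+1)$ or ($w_\tau(i)=w_\tau(i+1)$ and $c_\tau(i)-c_\tau(i+1)>1$). $\mathrm{Top}(T)$ is the largest element of $\mathrm{PSYT}(\mu;T)$. **Algebras.** $\mathcal{H}_n$ has generators $T_1,\dots,T_{n-1}$ with $(T_i-1)(T_i+t)=0$ and the braid relations. $\mathcal{A}_n$ has generators $T_i$ (with the relations of $\mathcal{H}_n$) and commuting $\theta_1,\dots,\theta_n$ with $\theta_{i+1}=tT_i^{-1}\theta_iT_i^{-1}$ and $T_i\theta_j=\theta_jT_i$ for $j\ne i,i+1$. $\mathcal{D}_n$ has in addition commuting generators $X_1,\dots,X_n$ with $X_{i+1}=tT_i^{-1}X_iT_i^{-1}$, $T_iX_j=X_jT_i$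 for $j\ne i,i+1$, and (for $n\ge 1$) $\pi_nX_i=X_{i+1}\pi_n$ for $1\le i\le n-1$ and $\pi_nX_n=qX_1\pi_n$, where $\pi_n=t^{n-1}\theta_1T_1^{-1}\cdots T_{n-1}^{-1}$. In $\mathcal{H}_n$ put $\overline\theta_1=1$, $\overline\theta_{i+1}=tT_i^{-1}\overline\theta_iT_i^{-1}$ and $\overline\varphi_i=tT_i^{-1}\overline\theta_i-\overline\theta_i\,tT_i^{-1}$; $\rho_n:\mathcal{A}_n\to\mathcal{H}_n$ is given by $T_i\mapsto T_i$, $\theta_i\mapsto\overline\theta_i$. Finally $\epsilon^{(n)}=\frac1{[n]_t!}\sum_{\sigma\in\mathfrak{S}_n}t^{\binom n2-\ell(\sigma)}T_\sigma$ with $[n]_t!=\prod_{i=1}^n\frac{1-t^i}{1-t}$. **Modules.** For $\mu$ with $n$ boxes, $S_\mu$ is the $\mathcal{H}_n$-module generated by the $\tau\in\mathrm{SYT}(\mu)$ with relations $\overline\theta_i(\tau)=t^{c_\tau(i)}\tau$; $\overline\varphi_i(\tau)=(t^{c_\tau(i)}-t^{c_\tau(i+1)})s_i(\tau)$ if $s_i(\tau)>\tau$;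 $T_i(\tau)=\tau$ if $i,i+1$ are in the same row of $\tau$; $T_i(\tau)=-t\tau$ if they are in the same column. Let $V_\mu=\mathrm{Ind}_{\mathcal{A}_n}^{\mathcal{D}_n}\rho_n^*(S_\mu)$ and $W_\mu=\epsilon^{(n)}(V_\mu)$. The family $(F_\tau)_{\tau\in\mathrm{PSYT}(\mu)}$ is the basis of $V_\mu$ such that - $\theta_iF_\tau=q^{w_\tau(i)}t^{c_\tau(i)}F_\tau$; - $F_\tau=1\otimes\tau$ for $\tau\in\mathrm{SYT}(\mu)$; - $F_{s_i(\tau)}=\Big(tT_i^{-1}+\frac{(t-1)q^{w_\tau(i+1)}t^{c_\tau(i+1)}}{q^{w_\tau(i)}t^{c_\tau(i)}-q^{w_\tau(i+1)}t^{c_\tau(i+1)}}\Big)F_\tau$ if $s_i(\tau)>\tau$; - $F_{\Psi(\tau)}=q^{w_\tau(1)}X_n\pi_n^{-1}F_\tau$ (for $n\ge1$). For $T\in\mathrm{RSSYT}(\mu)$, with $U_T=\mathrm{span}\{F_\tau:\tau\in\mathrm{PSYT}(\mu;T)\}$, $P_T$ is the element of $\epsilon^{(n)}(U_T)$ of the form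 $F_{\mathrm{Top}(T)}+\sum_{y\in\mathrm{PSYT}(\mu;T)\setminus\{\mathrm{Top}(T)\}}\kappa_yF_y$. The connecting map $\Phi^{(n)}_\lambda:V_{\lambda^{(n+1)}}\to V_{\lambda^{(n)}}$ is the linear map that sends $X^\alpha\otimes\tau$, $\tau\in\mathrm{SYT}(\lambda^{(n+1)})$, to $X_1^{\alpha_1}\cdots X_n^{\alpha_n}\otimes\tau|_{\lambda^{(n)}}$ if $\alpha_{n+1}=0$ and $\tau(\square_0)=n+1$, and to $0$ otherwise. $W^{(\infty)}_\lambda$ is the inverse limit of the $W_{\lambda^{(n)}}$, $n\ge n_\lambda$, along the $\Phi^{(n)}_\lambda$ (families $(f_n)$ with $f_n\in W_{\lambda^{(n)}}$ and $\Phi^{(n)}_\lambda(f_{n+1})=f_n$), and $\widetilde W_\lambda$ is its subspace of elements of bounded $X$-degree. $\Omega(\lambda)$ is the set of finitely supported $T:\lambda^{(\infty)}\to\mathbb{Z}_{\ge0}$ that decrease weakly along rows and strictly down columns. **Statement.** Let $\lambda$ be a partition. 1. For all $n\ge n_\lambda$ the objects above are well defined: $\pi_n$ acts invertibly on $V_{\lambda^{(n)}}$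 (for $n\ge 1$), and the family $(F_\tau)_{\tau\in\mathrm{PSYT}(\lambda^{(n)})}$, the elements $P_T$ for $T\in\mathrm{RSSYT}(\lambda^{(n)})$, and the map $\Phi_\lambda^{(n)}$ exist and are unique. 2. Let $n\ge n_\lambda$, $T\in\mathrm{RSSYT}(\lambda^{(n)})$ and $T'\in\mathrm{RSSYT}(\lambda^{(n+1)})$ be such that $T(\square)=T'(\square)$ for all $\square\in\lambda^{(n)}$ and $T'(\square_0)=0$. Then $\Phi^{(n)}_\lambda(P_{T'})=P_T$. 3. Hence the limits $\mathfrak{P}_T=\lim_nP_{T|_{\lambda^{(n)}}}\in\widetilde W_\lambda$ are well defined for $T\in\Omega(\lambda)$: every restriction $T|_{\lambda^{(n)}}$ lies in $\mathrm{RSSYT}(\lambda^{(n)})$, and there is exactly one element of $W_\lambda^{(\infty)}$ whose $n$-th component is $P_{T|_{\lambda^{(n)}}}$ for all sufficiently large $n$. It lies in $\widetilde W_\lambda$, and its $n$-th component is $P_{T|_{\lambda^{(n)}}}$ for every $n\ge n_\lambda$ such that $T$ vanishes outside $\lambda^{(n)}$. -/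

import Mathlib

open scoped TensorProduct

noncomputable section

namespace Murnaghan

/-! # The ground field `ℚ(q,t)` -/

/-- The field `ℚ(q,t)` of rational functions in two variables. -/
def Kqt : Type := FractionRing (MvPolynomial (Fin 2) ℚ)

instance : Field Kqt := inferInstanceAs (Field (FractionRing (MvPolynomial (Fin 2) ℚ)))

/-- The embedding of polynomials in rational functions. -/
def polyToKqt : MvPolynomial (Fin 2) ℚ →+* Kqt :=
  algebraMap (MvPolynomial (Fin 2) ℚ) (FractionRing (MvPolynomial (Fin 2) ℚ))

theorem polyToKqt_injective : Function.Injective polyToKqt :=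
  FaithfulSMul.algebraMap_injective (MvPolynomial (Fin 2) ℚ)
    (FractionRing (MvPolynomial (Fin 2) ℚ))

/-- The variable `q`. -/
def q : Kqt := polyToKqt (MvPolynomial.X 0)

/-- The variable `t`. -/
def t : Kqt := polyToKqt (MvPolynomial.X 1)

theorem t_ne_zero : t ≠ 0 := fun h =>
  MvPolynomial.X_ne_zero (1 : Fin 2) (polyToKqt_injective (h.trans (map_zero polyToKqt).symm))

/-! # Young diagrams and tableaux

A box is a pair `(row, column)`, both counted from `0`, as in `YoungDiagram`.
The labels `1, …, n` are represented by `Fin n` (so they too are counted from `0`). -/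

/-- The content (column minus row) of a box. -/
def content (c : ℕ × ℕ) : ℤ := (c.2 : ℤ) - (c.1 : ℤ)

/-- `d` lies strictly to the right of `c`, in the same row. -/
def RowBefore (c d : ℕ × ℕ) : Prop := c.1 = d.1 ∧ c.2 < d.2

/-- `d` lies strictly below `c`, in the same column. -/
def ColBefore (c d : ℕ × ℕ) : Prop := c.2 = d.2 ∧ c.1 < d.1

/-- For `1 ≤ i ≤ n - 1`, the number `i` as an element of `{1, …, n}`. -/
def lo {n : ℕ} (i : Fin (n - 1)) : Fin n := ⟨i.1, by omega⟩

/-- For `1 ≤ i ≤ n - 1`, the number `i + 1` as an element of `{1, …, n}`. -/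
def hi {n : ℕ} (i : Fin (n - 1)) : Fin n := ⟨i.1 + 1, by omega⟩

/-- Reverse semi-standard Young tableaux: labellings of the boxes by nonnegative integers, weakly
decreasing along rows and strictly decreasing along columns. -/
def IsRSSYT {μ : YoungDiagram} (T : μ.cells → ℕ) : Prop :=
  (∀ c d : μ.cells, RowBefore c d → T d ≤ T c) ∧ (∀ c d : μ.cells, ColBefore c d → T d < T c)

/-- Standard Young tableaux with `n` boxes (there are none unless `μ` has `n` boxes). -/
@[ext] structure SYT (n : ℕ) (μ : YoungDiagram) where
  /-- the label of a box -/
  idx : μ.cells ≃ Fin n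
  strict : ∀ c d : μ.cells, RowBefore c d ∨ ColBefore c d → idx c < idx d

/-- Periodic standard Young tableaux: the box `c` carries the label `(idx c) q ^ (wt c)`, each
`1 ≤ j ≤ n` is used exactly once, and labels increase strictly along rows and columns, where
`j q ^ m < k q ^ l` means that `m > l`, or `m = l` and `j < k`. -/
@[ext] structure PSYT (n : ℕ) (μ : YoungDiagram) where
  /-- the number `j` in the label `j q ^ b` of a box -/
  idx : μ.cells ≃ Fin n
  /-- the exponent `b` in the label `j q ^ b` of a box -/
  wt : μ.cells → ℕ
  strict : ∀ c d : μ.cells, RowBefore c d ∨ ColBefore c d →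
    wt d < wt c ∨ (wt c = wt d ∧ idx c < idx d)

/-- A standard tableau, seen as a periodic one. -/
def SYT.toPSYT {n : ℕ} {μ : YoungDiagram} (τ : SYT n μ) : PSYT n μ where
  idx := τ.idx
  wt := fun _ => 0
  strict := fun c d h => Or.inr ⟨rfl, τ.strict c d h⟩

/-- The content `c_τ(i)` of the box whose label involves `i`. -/
def PSYT.c {n : ℕ} {μ : YoungDiagram} (τ : PSYT n μ) (i : Fin n) : ℤ := content (τ.idx.symm i)

/-- The exponent `w_τ(i)` of `q` in the label that involves `i`. -/
def PSYT.w {n : ℕ} {μ : YoungDiagram} (τ : PSYT n μ) (i : Fin n) : ℕ := τ.wt (τ.idx.symm i)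

/-- `τ' = s_i(τ)`: the numbers `i` and `i + 1` are exchanged, the exponents stay in place. -/
def PSYT.IsSwap {n : ℕ} {μ : YoungDiagram} (i : Fin (n - 1)) (τ τ' : PSYT n μ) : Prop :=
  τ'.idx = τ.idx.trans (Equiv.swap (lo i) (hi i)) ∧ τ'.wt = τ.wt

/-- `τ' = s_i(τ)` and `s_i(τ) > τ`. -/
def PSYT.SwapUp {n : ℕ} {μ : YoungDiagram} (i : Fin (n - 1)) (τ τ' : PSYT n μ) : Prop :=
  PSYT.IsSwap i τ τ' ∧
    (τ.w (lo i) < τ.w (hi i) ∨ (τ.w (lo i) = τ.w (hi i) ∧ 1 < τ.c (lo i) - τ.c (hi i)))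

/-- `τ' = Ψ(τ)`: a label `k q ^ a` becomes `(k - 1) q ^ a` if `k ≥ 2`, and `1 q ^ a` becomes
`n q ^ (a + 1)`. -/
def PSYT.IsPsi {n : ℕ} {μ : YoungDiagram} (τ τ' : PSYT n μ) : Prop :=
  ∀ c : μ.cells,
    (1 ≤ (τ.idx c : ℕ) → (τ'.idx c : ℕ) + 1 = (τ.idx c : ℕ) ∧ τ'.wt c = τ.wt c) ∧
    ((τ.idx c : ℕ) = 0 → (τ'.idx c : ℕ) + 1 = n ∧ τ'.wt c = τ.wt c + 1)

/-- The relations that generate the partial order on periodic standard tableaux. -/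
def PSYT.Covers {n : ℕ} {μ : YoungDiagram} (τ τ' : PSYT n μ) : Prop :=
  PSYT.IsPsi τ τ' ∨ ∃ i, PSYT.SwapUp i τ τ'

/-- The partial order on periodic standard tableaux. -/
def PSYT.Le {n : ℕ} {μ : YoungDiagram} : PSYT n μ → PSYT n μ → Prop :=
  Relation.ReflTransGen PSYT.Covers

/-- `τ = Top(T)`: the largest periodic standard tableau with exponents given by `T`. -/
def PSYT.IsTop {n : ℕ} {μ : YoungDiagram} (T : μ.cells → ℕ) (τ : PSYT n μ) : Prop :=
  τ.wt = T ∧ ∀ σ : PSYT n μ, σ.wt = T → PSYT.Le σ τ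

/-- `n_λ = |λ| + λ_1`. -/
def nMin (lam : YoungDiagram) : ℕ := lam.card + lam.rowLen 0

/-- The diagram `λ^(n) = (n - |λ|, λ_1, λ_2, …)`, for `n ≥ n_λ`. -/
def ext (lam : YoungDiagram) (n : ℕ) (h : nMin lam ≤ n) : YoungDiagram :=
  YoungDiagram.ofRowLens ((n - lam.card) :: lam.rowLens) (by
    have hs := lam.rowLens_sorted
    rw [List.sortedGE_iff_pairwise] at hs ⊢
    refine List.pairwise_cons.2 ⟨fun a ha => ?_, hs⟩
    obtain ⟨i, -, rfl⟩ := List.mem_map.1 ha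
    have h1 := lam.rowLen_anti 0 i (Nat.zero_le i)
    unfold nMin at h
    show lam.rowLen i ≤ n - lam.card
    omega)

/-- The set of boxes of the infinite diagram `λ^(∞)`. -/
def extInf (lam : YoungDiagram) : Set (ℕ × ℕ) :=
  {c | ∃ (n : ℕ) (h : nMin lam ≤ n), c ∈ (ext lam n h).cells}

/-- The set `Ω(λ)`: finitely supported labellings of `λ^(∞)`, weakly decreasing along rows and
strictly decreasing along columns. -/
def IsOmega {lam : YoungDiagram} (T : extInf lam → ℕ) : Prop :=
  {c | T c ≠ 0}.Finite ∧
  (∀ c d : extInf lam, RowBefore c d → T d ≤ T c) ∧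
  (∀ c d : extInf lam, ColBefore c d → T d < T c)

/-- The restriction of a labelling of `λ^(∞)` to `λ^(n)`. -/
def restrictTo {lam : YoungDiagram} (T : extInf lam → ℕ) (n : ℕ) (h : nMin lam ≤ n) :
    (ext lam n h).cells → ℕ :=
  fun c => T ⟨c.1, n, h, c.2⟩

/-! # Hecke algebras -/

section elements

variable {R : Type} [Semiring R] [Algebra Kqt R]

/-- The inverse of `T` as soon as `(T - 1) * (T + t) = 0`. -/
def tInv (T : R) : R := t⁻¹ • (T + algebraMap Kqt R (t - 1))

/-- `π_n = t ^ (n - 1) θ_1 T_1⁻¹ ⋯ T_{n-1}⁻¹`, for `n ≥ 1`. -/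
def piElt {n : ℕ} (hn : 0 < n) (T : Fin (n - 1) → R) (θ : Fin n → R) : R :=
  t ^ (n - 1) • (θ ⟨0, hn⟩ * (List.ofFn fun i => tInv (T i)).prod)

end elements

/-- The `ℚ(q,t)`-algebra with generators `X` and relations `x = y` for `r x y`. -/
def Presented {X : Type} (r : FreeAlgebra Kqt X → FreeAlgebra Kqt X → Prop) : Type := RingQuot r

section presented

variable {X : Type} (r : FreeAlgebra Kqt X → FreeAlgebra Kqt X → Prop)

instance : Semiring (Presented r) := inferInstanceAs (Semiring (RingQuot r))

instance : Algebra Kqt (Presented r) := inferInstanceAs (Algebra Kqt (RingQuot r))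

instance : Ring (Presented r) := Algebra.semiringToRing Kqt

/-- The projection of the free algebra onto an algebra with given relations. -/
def Presented.mk : FreeAlgebra Kqt X →ₐ[Kqt] Presented r := RingQuot.mkAlgHom Kqt r

variable {r}

theorem Presented.mk_rel {x y : FreeAlgebra Kqt X} (h : r x y) :
    Presented.mk r x = Presented.mk r y := RingQuot.mkAlgHom_rel Kqt h

/-- The homomorphism with given values on the generators, provided the relations hold. -/
def Presented.lift {R : Type} [Ring R] [Algebra Kqt R] (f : X → R)
    (h : ∀ ⦃x y⦄, r x y → FreeAlgebra.lift Kqt f x = FreeAlgebra.lift Kqt f y) :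
    Presented r →ₐ[Kqt] R :=
  RingQuot.liftAlgHom Kqt ⟨FreeAlgebra.lift Kqt f, h⟩

theorem Presented.lift_mk {R : Type} [Ring R] [Algebra Kqt R] (f : X → R)
    (h : ∀ ⦃x y⦄, r x y → FreeAlgebra.lift Kqt f x = FreeAlgebra.lift Kqt f y)
    (x : FreeAlgebra Kqt X) :
    Presented.lift f h (Presented.mk r x) = FreeAlgebra.lift Kqt f x :=
  RingQuot.liftAlgHom_mkAlgHom_apply Kqt (FreeAlgebra.lift Kqt f) h x

end presented

/-- Relations of the finite Hecke algebra. -/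
inductive HRel (n : ℕ) :
    FreeAlgebra Kqt (Fin (n - 1)) → FreeAlgebra Kqt (Fin (n - 1)) → Prop
  | quad (i) : HRel n ((FreeAlgebra.ι Kqt i - 1) * (FreeAlgebra.ι Kqt i + algebraMap Kqt _ t)) 0
  | braid (i j : Fin (n - 1)) (h : (j : ℕ) = i + 1) :
      HRel n (FreeAlgebra.ι Kqt i * FreeAlgebra.ι Kqt j * FreeAlgebra.ι Kqt i)
        (FreeAlgebra.ι Kqt j * FreeAlgebra.ι Kqt i * FreeAlgebra.ι Kqt j)
  | far (i j : Fin (n - 1)) (h : (i : ℕ) + 1 < j) :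
      HRel n (FreeAlgebra.ι Kqt i * FreeAlgebra.ι Kqt j)
        (FreeAlgebra.ι Kqt j * FreeAlgebra.ι Kqt i)

/-- The finite Hecke algebra `H_n`. -/
abbrev Hecke (n : ℕ) : Type := Presented (HRel n)

/-- The generator `T_i` of `H_n`. -/
def Hecke.T {n : ℕ} (i : Fin (n - 1)) : Hecke n :=
  Presented.mk (HRel n) (FreeAlgebra.ι Kqt i)

/-- Generators of the positive affine Hecke algebra. -/
inductive AGen (n : ℕ) : Type
  | T (i : Fin (n - 1)) : AGen n
  | θ (i : Fin n) : AGen n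

/-- The generator `T_i`, in the free algebra. -/
def AGen.fT {n : ℕ} (i : Fin (n - 1)) : FreeAlgebra Kqt (AGen n) := FreeAlgebra.ι Kqt (.T i)

/-- The generator `θ_i`, in the free algebra. -/
def AGen.fθ {n : ℕ} (i : Fin n) : FreeAlgebra Kqt (AGen n) := FreeAlgebra.ι Kqt (.θ i)

open AGen in
/-- Relations of the positive affine Hecke algebra. -/
inductive ARel (n : ℕ) : FreeAlgebra Kqt (AGen n) → FreeAlgebra Kqt (AGen n) → Prop
  | quad (i) : ARel n ((fT i - 1) * (fT i + algebraMap Kqt _ t)) 0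
  | braid (i j : Fin (n - 1)) (h : (j : ℕ) = i + 1) :
      ARel n (fT i * fT j * fT i) (fT j * fT i * fT j)
  | far (i j : Fin (n - 1)) (h : (i : ℕ) + 1 < j) : ARel n (fT i * fT j) (fT j * fT i)
  | θθ (i j : Fin n) : ARel n (fθ i * fθ j) (fθ j * fθ i)
  | θsucc (i : Fin (n - 1)) : ARel n (fθ (hi i)) (t • (tInv (fT i) * fθ (lo i) * tInv (fT i)))
  | Tθ (i : Fin (n - 1)) (j : Fin n) (h : j ≠ lo i ∧ j ≠ hi i) : ARel n (fT i * fθ j) (fθ j * fT i)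

/-- The positive affine Hecke algebra `A_n`. -/
abbrev Affine (n : ℕ) : Type := Presented (ARel n)

/-- The generator `T_i` of `A_n`. -/
def Affine.T {n : ℕ} (i : Fin (n - 1)) : Affine n := Presented.mk (ARel n) (AGen.fT i)

/-- The generator `θ_i` of `A_n`. -/
def Affine.θ {n : ℕ} (i : Fin n) : Affine n := Presented.mk (ARel n) (AGen.fθ i)

/-- Generators of the positive double affine Hecke algebra. -/
inductive DGen (n : ℕ) : Type
  | T (i : Fin (n - 1)) : DGen n
  | θ (i : Fin n) : DGen n
  | X (i : Fin n) : DGen n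

/-- The generator `T_i`, in the free algebra. -/
def DGen.fT {n : ℕ} (i : Fin (n - 1)) : FreeAlgebra Kqt (DGen n) := FreeAlgebra.ι Kqt (.T i)

/-- The generator `θ_i`, in the free algebra. -/
def DGen.fθ {n : ℕ} (i : Fin n) : FreeAlgebra Kqt (DGen n) := FreeAlgebra.ι Kqt (.θ i)

/-- The generator `X_i`, in the free algebra. -/
def DGen.fX {n : ℕ} (i : Fin n) : FreeAlgebra Kqt (DGen n) := FreeAlgebra.ι Kqt (.X i)

open DGen in
/-- Relations of the positive double affine Hecke algebra. -/
inductive DRel (n : ℕ) : FreeAlgebra Kqt (DGen n) → FreeAlgebra Kqt (DGen n) → Prop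
  | quad (i) : DRel n ((fT i - 1) * (fT i + algebraMap Kqt _ t)) 0
  | braid (i j : Fin (n - 1)) (h : (j : ℕ) = i + 1) :
      DRel n (fT i * fT j * fT i) (fT j * fT i * fT j)
  | far (i j : Fin (n - 1)) (h : (i : ℕ) + 1 < j) : DRel n (fT i * fT j) (fT j * fT i)
  | θθ (i j : Fin n) : DRel n (fθ i * fθ j) (fθ j * fθ i)
  | θsucc (i : Fin (n - 1)) : DRel n (fθ (hi i)) (t • (tInv (fT i) * fθ (lo i) * tInv (fT i)))
  | Tθ (i : Fin (n - 1)) (j : Fin n) (h : j ≠ lo i ∧ j ≠ hi i) : DRel n (fT i * fθ j) (fθ j * fT i)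
  | XX (i j : Fin n) : DRel n (fX i * fX j) (fX j * fX i)
  | Xsucc (i : Fin (n - 1)) : DRel n (fX (hi i)) (t • (tInv (fT i) * fX (lo i) * tInv (fT i)))
  | TX (i : Fin (n - 1)) (j : Fin n) (h : j ≠ lo i ∧ j ≠ hi i) : DRel n (fT i * fX j) (fX j * fT i)
  | πX (hn : 0 < n) (i : Fin (n - 1)) :
      DRel n (piElt hn fT fθ * fX (lo i)) (fX (hi i) * piElt hn fT fθ)
  | πXlast (hn : 0 < n) :
      DRel n (piElt hn fT fθ * fX ⟨n - 1, by omega⟩) (q • (fX ⟨0, hn⟩ * piElt hn fT fθ))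

/-- The positive double affine Hecke algebra `D_n`. -/
abbrev DAHA (n : ℕ) : Type := Presented (DRel n)

/-- The generator `T_i` of `D_n`. -/
def DAHA.T {n : ℕ} (i : Fin (n - 1)) : DAHA n := Presented.mk (DRel n) (DGen.fT i)

/-- The generator `θ_i` of `D_n`. -/
def DAHA.θ {n : ℕ} (i : Fin n) : DAHA n := Presented.mk (DRel n) (DGen.fθ i)

/-- The generator `X_i` of `D_n`. -/
def DAHA.X {n : ℕ} (i : Fin n) : DAHA n := Presented.mk (DRel n) (DGen.fX i)

/-- The element `π_n` of `D_n`. -/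
def DAHA.π {n : ℕ} (hn : 0 < n) : DAHA n := piElt hn DAHA.T DAHA.θ

theorem map_tInv {R S : Type} [Semiring R] [Algebra Kqt R] [Semiring S] [Algebra Kqt S]
    (f : R →ₐ[Kqt] S) (x : R) : f (tInv x) = tInv (f x) := by
  simp [tInv]

/-! Consequences of the relations of `H_n`. -/

section heckeFacts

variable {n : ℕ}

theorem Hecke.quad (i : Fin (n - 1)) :
    (Hecke.T i - 1) * (Hecke.T i + algebraMap Kqt _ t) = 0 := by
  simpa [Hecke.T] using Presented.mk_rel (HRel.quad (n := n) i)

theorem Hecke.braid (i j : Fin (n - 1)) (h : (j : ℕ) = i + 1) :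
    Hecke.T i * Hecke.T j * Hecke.T i = Hecke.T j * Hecke.T i * Hecke.T j := by
  simpa [Hecke.T] using Presented.mk_rel (HRel.braid (n := n) i j h)

theorem Hecke.far (i j : Fin (n - 1)) (h : (i : ℕ) + 1 < j) :
    Commute (Hecke.T i) (Hecke.T j) := by
  show _ = _
  simpa [Hecke.T] using Presented.mk_rel (HRel.far (n := n) i j h)

theorem tInv_comm {R : Type} [Ring R] [Algebra Kqt R] {x y : R} (h : Commute x y) :
    Commute x (tInv y) :=
  (h.add_right (Algebra.commute_algebraMap_right _ _)).smul_right _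

theorem mul_tInv {R : Type} [Ring R] [Algebra Kqt R] {x : R}
    (h : (x - 1) * (x + algebraMap Kqt _ t) = 0) : x * tInv x = 1 := by
  have h1 : x * (x + algebraMap Kqt R (t - 1)) = algebraMap Kqt R t := by
    rw [map_sub, map_one]
    have e : x * (x + (algebraMap Kqt R t - 1)) =
      (x - 1) * (x + algebraMap Kqt _ t) + algebraMap Kqt R t := by noncomm_ring
    rw [e, h, zero_add]
  rw [tInv, mul_smul_comm, h1, Algebra.algebraMap_eq_smul_one, smul_smul,
    inv_mul_cancel₀ t_ne_zero, one_smul]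

theorem tInv_mul {R : Type} [Ring R] [Algebra Kqt R] {x : R}
    (h : (x - 1) * (x + algebraMap Kqt _ t) = 0) : tInv x * x = 1 := by
  rw [← (tInv_comm (Commute.refl x)).eq, mul_tInv h]

/-- `θbar_1 = 1` and `θbar_{i+1} = t T_i⁻¹ θbar_i T_i⁻¹`. -/
def Hecke.θbarAux (n : ℕ) : (i : ℕ) → i < n → Hecke n
  | 0, _ => 1
  | i + 1, h =>
    t • (tInv (Hecke.T ⟨i, by omega⟩) * Hecke.θbarAux n i (by omega) *
      tInv (Hecke.T ⟨i, by omega⟩))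

/-- The Jucys-Murphy type elements of `H_n`. -/
def Hecke.θbar (i : Fin n) : Hecke n := Hecke.θbarAux n i.1 i.2

/-- `φbar_i = (t T_i⁻¹) θbar_i - θbar_i (t T_i⁻¹)`. -/
def Hecke.φbar (i : Fin (n - 1)) : Hecke n :=
  (t • tInv (Hecke.T i)) * Hecke.θbar (lo i) - Hecke.θbar (lo i) * (t • tInv (Hecke.T i))

theorem Hecke.comm_low (i : Fin (n - 1)) (k : ℕ) (hk : k < n) (h : k < i) :
    Commute (Hecke.T i) (Hecke.θbarAux n k hk) := by
  induction k with
  | zero => exact Commute.one_right _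
  | succ k ih =>
    have h1 : Commute (Hecke.T i) (tInv (Hecke.T ⟨k, by omega⟩)) :=
      tInv_comm (Hecke.far ⟨k, by omega⟩ i h).symm
    exact ((h1.mul_right (ih (by omega) (by omega))).mul_right h1).smul_right _

theorem Hecke.comm_high (i : Fin (n - 1)) (k : ℕ) (hk : k < n) (h : (i : ℕ) + 1 < k) :
    Commute (Hecke.T i) (Hecke.θbarAux n k hk) := by
  induction k with
  | zero => omega
  | succ k ih =>
    rcases Nat.lt_or_ge ((i : ℕ) + 1) k with h' | h'
    · have h1 : Commute (Hecke.T i) (tInv (Hecke.T ⟨k, by omega⟩)) :=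
        tInv_comm (Hecke.far i ⟨k, by omega⟩ h')
      exact ((h1.mul_right (ih (by omega) h')).mul_right h1).smul_right _
    · obtain rfl : k = (i : ℕ) + 1 := by omega
      set j : Fin (n - 1) := ⟨(i : ℕ) + 1, by omega⟩ with hj
      have key : Hecke.θbarAux n ((i : ℕ) + 1 + 1) hk =
          t • (tInv (Hecke.T j) * (t • (tInv (Hecke.T i) *
            Hecke.θbarAux n i (by omega) * tInv (Hecke.T i))) * tInv (Hecke.T j)) := rfl
      rw [key]
      have hc := Hecke.comm_low j (i : ℕ) (by omega) (by simp [hj])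
      generalize Hecke.θbarAux n i (by omega) = z at hc
      have hb := Hecke.braid i j rfl
      have ha1 := mul_tInv (Hecke.quad i)
      have ha2 := tInv_mul (Hecke.quad i)
      have hb1 := mul_tInv (Hecke.quad j)
      have hb2 := tInv_mul (Hecke.quad j)
      generalize tInv (Hecke.T i) = a' at *
      generalize tInv (Hecke.T j) = b' at *
      generalize Hecke.T i = a at *
      generalize Hecke.T j = b at *
      have e1 : a * b' * a' = b' * a' * b := by
        calc a * b' * a' = (b' * (a' * a) * b) * (a * b' * a') := by
              rw [ha2, mul_one, hb2, one_mul]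
          _ = b' * a' * (a * b * a) * b' * a' := by noncomm_ring
          _ = b' * a' * b * (a * (b * b') * a') := by rw [hb]; noncomm_ring
          _ = b' * a' * b := by rw [hb1, mul_one, ha1, mul_one]
      have e2 : a' * b' * a = b * a' * b' := by
        calc a' * b' * a = (a' * b' * a) * (b * (a * a') * b') := by
              rw [ha1, mul_one, hb1, mul_one]
          _ = a' * b' * (a * b * a) * a' * b' := by noncomm_ring
          _ = (a' * (b' * b) * a) * b * a' * b' := by rw [hb]; noncomm_ring
          _ = b * a' * b' := by rw [hb2, mul_one, ha2, one_mul]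
      have e3 : Commute a (b' * (a' * z * a') * b') := by
        show _ = _
        calc a * (b' * (a' * z * a') * b') = (a * b' * a') * z * a' * b' := by noncomm_ring
          _ = b' * a' * (b * z) * a' * b' := by rw [e1]; noncomm_ring
          _ = b' * a' * z * (b * a' * b') := by rw [hc.eq]; noncomm_ring
          _ = (b' * (a' * z * a') * b') * a := by rw [← e2]; noncomm_ring
      rw [mul_smul_comm, smul_mul_assoc]
      exact (e3.smul_right _).smul_right _

theorem tInv_comm' {R : Type} [Ring R] [Algebra Kqt R] {x y : R} (h : Commute x y) :
    Commute (tInv x) y := (tInv_comm h.symm).symm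

theorem Hecke.θbar_comm_aux (j k : ℕ) (hj : j < n) (hk : k < n) (h : j < k) :
    Commute (Hecke.θbarAux n j hj) (Hecke.θbarAux n k hk) := by
  induction j with
  | zero => exact Commute.one_left _
  | succ j ih =>
    have h1 : Commute (tInv (Hecke.T ⟨j, by omega⟩)) (Hecke.θbarAux n k hk) :=
      tInv_comm' (Hecke.comm_high ⟨j, by omega⟩ k hk h)
    exact ((h1.mul_left (ih (by omega) (by omega))).mul_left h1).smul_left _

theorem Hecke.θbar_comm (i j : Fin n) : Commute (Hecke.θbar i) (Hecke.θbar j) := by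
  rcases lt_trichotomy i j with h | h | h
  · exact Hecke.θbar_comm_aux _ _ i.2 j.2 h
  · rw [h]
  · exact (Hecke.θbar_comm_aux _ _ j.2 i.2 h).symm

theorem Hecke.T_comm_θbar (i : Fin (n - 1)) (j : Fin n) (h : j ≠ lo i ∧ j ≠ hi i) :
    Commute (Hecke.T i) (Hecke.θbar j) := by
  have h1 : (j : ℕ) ≠ i := fun e => h.1 (Fin.ext e)
  have h2 : (j : ℕ) ≠ i + 1 := fun e => h.2 (Fin.ext e)
  rcases Nat.lt_or_ge (j : ℕ) i with h3 | h3
  · exact Hecke.comm_low i j j.2 h3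
  · exact Hecke.comm_high i j j.2 (by omega)

/-- The values of `ρ_n` on the generators. -/
def rhoGen : AGen n → Hecke n
  | .T i => Hecke.T i
  | .θ i => Hecke.θbar i

theorem rhoGen_rel ⦃x y : FreeAlgebra Kqt (AGen n)⦄ (h : ARel n x y) :
    FreeAlgebra.lift Kqt (rhoGen (n := n)) x = FreeAlgebra.lift Kqt (rhoGen (n := n)) y := by
  have hT : ∀ i, FreeAlgebra.lift Kqt (rhoGen (n := n)) (AGen.fT i) = Hecke.T i := fun i => by
    simp [AGen.fT, rhoGen]
  have hθ : ∀ i, FreeAlgebra.lift Kqt (rhoGen (n := n)) (AGen.fθ i) = Hecke.θbar i := fun i => by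
    simp [AGen.fθ, rhoGen]
  cases h with
  | quad i => simpa [hT] using Hecke.quad i
  | braid i j h => simpa [hT] using Hecke.braid i j h
  | far i j h => simpa [hT] using (Hecke.far i j h).eq
  | θθ i j => simpa [hθ] using (Hecke.θbar_comm i j).eq
  | θsucc i => simp only [hθ, hT, map_smul, map_mul, map_tInv]; rfl
  | Tθ i j h => simpa [hT, hθ] using (Hecke.T_comm_θbar i j h).eq

end heckeFacts

/-- The homomorphism `ρ_n : A_n → H_n` with `ρ_n(T_i) = T_i` and `ρ_n(θ_i) = θbar_i`. -/
def rho (n : ℕ) : Affine n →ₐ[Kqt] Hecke n :=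
  Presented.lift rhoGen rhoGen_rel

/-- The homomorphism `A_n → D_n` that maps generators to generators. -/
def affineToDAHA (n : ℕ) : Affine n →ₐ[Kqt] DAHA n :=
  Presented.lift (fun g => match g with
      | .T i => DAHA.T i
      | .θ i => DAHA.θ i) (by
    intro x y h
    set f := FreeAlgebra.lift Kqt (fun g : AGen n => match g with
      | .T i => (DAHA.T i : DAHA n)
      | .θ i => DAHA.θ i) with hf
    have hT : ∀ i, f (AGen.fT i) = DAHA.T i := fun i => by simp [hf, AGen.fT]
    have hθ : ∀ i, f (AGen.fθ i) = DAHA.θ i := fun i => by simp [hf, AGen.fθ]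
    cases h with
    | quad i => simpa [hT, DAHA.T] using Presented.mk_rel (DRel.quad (n := n) i)
    | braid i j h => simpa [hT, DAHA.T] using Presented.mk_rel (DRel.braid (n := n) i j h)
    | far i j h => simpa [hT, DAHA.T] using Presented.mk_rel (DRel.far (n := n) i j h)
    | θθ i j => simpa [hθ, DAHA.θ] using Presented.mk_rel (DRel.θθ (n := n) i j)
    | θsucc i =>
      simpa [hθ, hT, DAHA.θ, DAHA.T, map_tInv] using
        Presented.mk_rel (DRel.θsucc (n := n) i)
    | Tθ i j h =>
      simpa [hθ, hT, DAHA.θ, DAHA.T] using Presented.mk_rel (DRel.Tθ (n := n) i j h))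

/-- The homomorphism `H_n → D_n` that maps generators to generators. -/
def heckeToDAHA (n : ℕ) : Hecke n →ₐ[Kqt] DAHA n :=
  Presented.lift DAHA.T (by
    intro x y h
    cases h with
    | quad i => simpa [DAHA.T] using Presented.mk_rel (DRel.quad (n := n) i)
    | braid i j h => simpa [DAHA.T] using Presented.mk_rel (DRel.braid (n := n) i j h)
    | far i j h => simpa [DAHA.T] using Presented.mk_rel (DRel.far (n := n) i j h))

/-! # The trivial idempotent -/

/-- The simple transposition `s_i`. -/
def simpleRefl {n : ℕ} (i : Fin (n - 1)) : Equiv.Perm (Fin n) := Equiv.swap (lo i) (hi i)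

/-- `l` is a reduced expression of the permutation `σ`. -/
def IsReducedWord {n : ℕ} (σ : Equiv.Perm (Fin n)) (l : List (Fin (n - 1))) : Prop :=
  (l.map simpleRefl).prod = σ ∧
    ∀ l' : List (Fin (n - 1)), (l'.map simpleRefl).prod = σ → l.length ≤ l'.length

/-- A reduced expression of `σ`. -/
def redWord {n : ℕ} (σ : Equiv.Perm (Fin n)) : List (Fin (n - 1)) :=
  Classical.epsilon (IsReducedWord σ)

/-- `T_σ`, the product of the generators along a reduced expression. -/
def Hecke.Tperm {n : ℕ} (σ : Equiv.Perm (Fin n)) : Hecke n := ((redWord σ).map Hecke.T).prod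

/-- `[n]_t! = ∏_{i=1}^n (1 - t ^ i) / (1 - t)`. -/
def tFactorial (n : ℕ) : Kqt := ∏ i ∈ Finset.Icc 1 n, (1 - t ^ i) / (1 - t)

/-- The normalized trivial idempotent of `H_n`; here `ℓ(σ)` is the length of a reduced expression. -/
def Hecke.ε (n : ℕ) : Hecke n :=
  (tFactorial n)⁻¹ • ∑ σ : Equiv.Perm (Fin n),
    t ^ ((n.choose 2 : ℤ) - ((redWord σ).length : ℤ)) • Hecke.Tperm σ

/-! # The modules `λ` and `V_λ` -/

/-- The defining relations of the irreducible `H_n`-module labelled by `μ`, on the generators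
`τ ∈ SYT(μ)`; `Finsupp.single τ a` stands for `a(τ)`. -/
def spechtRels (n : ℕ) (μ : YoungDiagram) : Set (SYT n μ →₀ Hecke n) :=
  {x | ∃ (τ : SYT n μ) (i : Fin n),
    x = Finsupp.single τ (Hecke.θbar i) - t ^ τ.toPSYT.c i • Finsupp.single τ (1 : Hecke n)} ∪
  {x | ∃ (i : Fin (n - 1)) (τ τ' : SYT n μ), PSYT.SwapUp i τ.toPSYT τ'.toPSYT ∧
    x = Finsupp.single τ (Hecke.φbar i) -
      (t ^ τ.toPSYT.c (lo i) - t ^ τ.toPSYT.c (hi i)) • Finsupp.single τ' (1 : Hecke n)} ∪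
  {x | ∃ (i : Fin (n - 1)) (τ : SYT n μ),
    (τ.idx.symm (lo i)).1.1 = (τ.idx.symm (hi i)).1.1 ∧
    x = Finsupp.single τ (Hecke.T i) - Finsupp.single τ (1 : Hecke n)} ∪
  {x | ∃ (i : Fin (n - 1)) (τ : SYT n μ),
    (τ.idx.symm (lo i)).1.2 = (τ.idx.symm (hi i)).1.2 ∧
    x = Finsupp.single τ (Hecke.T i) - (-t) • Finsupp.single τ (1 : Hecke n)}

/-- The irreducible `H_n`-module labelled by `μ`, given by generators and relations. -/
abbrev Specht (n : ℕ) (μ : YoungDiagram) : Type :=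
  (SYT n μ →₀ Hecke n) ⧸ Submodule.span (Hecke n) (spechtRels n μ)

/-- The vector `τ` of the module `μ`. -/
def Specht.of {n : ℕ} {μ : YoungDiagram} (τ : SYT n μ) : Specht n μ :=
  Submodule.Quotient.mk (Finsupp.single τ (1 : Hecke n))

/-- The relations `d a ⊗ v = d ⊗ a(v)`, for `a ∈ A_n`, where `A_n` acts on `μ` through `ρ_n`. -/
def indRels (n : ℕ) (μ : YoungDiagram) : Set (DAHA n ⊗[Kqt] Specht n μ) :=
  {x | ∃ (d : DAHA n) (a : Affine n) (v : Specht n μ),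
    x = (d * affineToDAHA n a) ⊗ₜ[Kqt] v - d ⊗ₜ[Kqt] (rho n a • v)}

/-- The `D_n`-module `V_μ`, induced from the `A_n`-module `ρ_n^*(μ)`. -/
abbrev V (n : ℕ) (μ : YoungDiagram) : Type :=
  (DAHA n ⊗[Kqt] Specht n μ) ⧸ Submodule.span (DAHA n) (indRels n μ)

/-- The vector `X^α ⊗ v` of `V_μ`. -/
def monoTensor {n : ℕ} {μ : YoungDiagram} (α : Fin n → ℕ) (v : Specht n μ) : V n μ :=
  Submodule.Quotient.mk ((List.ofFn fun i => DAHA.X i ^ α i).prod ⊗ₜ[Kqt] v)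

/-- The action of an element of `D_n` on `V_μ`, as a linear map. -/
def act {n : ℕ} (μ : YoungDiagram) (d : DAHA n) : Module.End Kqt (V n μ) :=
  Algebra.lsmul Kqt Kqt (V n μ) d

/-- The spherical subspace `W_μ = ε(V_μ)`. -/
def W (n : ℕ) (μ : YoungDiagram) : Submodule Kqt (V n μ) :=
  LinearMap.range (act μ (heckeToDAHA n (Hecke.ε n)))

/-- The elements of `X`-degree at most `d`. -/
def degLE (n : ℕ) (μ : YoungDiagram) (d : ℕ) : Submodule Kqt (V n μ) :=
  Submodule.span Kqt
    {x | ∃ (α : Fin n → ℕ) (τ : SYT n μ), ∑ i, α i ≤ d ∧ x = monoTensor α (Specht.of τ)}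

/-! # Vector-valued Macdonald polynomials -/

/-- The defining properties of the family of non-symmetric vector-valued Macdonald polynomials. -/
structure IsNonsymMacdonald (n : ℕ) (μ : YoungDiagram) (F : PSYT n μ → V n μ) : Prop where
  linInd : LinearIndependent Kqt F
  span : Submodule.span Kqt (Set.range F) = ⊤
  weight : ∀ (τ : PSYT n μ) (i : Fin n), DAHA.θ i • F τ = (q ^ τ.w i * t ^ τ.c i) • F τ
  standard : ∀ τ : SYT n μ, F τ.toPSYT = monoTensor 0 (Specht.of τ)
  swap : ∀ (i : Fin (n - 1)) (τ τ' : PSYT n μ), PSYT.SwapUp i τ τ' →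
    F τ' = t • tInv (DAHA.T i) • F τ +
      ((t - 1) * (q ^ τ.w (hi i) * t ^ τ.c (hi i)) /
        (q ^ τ.w (lo i) * t ^ τ.c (lo i) - q ^ τ.w (hi i) * t ^ τ.c (hi i))) • F τ
  psi : ∀ (hn : 0 < n) (τ τ' : PSYT n μ), PSYT.IsPsi τ τ' →
    F τ' = q ^ τ.w ⟨0, hn⟩ • DAHA.X ⟨n - 1, Nat.sub_lt hn one_pos⟩ • Ring.inverse (act μ (DAHA.π hn)) (F τ)

/-- The non-symmetric vector-valued Macdonald polynomials `F_τ`. -/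
def nonsymMacdonald (n : ℕ) (μ : YoungDiagram) : PSYT n μ → V n μ :=
  Classical.epsilon (IsNonsymMacdonald n μ)

/-- The subspace `U_T`, spanned by the `F_τ` with exponents given by `T`. -/
def U (n : ℕ) {μ : YoungDiagram} (T : μ.cells → ℕ) : Submodule Kqt (V n μ) :=
  Submodule.span Kqt {x | ∃ τ : PSYT n μ, τ.wt = T ∧ x = nonsymMacdonald n μ τ}

/-- `P ∈ ε(U_T)` has the form `F_{Top(T)} + ∑ κ_y F_y`, where the sum is over the `y ≠ Top(T)` with
exponents given by `T`. -/
def IsSymMacdonald (n : ℕ) {μ : YoungDiagram} (T : μ.cells → ℕ) (P : V n μ) : Prop :=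
  P ∈ (U n T).map (act μ (heckeToDAHA n (Hecke.ε n))) ∧
  ∃ τ : PSYT n μ, PSYT.IsTop T τ ∧
    P - nonsymMacdonald n μ τ ∈
      Submodule.span Kqt {x | ∃ y : PSYT n μ, y.wt = T ∧ y ≠ τ ∧ x = nonsymMacdonald n μ y}

/-- The symmetric vector-valued Macdonald polynomial `P_T`. -/
def symMacdonald (n : ℕ) {μ : YoungDiagram} (T : μ.cells → ℕ) : V n μ :=
  Classical.epsilon (IsSymMacdonald n T)

/-! # Connecting maps and stable limits -/

/-- `τ` is the restriction to `λ^(n)` of the standard tableau `τ'` of shape `λ^(n+1)`; this happens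
for some `τ` if and only if `τ'` has the entry `n + 1` in the added box. -/
def Restricts {lam : YoungDiagram} {n : ℕ} (h : nMin lam ≤ n)
    (τ' : SYT (n + 1) (ext lam (n + 1) (Nat.le_succ_of_le h))) (τ : SYT n (ext lam n h)) : Prop :=
  ∀ (c : ℕ × ℕ) (hc : c ∈ (ext lam n h).cells)
    (hc' : c ∈ (ext lam (n + 1) (Nat.le_succ_of_le h)).cells),
    (τ'.idx ⟨c, hc'⟩ : ℕ) = (τ.idx ⟨c, hc⟩ : ℕ)

/-- `v` is the value at `τ'` of the map from the module `λ^(n+1)` to the module `λ^(n)`: the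
restriction of `τ'` if the added box has the entry `n + 1`, and `0` otherwise. -/
def IsRestrictionValue {lam : YoungDiagram} {n : ℕ} (h : nMin lam ≤ n)
    (τ' : SYT (n + 1) (ext lam (n + 1) (Nat.le_succ_of_le h)))
    (v : Specht n (ext lam n h)) : Prop :=
  (∃ τ, Restricts h τ' τ ∧ v = Specht.of τ) ∨ ((¬ ∃ τ, Restricts h τ' τ) ∧ v = 0)

/-- The defining property of the connecting map: `X^α ⊗ τ'` is sent to
`1(α_{n+1} = 0) X_1^{α_1} ⋯ X_n^{α_n} ⊗ v`, where `v` is the image of `τ'`. -/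
def IsConnectingMap (lam : YoungDiagram) (n : ℕ) (h : nMin lam ≤ n)
    (Φ : V (n + 1) (ext lam (n + 1) (Nat.le_succ_of_le h)) →ₗ[Kqt] V n (ext lam n h)) : Prop :=
  ∀ (α : Fin (n + 1) → ℕ) (τ' : SYT (n + 1) (ext lam (n + 1) (Nat.le_succ_of_le h)))
    (v : Specht n (ext lam n h)), IsRestrictionValue h τ' v →
    Φ (monoTensor α (Specht.of τ')) =
      if α (Fin.last n) = 0 then monoTensor (fun i => α i.castSucc) v else 0

/-- The connecting map `Φ^(n)_λ`. -/
def connectingMap (lam : YoungDiagram) (n : ℕ) (h : nMin lam ≤ n) :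
    V (n + 1) (ext lam (n + 1) (Nat.le_succ_of_le h)) →ₗ[Kqt] V n (ext lam n h) :=
  Classical.epsilon (IsConnectingMap lam n h)

/-- Families with a component in `V_{λ^(n)}` for every `n ≥ n_λ`. -/
abbrev VFamily (lam : YoungDiagram) : Type :=
  (m : {n : ℕ // nMin lam ≤ n}) → V m.1 (ext lam m.1 m.2)

/-- The inverse limit `W_λ^(∞)` of the spaces `W_{λ^(n)}`, `n ≥ n_λ`. -/
def Winf (lam : YoungDiagram) : Submodule Kqt (VFamily lam) where
  carrier := {f | (∀ m, f m ∈ W m.1 (ext lam m.1 m.2)) ∧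
    ∀ (n : ℕ) (h : nMin lam ≤ n),
      connectingMap lam n h (f ⟨n + 1, Nat.le_succ_of_le h⟩) = f ⟨n, h⟩}
  add_mem' := fun hf hg => ⟨fun m => add_mem (hf.1 m) (hg.1 m), fun n h => by
    simp only [Pi.add_apply, map_add, hf.2 n h, hg.2 n h]⟩
  zero_mem' := ⟨fun _ => zero_mem _, fun _ _ => by simp⟩
  smul_mem' := fun a _ hf => ⟨fun m => Submodule.smul_mem _ a (hf.1 m), fun n h => by
    simp only [Pi.smul_apply, map_smul, hf.2 n h]⟩

/-- The space of the elements of `W_λ^(∞)` of bounded `X`-degree. -/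
def Wtilde (lam : YoungDiagram) : Submodule Kqt (VFamily lam) where
  carrier := {f | f ∈ Winf lam ∧ ∃ d, ∀ m, f m ∈ degLE m.1 (ext lam m.1 m.2) d}
  add_mem' := by
    rintro f g ⟨hf, d, hd⟩ ⟨hg, e, he⟩
    refine ⟨add_mem hf hg, max d e, fun m => add_mem ?_ ?_⟩
    · refine Submodule.span_mono ?_ (hd m)
      rintro x ⟨α, τ, h1, h2⟩
      exact ⟨α, τ, h1.trans (le_max_left _ _), h2⟩
    · refine Submodule.span_mono ?_ (he m)
      rintro x ⟨α, τ, h1, h2⟩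
      exact ⟨α, τ, h1.trans (le_max_right _ _), h2⟩
  zero_mem' := ⟨zero_mem _, 0, fun _ => zero_mem _⟩
  smul_mem' := fun a _ hf =>
    ⟨Submodule.smul_mem _ a hf.1, hf.2.choose, fun m =>
      Submodule.smul_mem _ a (hf.2.choose_spec m)⟩

/-- `f` is the limit of the vectors `P_{T|λ^(n)}`: from some `n` on, these are its components. -/
def IsMacDLimit {lam : YoungDiagram} (T : extInf lam → ℕ) (f : VFamily lam) : Prop :=
  ∃ N, ∀ (n : ℕ) (h : nMin lam ≤ n), N ≤ n → f ⟨n, h⟩ = symMacdonald n (restrictTo T n h)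

end Murnaghan

end

open Murnaghan

open scoped TensorProduct

noncomputable section

namespace Murnaghan

/-! # Facts on the ground field -/

/-! The induced module is replaced by an explicit model in which the polynomials are basis vectors;
the connecting map is then shown to respect everything that characterizes them.

Model. On the space spanned by all labellings, without row or column conditions, let `t T_i⁻¹` act
by a seminormal form in the eigenvalues `q^w t^c`, let `θ_i` act diagonally, and let `γ` be the
shift `Ψ` rescaled by a power of `q`; it plays the part of `X_n π_n⁻¹`. Exchanges and shifts are
defined for every labelling, so the relations become identities of rational functions wherever the
eigenvalues in the denominators differ. They differ for numbers at distance at most two in a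
periodic standard tableau (`PSYT.ev_ne`), and the off-diagonal coefficient vanishes when an exchange
would leave the set of tableaux (`offCoef_of_adj`). Hence the span of the tableaux inherits the
relations. By `exists_DAHA_hom`, an affine Hecke action with such a `γ` extends to the double affine
algebra, with `X_n = γ π_n`.

Comparison. The induced module is spanned by the `X^α ⊗ τ` (`V.span_mono`) and maps onto the model
(`V.toModel_surjective`). The pairs `(α, τ)` of degree `d` inject into the tableaux of total
exponent `d` (`PSYT.ofSYT_injective`), which index a basis of the degree `d` part of the model. A
spanning family with no more members than the dimension is a basis, so the map is an isomorphism and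
the monomials form a basis. This gives the connecting map, and the `F_τ` as preimages of basis
vectors. They are unique because the two recursions reach every tableau from a standard one
(`PSYT.induction`). The operator `π_n` is invertible because `θ_1` is diagonal with nonzero
eigenvalues.

Symmetrization. Since `T_i ε = ε` and `ε` acts on invariant vectors by a nonzero scalar, `ε(U_T)`
consists of the invariant vectors of `U_T`. Invariance expresses the coefficient at `τ` by the one
at `s_i(τ) > τ` (`V.coef_of_isInv`), and every tableau with exponents `T` rises to the one sorted by
decreasing exponents and increasing contents, which is `Top(T)`. So the leading coefficient
determines an invariant vector, and the product `PSYT.kappa` solves the recursion.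

Stability. The added box has larger content than all others. The connecting map `Φ` commutes with
`X_1, …, X_n` and `T_1, …, T_{n-1}` and kills the image of `X_{n+1}`. The main point is `Φ π_{n+1}
T_n = t π_n Φ` (`AddBox.conn_πT`): it amounts to `Φ θ_1 = θ_1 Φ`, and so yields all `θ_i` with `i ≤
n`. If a number `i ≤ n` lies in the added box of `τ'`, then `Φ(F_τ')` is a `θ_i`-eigenvector for a
content that does not occur in the smaller diagram, hence zero (`AddBox.conn_F_of_ne`). If `τ'`
extends `τ` by `n + 1` with exponent `0`, induction along the two recursions gives `Φ(F_τ') = F_τ`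
(`AddBox.conn_F_hat`). Therefore `Φ(P_T')` is invariant, lies in `U_T` and has leading coefficient
`1`, because `Top(T')` is the extension of `Top(T)`. Uniqueness makes it `P_T`. The limits are
obtained by applying the connecting maps often enough to the family of the `P`. -/

theorem q_ne_zero : q ≠ 0 := fun h =>
  MvPolynomial.X_ne_zero (0 : Fin 2) (polyToKqt_injective (h.trans (map_zero polyToKqt).symm))

/-- The monomial `q ^ a t ^ b`. -/
def qt (a : ℕ) (b : ℤ) : Kqt := q ^ a * t ^ b

theorem qt_ne_zero (a : ℕ) (b : ℤ) : qt a b ≠ 0 :=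
  mul_ne_zero (pow_ne_zero _ q_ne_zero) (zpow_ne_zero _ t_ne_zero)

theorem q_pow_mul_t_pow_inj {a b a' b' : ℕ} (h : q ^ a * t ^ b = q ^ a' * t ^ b') :
    a = a' ∧ b = b' := by
  have h1 : (MvPolynomial.monomial (Finsupp.single 0 a + Finsupp.single 1 b) 1 :
      MvPolynomial (Fin 2) ℚ) =
      MvPolynomial.monomial (Finsupp.single 0 a' + Finsupp.single 1 b') 1 := by
    apply polyToKqt_injective
    have e : ∀ x y : ℕ, polyToKqt (MvPolynomial.monomial (Finsupp.single 0 x + Finsupp.single 1 y) 1)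
        = q ^ x * t ^ y := fun x y => by
      rw [← mul_one (1 : ℚ), ← MvPolynomial.monomial_mul, ← MvPolynomial.X_pow_eq_monomial,
        ← MvPolynomial.X_pow_eq_monomial, map_mul, map_pow, map_pow]
      rfl
    rw [e, e, h]
  have h2 := MvPolynomial.monomial_left_injective (one_ne_zero) h1
  exact ⟨by simpa using DFunLike.congr_fun h2 0, by simpa using DFunLike.congr_fun h2 1⟩

theorem qt_inj {a a' : ℕ} {b b' : ℤ} (h : qt a b = qt a' b') : a = a' ∧ b = b' := by
  -- Multiplication by `t ^ m` clears the negative exponents on both sides.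
  set m : ℕ := b.natAbs + b'.natAbs
  have h1 : q ^ a * t ^ (b + m).toNat = q ^ a' * t ^ (b' + m).toNat := by
    have e : ∀ c : ℤ, 0 ≤ c + m → t ^ (c + m).toNat = t ^ c * t ^ m := fun c hc => by
      rw [← zpow_natCast, Int.toNat_of_nonneg hc, zpow_add₀ t_ne_zero, zpow_natCast]
    rw [e b (by omega), e b' (by omega), ← mul_assoc, ← mul_assoc]
    exact congrArg (· * t ^ m) h
  obtain ⟨h2, h3⟩ := q_pow_mul_t_pow_inj h1
  exact ⟨h2, by omega⟩

theorem one_sub_t_ne_zero : 1 - t ≠ 0 := by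
  intro h
  have := (qt_inj (a := 0) (a' := 0) (b := 0) (b' := 1) (by simp [qt]; exact sub_eq_zero.1 h)).2
  omega

/-- After multiplication by a power of `t` the sum is a polynomial whose value at `1` is the number
of summands. It is needed for the scalar by which the idempotent acts on invariant vectors. -/
theorem sum_t_zpow_ne_zero {ι : Type} (s : Finset ι) (hs : s.Nonempty) (f : ι → ℤ) :
    ∑ i ∈ s, t ^ f i ≠ 0 := by
  intro h
  obtain ⟨M, hM⟩ : ∃ M : ℕ, ∀ i ∈ s, 0 ≤ f i + M := by
    refine ⟨∑ i ∈ s, (f i).natAbs, fun i hi => ?_⟩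
    have := Finset.single_le_sum (f := fun i => (f i).natAbs) (fun _ _ => Nat.zero_le _) hi
    omega
  have h1 : polyToKqt (∑ i ∈ s, MvPolynomial.X 1 ^ (f i + M).toNat) = 0 := by
    rw [map_sum]
    calc _ = ∑ i ∈ s, t ^ f i * t ^ M := Finset.sum_congr rfl fun i hi => by
            rw [map_pow, ← zpow_natCast, Int.toNat_of_nonneg (hM i hi)]
            change t ^ _ = _
            rw [zpow_add₀ t_ne_zero, zpow_natCast]
      _ = 0 := by rw [← Finset.sum_mul, h, zero_mul]
  have h2 : (∑ i ∈ s, MvPolynomial.X 1 ^ (f i + M).toNat : MvPolynomial (Fin 2) ℚ) = 0 :=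
    polyToKqt_injective (h1.trans (map_zero _).symm)
  have h3 := congrArg (MvPolynomial.eval fun _ => (1 : ℚ)) h2
  simp at h3
  exact hs.ne_empty h3

theorem tFactorial_ne_zero (n : ℕ) : tFactorial n ≠ 0 := by
  refine Finset.prod_ne_zero_iff.2 fun i hi => div_ne_zero ?_ one_sub_t_ne_zero
  intro h
  have := (qt_inj (a := 0) (a' := 0) (b := 0) (b' := i)
    (by simp [qt]; exact sub_eq_zero.1 h)).2
  have := (Finset.mem_Icc.1 hi).1
  omega

/-! # Lengths of permutations and reduced words -/

theorem lo_lt_hi {n : ℕ} (i : Fin (n - 1)) : lo i < hi i := Nat.lt_succ_self _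

theorem lo_ne_hi {n : ℕ} (i : Fin (n - 1)) : lo i ≠ hi i := (lo_lt_hi i).ne

/-- An adjacent transposition reverses only its own pair, so arguments about order or inversions
come down to that single pair. -/
theorem simpleRefl_lt {n : ℕ} (i : Fin (n - 1)) {a b : Fin n} (h : a < b)
    (h' : ¬ (a = lo i ∧ b = hi i)) : simpleRefl i a < simpleRefl i b := by
  simp only [simpleRefl, Equiv.swap_apply_def, Fin.ext_iff, Fin.lt_def, lo, hi] at *
  split_ifs <;> simp <;> omega

theorem simpleRefl_mul_self {n : ℕ} (i : Fin (n - 1)) : simpleRefl i * simpleRefl i = 1 :=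
  Equiv.swap_mul_self _ _

theorem simpleRefl_lo {n : ℕ} (i : Fin (n - 1)) : simpleRefl i (lo i) = hi i :=
  Equiv.swap_apply_left _ _

theorem simpleRefl_hi {n : ℕ} (i : Fin (n - 1)) : simpleRefl i (hi i) = lo i :=
  Equiv.swap_apply_right _ _

theorem simpleRefl_inv {n : ℕ} (i : Fin (n - 1)) : (simpleRefl i)⁻¹ = simpleRefl i :=
  Equiv.swap_inv _ _

theorem simpleRefl_of_ne {n : ℕ} (i : Fin (n - 1)) {a : Fin n} (h : a ≠ lo i) (h' : a ≠ hi i) :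
    simpleRefl i a = a := Equiv.swap_apply_of_ne_of_ne h h'

theorem simpleRefl_lo_of_lt {n : ℕ} {i j : Fin (n - 1)} (h : (i : ℕ) + 1 < j) :
    simpleRefl i (lo j) = lo j := simpleRefl_of_ne i
  (by simp [Fin.ext_iff, lo]; omega) (by simp [Fin.ext_iff, lo, hi]; omega)

theorem simpleRefl_hi_of_lt {n : ℕ} {i j : Fin (n - 1)} (h : (i : ℕ) < j) :
    simpleRefl i (hi j) = hi j := simpleRefl_of_ne i
  (by simp [Fin.ext_iff, lo, hi]; omega) (by simp [Fin.ext_iff, hi]; omega)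

theorem simpleRefl_lo_of_gt {n : ℕ} {i j : Fin (n - 1)} (h : (j : ℕ) < i) :
    simpleRefl i (lo j) = lo j := simpleRefl_of_ne i
  (by simp [Fin.ext_iff, lo]; omega) (by simp [Fin.ext_iff, lo, hi]; omega)

theorem simpleRefl_hi_of_gt {n : ℕ} {i j : Fin (n - 1)} (h : (j : ℕ) + 1 < i) :
    simpleRefl i (hi j) = hi j := simpleRefl_of_ne i
  (by simp [Fin.ext_iff, lo, hi]; omega) (by simp [Fin.ext_iff, hi]; omega)

theorem lo_eq_hi {n : ℕ} {i j : Fin (n - 1)} (h : (j : ℕ) = i + 1) : lo j = hi i := by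
  simp [lo, hi, h]

theorem simpleRefl_comm {n : ℕ} {i j : Fin (n - 1)} (h : (i : ℕ) + 1 < j) :
    simpleRefl j * simpleRefl i = simpleRefl i * simpleRefl j := by
  have := Equiv.mul_swap_eq_swap_mul (simpleRefl i) (lo j) (hi j)
  rw [simpleRefl_lo_of_lt h, simpleRefl_hi_of_lt (by omega)] at this
  exact this.symm

theorem simpleRefl_braid {n : ℕ} {i j : Fin (n - 1)} (h : (j : ℕ) = i + 1) :
    simpleRefl i * simpleRefl j * simpleRefl i = simpleRefl j * simpleRefl i * simpleRefl j := by
  have h1 : simpleRefl i * simpleRefl j = Equiv.swap (lo i) (hi j) * simpleRefl i := by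
    have := Equiv.mul_swap_eq_swap_mul (simpleRefl i) (lo j) (hi j)
    rwa [simpleRefl_hi_of_lt (by omega), lo_eq_hi h, simpleRefl_hi, ← lo_eq_hi h] at this
  have h2 : simpleRefl j * simpleRefl i = Equiv.swap (lo i) (hi j) * simpleRefl j := by
    have := Equiv.mul_swap_eq_swap_mul (simpleRefl j) (lo i) (hi i)
    rwa [simpleRefl_lo_of_gt (by omega), ← lo_eq_hi h, simpleRefl_lo, lo_eq_hi h] at this
  rw [h1, h2, mul_assoc, mul_assoc, simpleRefl_mul_self, simpleRefl_mul_self]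

/-- The number of inversions of a permutation. -/
def invCount {n : ℕ} (σ : Equiv.Perm (Fin n)) : ℕ :=
  (Finset.univ.filter fun x : Fin n × Fin n => x.1 < x.2 ∧ σ⁻¹ x.2 < σ⁻¹ x.1).card

theorem invCount_one {n : ℕ} : invCount (1 : Equiv.Perm (Fin n)) = 0 := by
  simp only [invCount, Finset.card_eq_zero, Finset.filter_eq_empty_iff]
  rintro x - ⟨h1, h2⟩
  exact lt_asymm h1 h2

/-- The inversion set of `s_i σ` is the image of that of `σ` under `s_i × s_i`, with the one new
pair `(i, i + 1)`. -/
theorem invCount_simpleRefl_mul {n : ℕ} (i : Fin (n - 1)) (σ : Equiv.Perm (Fin n))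
    (h : σ⁻¹ (lo i) < σ⁻¹ (hi i)) : invCount (simpleRefl i * σ) = invCount σ + 1 := by
  have hp : ∀ a, (simpleRefl i * σ)⁻¹ a = σ⁻¹ (simpleRefl i a) := fun a => by
    rw [mul_inv_rev, simpleRefl_inv]; rfl
  have hs : ∀ a, simpleRefl i (simpleRefl i a) = a := fun a => by
    rw [← Equiv.Perm.mul_apply, simpleRefl_mul_self, Equiv.Perm.one_apply]
  have key : (Finset.univ.filter fun x : Fin n × Fin n =>
      x.1 < x.2 ∧ (simpleRefl i * σ)⁻¹ x.2 < (simpleRefl i * σ)⁻¹ x.1) =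
      insert (lo i, hi i) ((Finset.univ.filter fun x : Fin n × Fin n =>
        x.1 < x.2 ∧ σ⁻¹ x.2 < σ⁻¹ x.1).map
          ((simpleRefl i).toEmbedding.prodMap (simpleRefl i).toEmbedding)) := by
    ext ⟨a, b⟩
    simp only [Finset.mem_filter, Finset.mem_univ, true_and, hp, Finset.mem_insert, Prod.mk.injEq,
      Finset.mem_map, Function.Embedding.coe_prodMap, Prod.exists, Prod.map_apply,
      Equiv.coe_toEmbedding]
    constructor
    · rintro ⟨h1, h2⟩
      by_cases h3 : a = lo i ∧ b = hi i
      · exact Or.inl h3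
      · exact Or.inr ⟨_, _, ⟨simpleRefl_lt i h1 h3, h2⟩, hs a, hs b⟩
    · rintro (⟨rfl, rfl⟩ | ⟨a', b', ⟨h1, h2⟩, rfl, rfl⟩)
      · refine ⟨lo_lt_hi i, ?_⟩
        rwa [simpleRefl_hi, simpleRefl_lo]
      · rw [hs, hs]
        refine ⟨simpleRefl_lt i h1 ?_, h2⟩
        rintro ⟨rfl, rfl⟩
        exact lt_asymm h h2
  unfold invCount
  rw [key, Finset.card_insert_of_notMem, Finset.card_map]
  simp only [Finset.mem_map, Function.Embedding.coe_prodMap, Prod.exists, Prod.map_apply,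
    Equiv.coe_toEmbedding, Finset.mem_filter, Prod.mk.injEq, not_exists, not_and]
  intro a b h1 ha hb
  have ha' : a = hi i := by rw [← hs a, ha, simpleRefl_lo]
  have hb' : b = lo i := by rw [← hs b, hb, simpleRefl_hi]
  have := h1.2.1
  rw [ha', hb'] at this
  exact absurd this (lo_lt_hi i).asymm

theorem simpleRefl_mul_cancel {n : ℕ} (i : Fin (n - 1)) (σ : Equiv.Perm (Fin n)) :
    simpleRefl i * (simpleRefl i * σ) = σ := by
  rw [← mul_assoc, simpleRefl_mul_self, one_mul]

theorem inv_simpleRefl_mul {n : ℕ} (i : Fin (n - 1)) (σ : Equiv.Perm (Fin n)) (a : Fin n) :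
    (simpleRefl i * σ)⁻¹ a = σ⁻¹ (simpleRefl i a) := by
  rw [mul_inv_rev, simpleRefl_inv]; rfl

theorem invCount_simpleRefl_mul_of_gt {n : ℕ} (i : Fin (n - 1)) (σ : Equiv.Perm (Fin n))
    (h : σ⁻¹ (hi i) < σ⁻¹ (lo i)) : invCount (simpleRefl i * σ) + 1 = invCount σ := by
  rw [← invCount_simpleRefl_mul, simpleRefl_mul_cancel]
  rwa [inv_simpleRefl_mul, inv_simpleRefl_mul, simpleRefl_lo, simpleRefl_hi]

theorem invCount_prod_le {n : ℕ} (l : List (Fin (n - 1))) :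
    invCount (l.map simpleRefl).prod ≤ l.length := by
  induction l with
  | nil => simp [invCount_one]
  | cons i l ih =>
    rw [List.map_cons, List.prod_cons, List.length_cons]
    rcases lt_or_ge ((l.map simpleRefl).prod⁻¹ (lo i)) ((l.map simpleRefl).prod⁻¹ (hi i))
      with h | h
    · rw [invCount_simpleRefl_mul i _ h]; omega
    · have h' := lt_of_le_of_ne h (fun e => lo_ne_hi i ((Equiv.injective _ e).symm))
      have := invCount_simpleRefl_mul_of_gt i _ h'
      omega

theorem eq_one_of_forall_lt {n : ℕ} (σ : Equiv.Perm (Fin n))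
    (h : ∀ i : Fin (n - 1), σ⁻¹ (lo i) < σ⁻¹ (hi i)) : σ = 1 := by
  have h1 : Monotone (σ⁻¹ : Equiv.Perm (Fin n)) := by
    rcases n with _ | n
    · exact fun a => a.elim0
    · refine (Fin.strictMono_iff_lt_succ.2 fun i => ?_).monotone
      exact h i
  exact inv_eq_one.1 ((Equiv.Perm.monotone_iff _).1 h1)

/-- A permutation other than the identity has a left descent, and multiplying by it removes one
inversion. -/
theorem exists_word {n : ℕ} (k : ℕ) (σ : Equiv.Perm (Fin n)) (hk : invCount σ = k) :
    ∃ l : List (Fin (n - 1)), (l.map simpleRefl).prod = σ ∧ l.length = k := by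
  induction k generalizing σ with
  | zero =>
    refine ⟨[], ?_, rfl⟩
    rw [List.map_nil, List.prod_nil, eq_comm]
    refine eq_one_of_forall_lt σ fun i => ?_
    by_contra h
    have h' := lt_of_le_of_ne (not_lt.1 h) (fun e => lo_ne_hi i ((Equiv.injective _ e).symm))
    have := invCount_simpleRefl_mul_of_gt i _ h'
    omega
  | succ k ih =>
    by_cases h : ∀ i : Fin (n - 1), σ⁻¹ (lo i) < σ⁻¹ (hi i)
    · rw [eq_one_of_forall_lt σ h, invCount_one] at hk
      omega
    · push Not at h
      obtain ⟨i, h⟩ := h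
      have h' := lt_of_le_of_ne h (fun e => lo_ne_hi i ((Equiv.injective _ e).symm))
      have := invCount_simpleRefl_mul_of_gt i _ h'
      obtain ⟨l, h1, h2⟩ := ih (simpleRefl i * σ) (by omega)
      exact ⟨i :: l, by rw [List.map_cons, List.prod_cons, h1, simpleRefl_mul_cancel], by simp [h2]⟩

/-- No word is shorter than the number of inversions and some word attains it, so the word chosen in
the definition has exactly this length. -/
theorem redWord_spec {n : ℕ} (σ : Equiv.Perm (Fin n)) :
    ((redWord σ).map simpleRefl).prod = σ ∧ (redWord σ).length = invCount σ := by
  obtain ⟨l, h1, h2⟩ := exists_word _ σ rfl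
  have h3 : IsReducedWord σ l :=
    ⟨h1, fun l' hl' => by rw [h2, ← hl']; exact invCount_prod_le l'⟩
  have h4 : IsReducedWord σ (redWord σ) := Classical.epsilon_spec ⟨l, h3⟩
  exact ⟨h4.1, le_antisymm (h2 ▸ h4.2 l h1) (by
    conv_lhs => rw [← h4.1]
    exact invCount_prod_le _)⟩

/-- Two reduced words of the same permutation have the same product under every map that satisfies
the braid relations. -/
theorem prod_map_eq_of_reduced {n : ℕ} {M : Type} [Monoid M] (T : Fin (n - 1) → M)
    (hb : ∀ i j : Fin (n - 1), (j : ℕ) = i + 1 → T i * T j * T i = T j * T i * T j)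
    (hf : ∀ i j : Fin (n - 1), (i : ℕ) + 1 < j → T i * T j = T j * T i) (k : ℕ)
    (l l' : List (Fin (n - 1))) (hl : l.length = k) (hl' : l'.length = k)
    (hll : (l.map simpleRefl).prod = (l'.map simpleRefl).prod)
    (hk : invCount (l.map simpleRefl).prod = k) : (l.map T).prod = (l'.map T).prod := by
  induction k using Nat.strong_induction_on generalizing l l' with
  | _ k ih =>
  rcases l with _ | ⟨i, l⟩
  · rw [List.length_nil] at hl
    rw [List.length_eq_zero_iff.1 (hl'.trans hl.symm)]
  rcases l' with _ | ⟨j, l'⟩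
  · simp at hl hl'; omega
  rw [List.length_cons] at hl hl'
  obtain ⟨σ, hσ⟩ : ∃ σ, σ = ((i :: l).map simpleRefl).prod := ⟨_, rfl⟩
  have hσ' := hσ.trans hll
  rw [← hσ] at hk
  rw [List.map_cons, List.prod_cons] at hσ hσ'
  have hi' : (l.map simpleRefl).prod = simpleRefl i * σ := by rw [hσ, simpleRefl_mul_cancel]
  have hj' : (l'.map simpleRefl).prod = simpleRefl j * σ := by rw [hσ', simpleRefl_mul_cancel]
  -- The first letter of a reduced word is a left descent: otherwise the remaining word would be
  -- shorter than the inversion number of its product.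
  have desc : ∀ (i : Fin (n - 1)) (l : List (Fin (n - 1))), l.length + 1 = k →
      (l.map simpleRefl).prod = simpleRefl i * σ → σ⁻¹ (hi i) < σ⁻¹ (lo i) := by
    intro i l h1 h2
    by_contra h3
    have h3' := lt_of_le_of_ne (not_lt.1 h3) (fun e => lo_ne_hi i (Equiv.injective _ e))
    have h4 := invCount_simpleRefl_mul i σ h3'
    have h5 := invCount_prod_le l
    rw [h2] at h5
    omega
  have di := desc i l hl hi'
  have dj := desc j l' hl' hj'
  have ci := invCount_simpleRefl_mul_of_gt i σ di
  have cj := invCount_simpleRefl_mul_of_gt j σ dj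
  -- the case of a common prefix of two reduced words
  have wlog' : ∀ (i j : Fin (n - 1)) (l l' : List (Fin (n - 1))), l.length + 1 = k →
      l'.length + 1 = k → (l.map simpleRefl).prod = simpleRefl i * σ →
      (l'.map simpleRefl).prod = simpleRefl j * σ → σ⁻¹ (hi i) < σ⁻¹ (lo i) →
      σ⁻¹ (hi j) < σ⁻¹ (lo j) → i < j →
      T i * (l.map T).prod = T j * (l'.map T).prod := by
    clear desc di dj ci cj hl hl' hi' hj' hσ hσ' hll l l' i j
    intro i j l l' hl hl' hi' hj' di dj hij
    have ci := invCount_simpleRefl_mul_of_gt i σ di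
    have cj := invCount_simpleRefl_mul_of_gt j σ dj
    by_cases h : (i : ℕ) + 1 < j
    · have e1 := simpleRefl_lo_of_lt h
      have e2 : simpleRefl i (hi j) = hi j := simpleRefl_hi_of_lt (by omega)
      have hs := simpleRefl_comm h
      have c2 := invCount_simpleRefl_mul_of_gt j (simpleRefl i * σ) (by
        rw [inv_simpleRefl_mul, inv_simpleRefl_mul, e1, e2]; exact dj)
      -- Both `i :: j :: r` and `j :: i :: r` are reduced words of `σ`. Induction compares each
      -- given word with the one that has the same first letter, and the two differ by a
      -- commutation.
      obtain ⟨r, hr, hr'⟩ := exists_word _ (simpleRefl j * (simpleRefl i * σ)) rfl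
      have h1 := ih (k - 1) (by omega) l (j :: r) (by omega) (by rw [List.length_cons]; omega)
        (by rw [hi', List.map_cons, List.prod_cons, hr, simpleRefl_mul_cancel])
        (by rw [hi']; omega)
      have h2 := ih (k - 1) (by omega) l' (i :: r) (by omega) (by rw [List.length_cons]; omega)
        (by rw [hj', List.map_cons, List.prod_cons, hr, ← mul_assoc (simpleRefl j), hs, mul_assoc,
          simpleRefl_mul_cancel])
        (by rw [hj']; omega)
      rw [h1, h2, List.map_cons, List.map_cons, List.prod_cons, List.prod_cons, ← mul_assoc,
        ← mul_assoc, hf i j h]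
    · have hj : (j : ℕ) = i + 1 := by have := Fin.lt_def.1 hij; omega
      have hlj := lo_eq_hi hj
      rw [hlj] at dj
      have e0 : simpleRefl i (hi j) = hi j := simpleRefl_hi_of_lt (by omega)
      have e1 : simpleRefl j (lo i) = lo i := simpleRefl_lo_of_gt (by omega)
      have e2 : simpleRefl j (hi i) = hi j := by rw [← hlj, simpleRefl_lo]
      have e3 : simpleRefl j (hi j) = hi i := by rw [simpleRefl_hi, hlj]
      have hs := simpleRefl_braid hj
      have c2 := invCount_simpleRefl_mul_of_gt j (simpleRefl i * σ) (by
        rw [inv_simpleRefl_mul, inv_simpleRefl_mul, hlj, simpleRefl_hi, e0]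
        exact dj.trans di)
      have c3 := invCount_simpleRefl_mul_of_gt i (simpleRefl j * (simpleRefl i * σ)) (by
        simp only [inv_simpleRefl_mul]
        rw [e1, e2, e0, simpleRefl_lo]; exact dj)
      have d2 := invCount_simpleRefl_mul_of_gt i (simpleRefl j * σ) (by
        simp only [inv_simpleRefl_mul]
        rw [e1, e2]; exact dj.trans di)
      -- With descents at `i` and `i + 1` the longest element of the rank two subgroup splits off,
      -- so `i j i r` and `j i j r` are both reduced words of `σ`.
      obtain ⟨r, hr, hr'⟩ := exists_word _ (simpleRefl i * (simpleRefl j * (simpleRefl i * σ))) rfl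
      have h1 := ih (k - 1) (by omega) l (j :: i :: r) (by omega)
        (by simp only [List.length_cons]; omega)
        (by simp only [hi', List.map_cons, List.prod_cons, hr, simpleRefl_mul_cancel])
        (by rw [hi']; omega)
      have h2 := ih (k - 1) (by omega) l' (i :: j :: r) (by omega)
        (by simp only [List.length_cons]; omega)
        (by
          simp only [hj', List.map_cons, List.prod_cons, hr]
          have : simpleRefl i * (simpleRefl j * (simpleRefl i * σ)) =
              simpleRefl j * (simpleRefl i * (simpleRefl j * σ)) := by
            simp only [← mul_assoc, hs]
          rw [this, simpleRefl_mul_cancel, simpleRefl_mul_cancel])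
        (by rw [hj']; omega)
      rw [h1, h2]
      simp only [List.map_cons, List.prod_cons, ← mul_assoc, hb i j hj]
  simp only [List.map_cons, List.prod_cons]
  rcases lt_trichotomy i j with h | h | h
  · exact wlog' i j l l' hl hl' hi' hj' di dj h
  · subst h
    rw [ih (k - 1) (by omega) l l' (by omega) (by omega) (hi'.trans hj'.symm) (by rw [hi']; omega)]
  · exact (wlog' j i l' l hl' hl hj' hi' dj di h).symm

/-! # The trivial idempotent -/

theorem Hecke.Tperm_eq {n : ℕ} (l : List (Fin (n - 1)))
    (h : invCount (l.map simpleRefl).prod = l.length) :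
    Hecke.Tperm (l.map simpleRefl).prod = (l.map Hecke.T).prod := by
  have h1 := redWord_spec (l.map simpleRefl).prod
  exact prod_map_eq_of_reduced Hecke.T Hecke.braid (fun i j h => (Hecke.far i j h).eq)
    l.length _ _ (h1.2.trans h) rfl h1.1 (by rw [h1.1, h])

theorem Hecke.T_mul_Tperm {n : ℕ} (i : Fin (n - 1)) (σ : Equiv.Perm (Fin n))
    (h : σ⁻¹ (lo i) < σ⁻¹ (hi i)) :
    Hecke.T i * Hecke.Tperm σ = Hecke.Tperm (simpleRefl i * σ) := by
  have h1 := redWord_spec σ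
  have h2 := Hecke.Tperm_eq (i :: redWord σ) (by
    rw [List.map_cons, List.prod_cons, h1.1, List.length_cons, h1.2, invCount_simpleRefl_mul i σ h])
  rw [List.map_cons, List.prod_cons, h1.1] at h2
  rw [h2, List.map_cons, List.prod_cons]
  rfl

theorem sq_of_quad {R : Type} [Ring R] [Algebra Kqt R] {x : R}
    (h : (x - 1) * (x + algebraMap Kqt _ t) = 0) : x * x = (1 - t) • x + t • (1 : R) := by
  have e : (x - 1) * (x + algebraMap Kqt _ t) =
      x * x - ((1 - t) • x + t • (1 : R)) := by
    rw [Algebra.algebraMap_eq_smul_one, sub_mul, mul_add, one_mul, mul_smul_comm, mul_one, sub_smul,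
      one_smul]
    abel
  rw [e] at h
  exact sub_eq_zero.1 h

/-- Pair `σ` with `s_i σ`. If `s_i σ` is longer, the two terms add up to a multiple of `(T_i + t)
T_σ`, which `T_i - 1` kills by the quadratic relation. -/
theorem Hecke.T_mul_ε {n : ℕ} (i : Fin (n - 1)) : Hecke.T i * Hecke.ε n = Hecke.ε n := by
  rw [← sub_eq_zero, Hecke.ε, mul_smul_comm, ← smul_sub, Finset.mul_sum, ← Finset.sum_sub_distrib]
  refine smul_eq_zero_of_right _ ?_
  have asc : ∀ σ : Equiv.Perm (Fin n), σ⁻¹ (lo i) < σ⁻¹ (hi i) →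
      (Hecke.T i * t ^ ((n.choose 2 : ℤ) - ((redWord σ).length : ℤ)) • Hecke.Tperm σ -
        t ^ ((n.choose 2 : ℤ) - ((redWord σ).length : ℤ)) • Hecke.Tperm σ) +
      (Hecke.T i * t ^ ((n.choose 2 : ℤ) - ((redWord (simpleRefl i * σ)).length : ℤ)) •
          Hecke.Tperm (simpleRefl i * σ) -
        t ^ ((n.choose 2 : ℤ) - ((redWord (simpleRefl i * σ)).length : ℤ)) •
          Hecke.Tperm (simpleRefl i * σ)) = 0 := by
    intro σ h
    rw [(redWord_spec σ).2, (redWord_spec _).2, invCount_simpleRefl_mul i σ h,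
      ← Hecke.T_mul_Tperm i σ h, mul_smul_comm, mul_smul_comm, ← mul_assoc,
      sq_of_quad (Hecke.quad i)]
    have e : t ^ ((n.choose 2 : ℤ) - (invCount σ : ℤ)) =
        t ^ ((n.choose 2 : ℤ) - ((invCount σ + 1 : ℕ) : ℤ)) * t := by
      rw [← zpow_add_one₀ t_ne_zero]
      congr 1
      push_cast
      ring
    rw [e, add_mul, smul_mul_assoc, smul_mul_assoc, one_mul]
    module
  refine Finset.sum_involution (fun σ _ => simpleRefl i * σ) ?_ ?_ ?_ ?_
  · intro σ _
    rcases lt_or_ge (σ⁻¹ (lo i)) (σ⁻¹ (hi i)) with h | h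
    · exact asc σ h
    · have h' := lt_of_le_of_ne h (fun e => lo_ne_hi i ((Equiv.injective _ e).symm))
      have := asc (simpleRefl i * σ)
        (by rwa [inv_simpleRefl_mul, inv_simpleRefl_mul, simpleRefl_lo, simpleRefl_hi])
      rw [simpleRefl_mul_cancel] at this
      rw [add_comm]
      exact this
  · intro σ _ _ h
    have h1 := mul_eq_right.1 h
    have h2 := simpleRefl_lo i
    rw [h1] at h2
    exact lo_ne_hi i h2
  · intros; exact Finset.mem_univ _
  · intro σ _; exact simpleRefl_mul_cancel i σ

/-- In a module, the trivial idempotent acts on the vectors fixed by all `T_i` by a nonzero scalar. -/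
theorem exists_ε_apply_eq {n : ℕ} : ∃ c : Kqt, c ≠ 0 ∧ ∀ (M : Type) [AddCommGroup M]
    [Module Kqt M] (f : Hecke n →ₐ[Kqt] Module.End Kqt M) (v : M), (∀ i, f (Hecke.T i) v = v) →
      f (Hecke.ε n) v = c • v := by
  refine ⟨(tFactorial n)⁻¹ * ∑ σ : Equiv.Perm (Fin n),
    t ^ ((n.choose 2 : ℤ) - ((redWord σ).length : ℤ)),
    mul_ne_zero (inv_ne_zero (tFactorial_ne_zero n))
      (sum_t_zpow_ne_zero _ ⟨1, Finset.mem_univ _⟩ _), fun M _ _ f v hv => ?_⟩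
  have h : ∀ l : List (Fin (n - 1)), f (l.map Hecke.T).prod v = v := by
    intro l
    induction l with
    | nil => simp
    | cons i l ih => rw [List.map_cons, List.prod_cons, map_mul, Module.End.mul_apply, ih, hv]
  rw [Hecke.ε, map_smul, map_sum, LinearMap.smul_apply, LinearMap.sum_apply, mul_smul,
    Finset.sum_smul]
  congr 1
  refine Finset.sum_congr rfl fun σ _ => ?_
  rw [map_smul, LinearMap.smul_apply, Hecke.Tperm, h]

end Murnaghan

end

noncomputable section

namespace Murnaghan

/-! # Representations of the double affine Hecke algebra from a raising operator -/

section raising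

variable {A : Type} [Ring A]

/-- The ordered product `T 0 * T 1 * ⋯ * T (k - 1)`. -/
def prodUpTo (T : ℕ → A) : ℕ → A
  | 0 => 1
  | k + 1 => prodUpTo T k * T k

theorem prodUpTo_succ (T : ℕ → A) (k : ℕ) : prodUpTo T (k + 1) = prodUpTo T k * T k := rfl

theorem prodUpTo_succ' (T : ℕ → A) (k : ℕ) :
    prodUpTo T (k + 1) = T 0 * prodUpTo (fun i => T (i + 1)) k := by
  induction k with
  | zero => simp [prodUpTo]
  | succ k ih => rw [prodUpTo_succ, ih, prodUpTo_succ, mul_assoc]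

theorem prod_ofFn_eq_prodUpTo {N : ℕ} (f : Fin N → A) (T : ℕ → A) (h : ∀ i : Fin N, f i = T i) :
    (List.ofFn f).prod = prodUpTo T N := by
  induction N with
  | zero => simp [prodUpTo]
  | succ N ih =>
    rw [List.ofFn_succ', List.concat_eq_append, List.prod_append, ih _ fun i => h i.castSucc,
      prodUpTo_succ, List.prod_singleton, h]
    simp

theorem prodUpTo_commute (T : ℕ → A) (x : A) (k : ℕ) (h : ∀ i < k, Commute x (T i)) :
    Commute x (prodUpTo T k) := by
  induction k with
  | zero => exact Commute.one_right _
  | succ k ih => exact (ih fun i hi => h i (by omega)).mul_right (h k (by omega))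

theorem prodUpTo_semiconj (T T' : ℕ → A) (x : A) (k : ℕ) (h : ∀ i < k, x * T i = T' i * x) :
    x * prodUpTo T k = prodUpTo T' k * x := by
  induction k with
  | zero => simp [prodUpTo]
  | succ k ih =>
    rw [prodUpTo_succ, prodUpTo_succ, ← mul_assoc, ih fun i hi => h i (by omega), mul_assoc,
      h k (by omega), mul_assoc]

/-- Invertible elements `T 0, …, T (N - 1)` that satisfy the braid relations. -/
structure BraidData (N : ℕ) (T T' : ℕ → A) : Prop where
  mul_inv : ∀ i < N, T i * T' i = 1
  inv_mul : ∀ i < N, T' i * T i = 1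
  braid : ∀ i, i + 1 < N → T i * T (i + 1) * T i = T (i + 1) * T i * T (i + 1)
  far : ∀ i j, i + 1 < j → j < N → Commute (T i) (T j)

namespace BraidData

variable {N : ℕ} {T T' : ℕ → A}

theorem commute_inv {x : A} {i : ℕ} (h : BraidData N T T') (hi : i < N) (hx : Commute x (T i)) :
    Commute x (T' i) := by
  have h1 := h.mul_inv i hi
  have h2 := h.inv_mul i hi
  show _ = _
  calc x * T' i = T' i * (T i * x) * T' i := by rw [← mul_assoc, h2, one_mul]
    _ = T' i * x * (T i * T' i) := by rw [← hx.eq]; noncomm_ring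
    _ = T' i * x := by rw [h1, mul_one]

theorem mul_prodUpTo_far {j k : ℕ} (h : BraidData N T T') (hj : j < N) (hkj : k < j) :
    Commute (T j) (prodUpTo T k) :=
  prodUpTo_commute _ _ _ fun i hi => (h.far i j (by omega) hj).symm

/-- The factor crosses `T j * T (j + 1)` by the braid relation, which lowers its index by one, and
commutes with all other letters. -/
theorem mul_prodUpTo {j k : ℕ} (h : BraidData N T T') (hk : k ≤ N) (hj : j + 1 < k) :
    T (j + 1) * prodUpTo T k = prodUpTo T k * T j := by
  induction k with
  | zero => omega
  | succ k ih =>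
    rw [prodUpTo_succ]
    rcases Nat.lt_or_ge (j + 1) k with h1 | h1
    · rw [← mul_assoc, ih (by omega) h1, mul_assoc, mul_assoc, (h.far j k h1 (by omega)).eq]
    · obtain rfl : k = j + 1 := by omega
      rw [prodUpTo_succ, ← mul_assoc, ← mul_assoc,
        (h.mul_prodUpTo_far (j := j + 1) (k := j) (by omega) (by omega)).eq]
      calc prodUpTo T j * T (j + 1) * T j * T (j + 1)
          = prodUpTo T j * (T (j + 1) * T j * T (j + 1)) := by noncomm_ring
        _ = _ := by rw [← h.braid j (by omega)]; noncomm_ring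

/-- With `c = T 0 ⋯ T (N - 1)`: `c (T 0 ⋯ T (N - 2)) = (T 1 ⋯ T (N - 1)) c`. -/
theorem coxeter_mul {k : ℕ} (h : BraidData N T T') (hk : k < N) :
    prodUpTo T N * prodUpTo T k = prodUpTo (fun i => T (i + 1)) k * prodUpTo T N :=
  prodUpTo_semiconj _ _ _ _ fun i hi => (h.mul_prodUpTo le_rfl (by omega)).symm

theorem exists_inv_prodUpTo {k : ℕ} (h : BraidData N T T') (hk : k ≤ N) :
    ∃ u, u * prodUpTo T k = 1 := by
  induction k with
  | zero => exact ⟨1, one_mul _⟩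
  | succ k ih =>
    obtain ⟨u, hu⟩ := ih (by omega)
    refine ⟨T' k * u, ?_⟩
    rw [prodUpTo_succ, mul_assoc, ← mul_assoc u, hu, one_mul, h.inv_mul k (by omega)]

end BraidData

variable [Algebra Kqt A]

/-- Commuting elements obtained from each other by `Z (i + 1) = t (T i)⁻¹ (Z i) (T i)⁻¹`. -/
structure LadderData (N : ℕ) (T T' Z : ℕ → A) : Prop extends BraidData N T T' where
  succ : ∀ i < N, Z (i + 1) = t • (T' i * Z i * T' i)
  comm_high_zero : ∀ i, i + 1 < N → Commute (T (i + 1)) (Z 0)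
  comm_zero_one : 0 < N → Commute (Z 0) (Z 1)

namespace LadderData

variable {N : ℕ} {T T' Z : ℕ → A}

theorem comm_low {i k : ℕ} (h : LadderData N T T' Z) (hi : i < N) (hk : k < i) :
    Commute (T i) (Z k) := by
  induction k with
  | zero =>
    obtain ⟨i, rfl⟩ : ∃ j, i = j + 1 := ⟨i - 1, by omega⟩
    exact h.comm_high_zero i hi
  | succ k ih =>
    have h1 : Commute (T i) (T' k) :=
      h.commute_inv (by omega) (h.far k i (by omega) hi).symm
    rw [h.succ k (by omega)]
    exact ((h1.mul_right (ih (by omega))).mul_right h1).smul_right _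

/-- Only `k = i + 2` needs the braid relation: `Z (i + 2)` is `Z i` wrapped in inverses of `T i` and
`T (i + 1)`, and `T i` passes through these as `T (i + 1)`, which commutes with `Z i`. -/
theorem comm_high {i k : ℕ} (h : LadderData N T T' Z) (hk : k ≤ N) (hik : i + 1 < k) :
    Commute (T i) (Z k) := by
  induction k with
  | zero => omega
  | succ k ih =>
    rcases Nat.lt_or_ge (i + 1) k with h' | h'
    · have h1 : Commute (T i) (T' k) := h.commute_inv (by omega) (h.far i k h' (by omega))
      rw [h.succ k (by omega)]
      exact ((h1.mul_right (ih (by omega) h')).mul_right h1).smul_right _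
    · obtain rfl : k = i + 1 := by omega
      rw [h.succ _ (by omega), h.succ _ (by omega)]
      have hc := h.comm_low (i := i + 1) (k := i) (by omega) (by omega)
      have hb := h.braid i (by omega)
      have ha1 := h.mul_inv i (by omega)
      have ha2 := h.inv_mul i (by omega)
      have hb1 := h.mul_inv (i + 1) (by omega)
      have hb2 := h.inv_mul (i + 1) (by omega)
      generalize T' i = a' at *
      generalize T' (i + 1) = b' at *
      generalize T i = a at *
      generalize T (i + 1) = b at *
      generalize Z i = z at *
      have e1 : a * b' * a' = b' * a' * b := by
        calc a * b' * a' = (b' * (a' * a) * b) * (a * b' * a') := by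
              rw [ha2, mul_one, hb2, one_mul]
          _ = b' * a' * (a * b * a) * b' * a' := by noncomm_ring
          _ = b' * a' * b * (a * (b * b') * a') := by rw [hb]; noncomm_ring
          _ = b' * a' * b := by rw [hb1, mul_one, ha1, mul_one]
      have e2 : a' * b' * a = b * a' * b' := by
        calc a' * b' * a = (a' * b' * a) * (b * (a * a') * b') := by
              rw [ha1, mul_one, hb1, mul_one]
          _ = a' * b' * (a * b * a) * a' * b' := by noncomm_ring
          _ = (a' * (b' * b) * a) * b * a' * b' := by rw [hb]; noncomm_ring
          _ = b * a' * b' := by rw [hb2, mul_one, ha2, one_mul]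
      have e3 : Commute a (b' * (a' * z * a') * b') := by
        show _ = _
        calc a * (b' * (a' * z * a') * b') = (a * b' * a') * z * a' * b' := by noncomm_ring
          _ = b' * a' * (b * z) * a' * b' := by rw [e1]; noncomm_ring
          _ = b' * a' * z * (b * a' * b') := by rw [hc.eq]; noncomm_ring
          _ = (b' * (a' * z * a') * b') * a := by rw [← e2]; noncomm_ring
      rw [mul_smul_comm, smul_mul_assoc]
      exact (e3.smul_right _).smul_right _

theorem comm_zero {k : ℕ} (h : LadderData N T T' Z) (hk : k < N) : Commute (Z 0) (Z (k + 1)) := by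
  induction k with
  | zero => exact h.comm_zero_one hk
  | succ k ih =>
    have h1 : Commute (Z 0) (T' (k + 1)) := h.commute_inv hk (h.comm_high_zero k hk).symm
    rw [h.succ (k + 1) hk]
    exact ((h1.mul_right (ih (by omega))).mul_right h1).smul_right _

theorem comm_of_lt {j k : ℕ} (h : LadderData N T T' Z) (hk : k ≤ N) (hjk : j < k) :
    Commute (Z j) (Z k) := by
  induction j with
  | zero =>
    obtain ⟨k, rfl⟩ : ∃ l, k = l + 1 := ⟨k - 1, by omega⟩
    exact h.comm_zero hk
  | succ j ih =>
    have h1 : Commute (T' j) (Z k) :=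
      (h.commute_inv (by omega) (h.comm_high hk hjk).symm).symm
    rw [h.succ j (by omega)]
    exact ((h1.mul_left (ih (by omega))).mul_left h1).smul_left _

theorem comm {j k : ℕ} (h : LadderData N T T' Z) (hj : j ≤ N) (hk : k ≤ N) :
    Commute (Z j) (Z k) := by
  rcases lt_trichotomy j k with h1 | rfl | h1
  · exact h.comm_of_lt hk h1
  · exact Commute.refl _
  · exact (h.comm_of_lt hj h1).symm

/-- For `Z = θ` this turns `π = t^(n-1) θ_1 T_1⁻¹ ⋯ T_{n-1}⁻¹` into `T_1 ⋯ T_{n-1} θ_n`, the form in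
which `π` is handled below. -/
theorem prodUpTo_mul {k : ℕ} (h : LadderData N T T' Z) (hk : k ≤ N) :
    prodUpTo T k * Z k = t ^ k • (Z 0 * prodUpTo T' k) := by
  induction k with
  | zero => simp [prodUpTo]
  | succ k ih =>
    rw [prodUpTo_succ, h.succ k (by omega), prodUpTo_succ, mul_smul_comm, pow_succ', mul_smul,
      ← mul_assoc (Z 0), ← smul_mul_assoc (t ^ k), ← ih (by omega)]
    congr 1
    calc prodUpTo T k * T k * (T' k * Z k * T' k)
        = prodUpTo T k * (T k * T' k) * Z k * T' k := by noncomm_ring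
      _ = _ := by rw [h.mul_inv k (by omega), mul_one]

end LadderData

/-- A representation of the affine Hecke algebra with an operator that raises the degree. -/
structure RaisingData (N : ℕ) (T T' θ : ℕ → A) (γ : A) : Prop extends LadderData N T T' θ where
  γT : ∀ i, i + 1 < N → γ * T (i + 1) = T i * γ
  γγT : 0 < N → γ * γ * T 0 = T (N - 1) * (γ * γ)
  γθ : ∀ i < N, γ * θ (i + 1) = θ i * γ
  γθ_last : θ N * γ = q • (γ * θ 0)

/-- The elements `X_i` that belong to a raising operator. -/
def ladderX (N : ℕ) (T T' θ : ℕ → A) (γ : A) : ℕ → A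
  | 0 => prodUpTo T N * (γ * θ 0)
  | k + 1 => t • (T' k * ladderX N T T' θ γ k * T' k)

namespace RaisingData

variable {N : ℕ} {T T' θ : ℕ → A} {γ : A}

theorem γθ_T {i : ℕ} (h : RaisingData N T T' θ γ) (hi : i + 1 < N) :
    γ * θ 0 * T (i + 1) = T i * (γ * θ 0) := by
  rw [mul_assoc, ← (h.comm_high_zero i hi).eq, ← mul_assoc, h.γT i hi, mul_assoc]

/-- Since `θ 1` is `θ 0` between two factors `T' 0`, moving `T 0` through `θ 1 * θ 0` is the
commutation of `θ 0` and `θ 1`. -/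
theorem T_comm_θθ (h : RaisingData N T T' θ γ) (hN : 0 < N) : Commute (T 0) (θ 1 * θ 0) := by
  have h1 := h.comm_zero_one hN
  have h2 := h.mul_inv 0 hN
  have h3 := h.inv_mul 0 hN
  rw [h.succ 0 hN] at h1 ⊢
  have h4 : θ 0 * (T' 0 * θ 0 * T' 0) = (T' 0 * θ 0 * T' 0) * θ 0 := by
    have := h1.eq
    rw [mul_smul_comm, smul_mul_assoc] at this
    exact smul_right_injective _ t_ne_zero this
  rw [smul_mul_assoc]
  refine Commute.smul_right ?_ _
  show _ = _
  calc T 0 * (T' 0 * θ 0 * T' 0 * θ 0) = T 0 * T' 0 * θ 0 * T' 0 * θ 0 := by noncomm_ring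
    _ = θ 0 * T' 0 * θ 0 * (T' 0 * T 0) := by rw [h2, h3, one_mul, mul_one]
    _ = θ 0 * (T' 0 * θ 0 * T' 0) * T 0 := by noncomm_ring
    _ = T' 0 * θ 0 * T' 0 * θ 0 * T 0 := by rw [h4]

theorem γθ_sq_T (h : RaisingData N T T' θ γ) (hN : 0 < N) :
    (γ * θ 0) * (γ * θ 0) * T 0 = T (N - 1) * ((γ * θ 0) * (γ * θ 0)) := by
  have e : (γ * θ 0) * (γ * θ 0) = γ * γ * (θ 1 * θ 0) := by
    calc (γ * θ 0) * (γ * θ 0) = γ * (θ 0 * γ) * θ 0 := by noncomm_ring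
      _ = _ := by rw [← h.γθ 0 hN]; noncomm_ring
  rw [e, mul_assoc, ← (h.T_comm_θθ hN).eq, ← mul_assoc, h.γγT hN, mul_assoc]

/-- Two facts about `X_0` suffice, by the general properties of ladders. That `T (i + 1)` commutes
with `X_0` comes from sliding it through the Coxeter product and back through `γ θ_0`. Writing `X_0
= T 0 * y`, one has `X_1 = t y (T 0)⁻¹`, so that `X_0` and `X_1` commute because `T 0` commutes with
`y²`. -/
theorem ladderX_data (h : RaisingData N T T' θ γ) : LadderData N T T' (ladderX N T T' θ γ) where
  toBraidData := h.toBraidData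
  succ i hi := rfl
  comm_high_zero i hi := by
    show _ = _
    rw [ladderX, ← mul_assoc, h.mul_prodUpTo le_rfl hi, mul_assoc, ← h.γθ_T hi, ← mul_assoc]
  comm_zero_one hN := by
    obtain ⟨M, rfl⟩ : ∃ M, N = M + 1 := ⟨N - 1, by omega⟩
    have h1 := h.mul_inv 0 hN
    have h2 := h.inv_mul 0 hN
    set g := γ * θ 0 with hg
    set d := prodUpTo (fun i => T (i + 1)) M with hd
    have hX : ladderX (M + 1) T T' θ γ 0 = T 0 * (d * g) := by
      rw [ladderX, prodUpTo_succ', mul_assoc]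
    have hgd : g * d = prodUpTo T M * g :=
      prodUpTo_semiconj _ _ _ _ fun i hi => h.γθ_T (by omega)
    -- Here the relation for `γ²` enters: `T 0` passes the double Coxeter product as the last
    -- generator, and `(γ θ_0)²` turns that back into `T 0`.
    have hY : T 0 * ((d * g) * (d * g)) = (d * g) * (d * g) * T 0 := by
      have e : (d * g) * (d * g) = d * prodUpTo T M * (g * g) := by
        calc (d * g) * (d * g) = d * (g * d) * g := by noncomm_ring
          _ = _ := by rw [hgd]; noncomm_ring
      have e2 := h.γθ_sq_T hN
      rw [Nat.add_sub_cancel, ← hg] at e2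
      have e3 := h.coxeter_mul (Nat.lt_succ_self M)
      rw [← hd, prodUpTo_succ' T M, ← hd, ← prodUpTo_succ' T M, prodUpTo_succ] at e3
      calc T 0 * ((d * g) * (d * g)) = (T 0 * d) * prodUpTo T M * (g * g) := by
            rw [e]; noncomm_ring
        _ = prodUpTo T M * T M * prodUpTo T M * (g * g) := by
            rw [← prodUpTo_succ, prodUpTo_succ']
        _ = d * prodUpTo T M * (T M * (g * g)) := by rw [e3]; noncomm_ring
        _ = _ := by rw [← e2, e]; noncomm_ring
    show _ = _
    have hX1 : ladderX (M + 1) T T' θ γ 1 = t • (T' 0 * (T 0 * (d * g)) * T' 0) := by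
      rw [← hX]; rfl
    rw [hX1, hX, mul_smul_comm, smul_mul_assoc]
    congr 1
    calc T 0 * (d * g) * (T' 0 * (T 0 * (d * g)) * T' 0)
        = T 0 * (d * g) * (T' 0 * T 0) * (d * g) * T' 0 := by noncomm_ring
      _ = T 0 * ((d * g) * (d * g)) * T' 0 := by rw [h2]; noncomm_ring
      _ = (d * g) * (d * g) * (T 0 * T' 0) := by rw [hY]; noncomm_ring
      _ = (T' 0 * T 0) * (d * g) * (T' 0 * T 0) * (d * g) := by rw [h1, h2]; noncomm_ring
      _ = _ := by noncomm_ring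

theorem pi_mul_T {i : ℕ} (h : RaisingData N T T' θ γ) (hi : i + 1 < N) :
    prodUpTo T N * θ N * T i = T (i + 1) * (prodUpTo T N * θ N) := by
  rw [mul_assoc, ← (h.toLadderData.comm_high (i := i) le_rfl hi).eq, ← mul_assoc,
    ← h.mul_prodUpTo le_rfl hi, mul_assoc]

theorem pi_mul_γ (h : RaisingData N T T' θ γ) :
    prodUpTo T N * θ N * γ = q • ladderX N T T' θ γ 0 := by
  rw [mul_assoc, h.γθ_last, mul_smul_comm, ladderX]

/-- This says `X_n = γ π`. After multiplication on the left by `T_1 ⋯ T_{n-1}`, which is left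
cancellable, both sides become `t^(n-1) X_1 T_1⁻¹ ⋯ T_{n-1}⁻¹`. -/
theorem ladderX_last (h : RaisingData N T T' θ γ) :
    ladderX N T T' θ γ N = γ * (prodUpTo T N * θ N) := by
  obtain ⟨u, hu⟩ := h.exists_inv_prodUpTo le_rfl
  have h1 := h.ladderX_data.prodUpTo_mul le_rfl
  have h2 : prodUpTo T N * ladderX N T T' θ γ N =
      prodUpTo T N * (γ * (prodUpTo T N * θ N)) := by
    rw [h1, h.toLadderData.prodUpTo_mul le_rfl, ladderX, mul_smul_comm, mul_smul_comm]
    congr 1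
    noncomm_ring
  have h3 := congrArg (u * ·) h2
  simpa only [← mul_assoc, hu, one_mul] using h3

theorem pi_mul_X_last (h : RaisingData N T T' θ γ) : prodUpTo T N * θ N * ladderX N T T' θ γ N =
    q • (ladderX N T T' θ γ 0 * (prodUpTo T N * θ N)) := by
  rw [h.ladderX_last, ← mul_assoc, h.pi_mul_γ, smul_mul_assoc]

/-- The case `i = 0` is a computation with the Coxeter element `c`. The others follow by induction,
since `π T_i = T_{i+1} π` carries the recursion for `X` one step up. -/
theorem pi_mul_X {i : ℕ} (h : RaisingData N T T' θ γ) (hi : i < N) :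
    prodUpTo T N * θ N * ladderX N T T' θ γ i =
    ladderX N T T' θ γ (i + 1) * (prodUpTo T N * θ N) := by
  induction i with
  | zero =>
    obtain ⟨M, rfl⟩ : ∃ M, N = M + 1 := ⟨N - 1, by omega⟩
    have h1 := h.mul_inv 0 hi
    have h2 := h.inv_mul 0 hi
    have h3 := h.mul_inv M (by omega)
    have h4 := h.inv_mul M (by omega)
    set d := prodUpTo (fun i => T (i + 1)) M with hd
    set e := prodUpTo T M with he
    set c := prodUpTo T (M + 1) with hc
    have hcd : c = T 0 * d := prodUpTo_succ' T M
    have hce : c = e * T M := rfl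
    have hdc : c * e = d * c := h.coxeter_mul (Nat.lt_succ_self M)
    have hγd : γ * d = e * γ :=
      prodUpTo_semiconj _ _ _ _ fun i hi => h.γT i (by omega)
    have hθd : Commute (θ 0) d :=
      prodUpTo_commute _ _ _ fun i hi => (h.comm_high_zero i (by omega)).symm
    have hθe : Commute (θ (M + 1)) e :=
      prodUpTo_commute _ _ _ fun i hi => (h.toLadderData.comm_high le_rfl (by omega)).symm
    -- Both `T 0 * d` and `e * T M` are `c`, and `c * e = d * c`; so `T 0` on the left and `T M` on
    -- the right of `d * c` give the same element `c * c`.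
    have hdcT : T' 0 * (d * c) = d * c * T' M := by
      have e1 : d * c = T 0 * (d * c * T' M) := by
        calc d * c = c * e * (T M * T' M) := by rw [hdc, h3, mul_one]
          _ = c * (e * T M) * T' M := by noncomm_ring
          _ = c * c * T' M := by rw [← hce]
          _ = T 0 * d * c * T' M := by rw [← hcd]
          _ = _ := by noncomm_ring
      calc T' 0 * (d * c) = T' 0 * (T 0 * (d * c * T' M)) := by rw [← e1]
        _ = (T' 0 * T 0) * (d * c * T' M) := by noncomm_ring
        _ = _ := by rw [h2, one_mul]
    have hX1 : ladderX (M + 1) T T' θ γ (0 + 1) = t • (T' 0 * (c * (γ * θ 0)) * T' 0) := rfl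
    have hX0 : ladderX (M + 1) T T' θ γ 0 = c * (γ * θ 0) := rfl
    have hθc : θ (M + 1) * c = t • (e * T' M * θ M) := by
      calc θ (M + 1) * c = (θ (M + 1) * e) * T M := by rw [hce]; noncomm_ring
        _ = e * (θ (M + 1) * T M) := by rw [hθe.eq]; noncomm_ring
        _ = _ := by
          rw [h.succ M (by omega), smul_mul_assoc, mul_smul_comm]
          congr 1
          calc e * (T' M * θ M * T' M * T M) = e * T' M * θ M * (T' M * T M) := by noncomm_ring
            _ = _ := by rw [h4, mul_one]
    rw [hX1, hX0]
    calc c * θ (M + 1) * (c * (γ * θ 0)) = c * (θ (M + 1) * c) * γ * θ 0 := by noncomm_ring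
      _ = t • (c * e * T' M * θ M * γ * θ 0) := by
        rw [hθc]
        simp only [mul_smul_comm, smul_mul_assoc, mul_assoc]
      _ = t • (T' 0 * (c * (γ * θ 0)) * T' 0 * (c * θ (M + 1))) := by
        congr 1
        calc c * e * T' M * θ M * γ * θ 0 = (d * c * T' M) * (θ M * γ) * θ 0 := by
              rw [hdc]; noncomm_ring
          _ = T' 0 * (c * e) * (γ * θ (M + 1)) * θ 0 := by
              rw [← hdcT, h.γθ M (by omega), hdc]
          _ = T' 0 * c * (e * γ) * (θ (M + 1) * θ 0) := by noncomm_ring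
          _ = T' 0 * c * (γ * d) * (θ 0 * θ (M + 1)) := by
              rw [hγd, (h.toLadderData.comm (j := M + 1) (k := 0) le_rfl (Nat.zero_le _)).eq]
          _ = T' 0 * c * γ * (d * θ 0) * θ (M + 1) := by noncomm_ring
          _ = T' 0 * c * γ * (θ 0 * d) * θ (M + 1) := by rw [hθd.eq]
          _ = T' 0 * (c * (γ * θ 0)) * ((T' 0 * T 0) * d) * θ (M + 1) := by
              rw [h2]; noncomm_ring
          _ = T' 0 * (c * (γ * θ 0)) * T' 0 * ((T 0 * d) * θ (M + 1)) := by noncomm_ring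
          _ = _ := by rw [← hcd]
      _ = _ := by rw [smul_mul_assoc]
  | succ i ih =>
    have ih := ih (by omega)
    have h1 := h.pi_mul_T hi
    set p := prodUpTo T N * θ N
    have h2 : p * T' i = T' (i + 1) * p := by
      calc p * T' i = (T' (i + 1) * T (i + 1)) * p * T' i := by
            rw [h.inv_mul _ hi, one_mul]
        _ = T' (i + 1) * (T (i + 1) * p) * T' i := by noncomm_ring
        _ = T' (i + 1) * p * (T i * T' i) := by rw [← h1]; noncomm_ring
        _ = _ := by rw [h.mul_inv i (by omega), mul_one]
    rw [ladderX.eq_def _ _ _ _ _ (i + 1 + 1), ladderX.eq_def _ _ _ _ _ (i + 1)]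
    simp only
    rw [mul_smul_comm, smul_mul_assoc]
    congr 1
    calc p * (T' i * ladderX N T T' θ γ i * T' i)
        = (p * T' i) * ladderX N T T' θ γ i * T' i := by noncomm_ring
      _ = T' (i + 1) * (p * ladderX N T T' θ γ i) * T' i := by rw [h2]; noncomm_ring
      _ = T' (i + 1) * ladderX N T T' θ γ (i + 1) * (p * T' i) := by rw [ih]; noncomm_ring
      _ = _ := by rw [h2]; noncomm_ring

end RaisingData

/-- A family indexed by `Fin m`, extended by `1`. -/
def extendFin {m : ℕ} (f : Fin m → A) (k : ℕ) : A := if h : k < m then f ⟨k, h⟩ else 1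

theorem extendFin_of_lt {m : ℕ} (f : Fin m → A) {k : ℕ} (h : k < m) :
    extendFin f k = f ⟨k, h⟩ := dif_pos h

theorem extendFin_coe {m : ℕ} (f : Fin m → A) (i : Fin m) : extendFin f i = f i :=
  extendFin_of_lt f i.2

theorem piElt_eq {N : ℕ} (T : Fin N → A) (θ : Fin (N + 1) → A) (hn : 0 < N + 1) :
    piElt (n := N + 1) hn T θ =
      t ^ N • (extendFin θ 0 * prodUpTo (extendFin fun i => tInv (T i)) N) := by
  rw [← prod_ofFn_eq_prodUpTo (fun i => tInv (T i)) (extendFin fun i => tInv (T i))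
    fun i => (extendFin_coe (fun i => tInv (T i)) i).symm, extendFin_of_lt θ hn]
  rfl

theorem map_piElt {B : Type} [Ring B] [Algebra Kqt B] {n : ℕ} (hn : 0 < n) (f : A →ₐ[Kqt] B)
    (T : Fin (n - 1) → A) (θ : Fin n → A) :
    f (piElt hn T θ) = piElt hn (fun i => f (T i)) fun i => f (θ i) := by
  have e : (f ∘ fun i => tInv (T i)) = fun i => tInv (f (T i)) := funext fun i => map_tInv f (T i)
  rw [piElt, piElt, map_smul, map_mul, map_list_prod, List.map_ofFn, e]

/-- The relations of the affine Hecke algebra, with those of a raising operator, give a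
representation of the double affine Hecke algebra. -/
theorem exists_DAHA_hom {N : ℕ} (T : Fin N → A) (θ : Fin (N + 1) → A) (γ : A)
    (quad : ∀ i, (T i - 1) * (T i + algebraMap Kqt _ t) = 0)
    (h : RaisingData N (extendFin T) (extendFin fun i => tInv (T i)) (extendFin θ) γ) :
    ∃ f : DAHA (N + 1) →ₐ[Kqt] A, (∀ i : Fin N, f (DAHA.T i) = T i) ∧
      (∀ i, f (DAHA.θ i) = θ i) ∧
      ∀ hn, f (DAHA.X ⟨N, Nat.lt_succ_self N⟩) = γ * f (DAHA.π hn) := by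
  set X := ladderX N (extendFin T) (extendFin fun i => tInv (T i)) (extendFin θ) γ with hX
  have hXd : LadderData N _ _ X := h.ladderX_data
  let gen : DGen (N + 1) → A := fun x => match x with
    | .T i => T i
    | .θ i => θ i
    | .X i => X i
  have gT : ∀ i : Fin N, FreeAlgebra.lift Kqt gen (DGen.fT (n := N + 1) i) = T i := fun i => by
    simp [DGen.fT, gen]
  have gθ : ∀ i, FreeAlgebra.lift Kqt gen (DGen.fθ i) = θ i := fun i => by
    simp [DGen.fθ, gen]
  have gX : ∀ i, FreeAlgebra.lift Kqt gen (DGen.fX i) = X i := fun i => by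
    simp [DGen.fX, gen]
  -- The image of `π` is needed in the form `T_1 ⋯ T_{n-1} θ_n`, in which the relations with the
  -- `X_i` were proved.
  have gπ : ∀ hn, FreeAlgebra.lift Kqt gen (piElt (n := N + 1) hn DGen.fT DGen.fθ) =
      prodUpTo (extendFin T) N * extendFin θ N := by
    intro hn
    rw [h.toLadderData.prodUpTo_mul le_rfl]
    have := piElt_eq T θ hn
    rw [← this, map_piElt]
    congr 1
    · exact funext gT
    · exact funext gθ
  have eT : ∀ i : Fin N, extendFin T i = T i := extendFin_coe T
  have eT' : ∀ i : Fin N, extendFin (fun i => tInv (T i)) i = tInv (T i) :=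
    extendFin_coe fun i => tInv (T i)
  have eθ : ∀ i : Fin (N + 1), extendFin θ i = θ i := extendFin_coe θ
  have hrel : ∀ ⦃x y⦄, DRel (N + 1) x y →
      FreeAlgebra.lift Kqt gen x = FreeAlgebra.lift Kqt gen y := by
    intro x y hxy
    cases hxy with
    | quad i => simpa [gT] using quad i
    | braid i j hij =>
      change Fin N at i j
      have := h.braid i (by omega)
      rw [← hij, eT, eT] at this
      simpa [gT] using this
    | far i j hij =>
      change Fin N at i j
      have := (h.far i j hij j.2).eq
      rw [eT, eT] at this
      simpa [gT] using this
    | θθ i j =>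
      have := (h.toLadderData.comm (j := i) (k := j) (by omega) (by omega)).eq
      rw [eθ, eθ] at this
      simpa [gθ] using this
    | θsucc i =>
      change Fin N at i
      have := h.succ i i.2
      rw [eT', show (i : ℕ) + 1 = ((hi (n := N + 1) i : Fin (N + 1)) : ℕ) from rfl,
        show (i : ℕ) = ((lo (n := N + 1) i : Fin (N + 1)) : ℕ) from rfl, eθ, eθ] at this
      simp only [map_smul, map_mul, map_tInv, gθ]
      rw [this]
      erw [gT]
    | Tθ i j hij =>
      change Fin N at i
      have h1 : (j : ℕ) ≠ i := fun e => hij.1 (Fin.ext e)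
      have h2 : (j : ℕ) ≠ i + 1 := fun e => hij.2 (Fin.ext e)
      have : extendFin T i * extendFin θ j = extendFin θ j * extendFin T i := by
        rcases Nat.lt_or_ge (j : ℕ) i with h3 | h3
        · exact (h.toLadderData.comm_low i.2 h3).eq
        · exact (h.toLadderData.comm_high (by omega) (by omega)).eq
      rw [eT, eθ] at this
      simpa [gT, gθ] using this
    | XX i j =>
      have := (hXd.comm (j := i) (k := j) (by omega) (by omega)).eq
      simpa [gX] using this
    | Xsucc i =>
      change Fin N at i
      have := hXd.succ i i.2
      rw [eT'] at this
      simp only [map_smul, map_mul, map_tInv, gX]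
      erw [gT]
      exact this
    | TX i j hij =>
      change Fin N at i
      have h1 : (j : ℕ) ≠ i := fun e => hij.1 (Fin.ext e)
      have h2 : (j : ℕ) ≠ i + 1 := fun e => hij.2 (Fin.ext e)
      have : extendFin T i * X j = X j * extendFin T i := by
        rcases Nat.lt_or_ge (j : ℕ) i with h3 | h3
        · exact (hXd.comm_low i.2 h3).eq
        · exact (hXd.comm_high (by omega) (by omega)).eq
      rw [eT] at this
      simpa [gT, gX] using this
    | πX hn i =>
      change Fin N at i
      rw [map_mul, map_mul, gπ, gX, gX]
      exact h.pi_mul_X i.2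
    | πXlast hn =>
      rw [map_mul, map_smul, map_mul, gπ, gX, gX]
      exact h.pi_mul_X_last
  refine ⟨Presented.lift gen hrel, fun i => ?_, fun i => ?_, fun hn => ?_⟩
  · rw [DAHA.T, Presented.lift_mk]; exact gT i
  · rw [DAHA.θ, Presented.lift_mk, gθ]
  · have e : (DAHA.π hn : DAHA (N + 1)) =
        Presented.mk (DRel (N + 1)) (piElt hn DGen.fT DGen.fθ) :=
      (map_piElt hn (Presented.mk (DRel (N + 1))) DGen.fT DGen.fθ).symm
    rw [e, DAHA.X, Presented.lift_mk, Presented.lift_mk, gπ, gX]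
    exact h.ladderX_last

end raising

end Murnaghan

end

noncomputable section

namespace Murnaghan

/-! # Combinatorics of periodic standard tableaux -/

variable {n : ℕ} {μ : YoungDiagram}

/-- The inverse of the cyclic shift: `k ↦ k - 1`, and `0 ↦ n - 1`. -/
def rotDown (n : ℕ) : Equiv.Perm (Fin n) := (finRotate n).symm

theorem rotDown_of_pos {i : Fin n} (h : 1 ≤ (i : ℕ)) : (rotDown n i : ℕ) + 1 = i := by
  rcases n with _ | n
  · exact i.elim0
  · obtain ⟨j, rfl⟩ : ∃ j, finRotate (n + 1) j = i := (finRotate (n + 1)).surjective i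
    rw [rotDown, Equiv.symm_apply_apply]
    rw [coe_finRotate] at h ⊢
    split_ifs at h ⊢ <;> simp_all

theorem rotDown_of_zero {i : Fin n} (h : (i : ℕ) = 0) : (rotDown n i : ℕ) + 1 = n := by
  rcases n with _ | n
  · exact i.elim0
  · obtain ⟨j, rfl⟩ : ∃ j, finRotate (n + 1) j = i := (finRotate (n + 1)).surjective i
    rw [rotDown, Equiv.symm_apply_apply]
    rw [coe_finRotate] at h
    split_ifs at h with h1
    · simp [h1]

namespace PSYT

/-- The corner in the row of `c` and the column of `d` lies in the diagram and links the row and the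
column condition. -/
theorem strict_of_le (τ : PSYT n μ) {c d : μ.cells} (h1 : c.1.1 ≤ d.1.1) (h2 : c.1.2 ≤ d.1.2)
    (hne : c ≠ d) : τ.wt d < τ.wt c ∨ (τ.wt c = τ.wt d ∧ τ.idx c < τ.idx d) := by
  rcases h1.eq_or_lt with h1 | h1
  · exact τ.strict c d (Or.inl ⟨h1, lt_of_le_of_ne h2 fun e => hne (Subtype.ext (Prod.ext h1 e))⟩)
  rcases h2.eq_or_lt with h2 | h2
  · exact τ.strict c d (Or.inr ⟨h2, h1⟩)
  have he : (c.1.1, d.1.2) ∈ μ.cells := μ.isLowerSet (show (c.1.1, d.1.2) ≤ d.1 from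
    ⟨h1.le, le_rfl⟩) d.2
  have e1 := τ.strict c ⟨_, he⟩ (Or.inl ⟨rfl, h2⟩)
  have e2 := τ.strict ⟨_, he⟩ d (Or.inr ⟨rfl, h1⟩)
  simp only [Fin.lt_def] at *
  omega

/-- A box between two boxes with the same exponent has this exponent and a number in between. -/
theorem between (τ : PSYT n μ) {c d e : μ.cells} (hw : τ.wt c = τ.wt d)
    (h1 : c.1.1 ≤ e.1.1) (h2 : c.1.2 ≤ e.1.2) (h3 : e.1.1 ≤ d.1.1) (h4 : e.1.2 ≤ d.1.2)
    (hce : c ≠ e) (hed : e ≠ d) : τ.idx c < τ.idx e ∧ τ.idx e < τ.idx d := by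
  have e1 := τ.strict_of_le h1 h2 hce
  have e2 := τ.strict_of_le h3 h4 hed
  simp only [Fin.lt_def] at *
  omega

/-- The relative position of the boxes of consecutive numbers with the same exponent. -/
theorem adj_cases (τ : PSYT n μ) (i : Fin (n - 1)) (hw : τ.w (lo i) = τ.w (hi i)) :
    ((τ.idx.symm (lo i)).1.1 = (τ.idx.symm (hi i)).1.1 ∧ τ.c (hi i) = τ.c (lo i) + 1) ∨
    ((τ.idx.symm (lo i)).1.2 = (τ.idx.symm (hi i)).1.2 ∧ τ.c (lo i) = τ.c (hi i) + 1) ∨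
    ((τ.idx.symm (lo i)).1.1 ≠ (τ.idx.symm (hi i)).1.1 ∧
      (τ.idx.symm (lo i)).1.2 ≠ (τ.idx.symm (hi i)).1.2 ∧
      (1 < τ.c (lo i) - τ.c (hi i) ∨ 1 < τ.c (hi i) - τ.c (lo i))) := by
  have ha' : (τ.idx (τ.idx.symm (lo i)) : ℕ) = i := by rw [Equiv.apply_symm_apply]; rfl
  have hb' : (τ.idx (τ.idx.symm (hi i)) : ℕ) = i + 1 := by rw [Equiv.apply_symm_apply]; rfl
  unfold w at hw
  unfold c content
  generalize τ.idx.symm (lo i) = a at *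
  generalize τ.idx.symm (hi i) = b at *
  have hab : a ≠ b := by rintro rfl; omega
  have hab' : ¬ (a.1.1 = b.1.1 ∧ a.1.2 = b.1.2) := fun e => hab (Subtype.ext (Prod.ext e.1 e.2))
  have hba : ¬ (b.1.1 ≤ a.1.1 ∧ b.1.2 ≤ a.1.2) := fun h => by
    have := τ.strict_of_le h.1 h.2 hab.symm
    simp only [Fin.lt_def] at this
    omega
  -- Numbers `i` and `i + 1` with equal exponents leave no room for a third box in the rectangle
  -- that they span.
  have key : ∀ e : ℕ × ℕ, a.1.1 ≤ e.1 → a.1.2 ≤ e.2 → e.1 ≤ b.1.1 → e.2 ≤ b.1.2 →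
      (a.1.1 ≠ e.1 ∨ a.1.2 ≠ e.2) → (b.1.1 ≠ e.1 ∨ b.1.2 ≠ e.2) → False := by
    intro e h1 h2 h3 h4 h5 h6
    have he : e ∈ μ.cells := μ.isLowerSet (show e ≤ b.1 from ⟨h3, h4⟩) b.2
    have := τ.between (e := ⟨e, he⟩) hw h1 h2 h3 h4 (by rintro rfl; simp at h5)
      (by intro h; rw [← h] at h6; simp at h6)
    simp only [Fin.lt_def] at this
    omega
  by_cases h : a.1.1 ≤ b.1.1 ∧ a.1.2 ≤ b.1.2
  · rcases h.1.eq_or_lt with h1 | h1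
    · have := key (a.1.1, a.1.2 + 1) le_rfl (by simp) (by simp; omega) (by simp; omega) (by simp)
      simp at this
      left; refine ⟨h1, ?_⟩
      omega
    · rcases h.2.eq_or_lt with h2 | h2
      · have := key (a.1.1 + 1, a.1.2) (by simp) le_rfl (by simp; omega) (by simp; omega) (by simp)
        simp at this
        right; left; refine ⟨h2, ?_⟩
        omega
      · exact (key (a.1.1, b.1.2) le_rfl h2.le h1.le le_rfl (Or.inr h2.ne) (Or.inl h1.ne')).elim
  · right; right
    omega

/-- On a common diagonal the two boxes span a rectangle whose other two corners would carry two
different numbers strictly between `i` and `j`. The bound `2` is the one that the braid relation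
requires. -/
theorem c_ne_of_lt (τ : PSYT n μ) {i j : Fin n} (h : (i : ℕ) < j) (h' : (j : ℕ) ≤ i + 2)
    (hw : τ.w i = τ.w j) : τ.c i ≠ τ.c j := by
  intro hc
  have ha' : τ.idx (τ.idx.symm i) = i := by rw [Equiv.apply_symm_apply]
  have hb' : τ.idx (τ.idx.symm j) = j := by rw [Equiv.apply_symm_apply]
  unfold w at hw
  unfold c content at hc
  generalize τ.idx.symm i = a at *
  generalize τ.idx.symm j = b at *
  have hab : a ≠ b := by rintro rfl; omega
  have hab' : ¬ (a.1.1 = b.1.1 ∧ a.1.2 = b.1.2) := fun e => hab (Subtype.ext (Prod.ext e.1 e.2))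
  have hba : ¬ (b.1.1 ≤ a.1.1 ∧ b.1.2 ≤ a.1.2) := fun h => by
    have := τ.strict_of_le h.1 h.2 hab.symm
    simp only [Fin.lt_def] at this
    omega
  have h1 : a.1.1 < b.1.1 ∧ a.1.2 < b.1.2 := by omega
  have he : (a.1.1, b.1.2) ∈ μ.cells :=
    μ.isLowerSet (show (a.1.1, b.1.2) ≤ b.1 from ⟨h1.1.le, le_rfl⟩) b.2
  have hf : (b.1.1, a.1.2) ∈ μ.cells :=
    μ.isLowerSet (show (b.1.1, a.1.2) ≤ b.1 from ⟨le_rfl, h1.2.le⟩) b.2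
  have e1 := τ.between (e := ⟨_, he⟩) hw le_rfl h1.2.le h1.1.le le_rfl
    (by intro e; have := congrArg (·.1.2) e; simp at this; omega)
    (by intro e; have := congrArg (·.1.1) e; simp at this; omega)
  have e2 := τ.between (e := ⟨_, hf⟩) hw h1.1.le le_rfl le_rfl h1.2.le
    (by intro e; have := congrArg (·.1.1) e; simp at this; omega)
    (by intro e; have := congrArg (·.1.2) e; simp at this; omega)
  have e3 : τ.idx ⟨_, he⟩ ≠ τ.idx ⟨_, hf⟩ := fun e => by
    have := congrArg (·.1.1) (τ.idx.injective e); simp at this; omega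
  simp only [Fin.lt_def, Fin.ext_iff, ne_eq] at *
  omega

/-- The eigenvalue of `θ_i` that belongs to `τ`. -/
def ev (τ : PSYT n μ) (i : Fin n) : Kqt := qt (τ.w i) (τ.c i)

theorem ev_ne (τ : PSYT n μ) {i j : Fin n} (h : (i : ℕ) < j) (h' : (j : ℕ) ≤ i + 2) :
    τ.ev i ≠ τ.ev j := fun e => by
  obtain ⟨h1, h2⟩ := qt_inj e
  exact τ.c_ne_of_lt h h' h1 h2

/-- `s_i(τ) > τ`, provided that `s_i(τ)` exists. -/
def Up (i : Fin (n - 1)) (τ : PSYT n μ) : Prop :=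
  τ.w (lo i) < τ.w (hi i) ∨ (τ.w (lo i) = τ.w (hi i) ∧ 1 < τ.c (lo i) - τ.c (hi i))

theorem IsSwap.unique {i : Fin (n - 1)} {τ σ σ' : PSYT n μ} (h : IsSwap i τ σ)
    (h' : IsSwap i τ σ') : σ = σ' := PSYT.ext (h.1.trans h'.1.symm) (h.2.trans h'.2.symm)

/-- The exchange can only violate a condition between the boxes of `i` and `i + 1` with equal
exponents. Such boxes are adjacent, with contents differing by one, which the hypothesis excludes.
-/
theorem exists_isSwap (i : Fin (n - 1)) (τ : PSYT n μ)
    (h : τ.w (lo i) = τ.w (hi i) → 1 < τ.c (lo i) - τ.c (hi i) ∨ 1 < τ.c (hi i) - τ.c (lo i)) :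
    ∃ τ', IsSwap i τ τ' := by
  refine ⟨⟨τ.idx.trans (Equiv.swap (lo i) (hi i)), τ.wt, fun c d hcd => ?_⟩, rfl, rfl⟩
  rcases τ.strict c d hcd with h1 | ⟨h1, h2⟩
  · exact Or.inl h1
  refine Or.inr ⟨h1, simpleRefl_lt i h2 ?_⟩
  rintro ⟨h3, h4⟩
  have hc : c = τ.idx.symm (lo i) := by rw [← h3, Equiv.symm_apply_apply]
  have hd : d = τ.idx.symm (hi i) := by rw [← h4, Equiv.symm_apply_apply]
  have hw : τ.w (lo i) = τ.w (hi i) := by unfold w; rw [← hc, ← hd, h1]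
  have h6 := h hw
  rcases τ.adj_cases i hw with h5 | h5 | h5
  · omega
  · omega
  · rw [← hc, ← hd] at h5
    rcases hcd with hcd | hcd
    · exact h5.1 hcd.1
    · exact h5.2.1 hcd.1

theorem Up.exists_isSwap {i : Fin (n - 1)} {τ : PSYT n μ} (h : Up i τ) : ∃ τ', IsSwap i τ τ' :=
  PSYT.exists_isSwap i τ fun h1 => by unfold Up at h; omega

open Classical in
/-- `s_i(τ)`, or `τ` if this is not a periodic standard tableau. -/
def sw (i : Fin (n - 1)) (τ : PSYT n μ) : PSYT n μ :=
  if h : ∃ τ', IsSwap i τ τ' then h.choose else τ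

theorem isSwap_sw {i : Fin (n - 1)} {τ : PSYT n μ} (h : ∃ τ', IsSwap i τ τ') :
    IsSwap i τ (sw i τ) := by
  rw [sw, dif_pos h]; exact h.choose_spec

theorem sw_eq {i : Fin (n - 1)} {τ τ' : PSYT n μ} (h : IsSwap i τ τ') : sw i τ = τ' :=
  (isSwap_sw ⟨τ', h⟩).unique h

theorem sw_wt (i : Fin (n - 1)) (τ : PSYT n μ) : (sw i τ).wt = τ.wt := by
  by_cases h : ∃ τ', IsSwap i τ τ'
  · exact (isSwap_sw h).2
  · rw [sw, dif_neg h]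

theorem Up.swapUp {i : Fin (n - 1)} {τ : PSYT n μ} (h : Up i τ) : SwapUp i τ (sw i τ) :=
  ⟨isSwap_sw h.exists_isSwap, h⟩

theorem IsSwap.symm_apply {i : Fin (n - 1)} {τ τ' : PSYT n μ} (h : IsSwap i τ τ') (j : Fin n) :
    τ'.idx.symm j = τ.idx.symm (simpleRefl i j) := by
  rw [h.1]; rfl

theorem IsSwap.w_eq {i : Fin (n - 1)} {τ τ' : PSYT n μ} (h : IsSwap i τ τ') (j : Fin n) :
    τ'.w j = τ.w (simpleRefl i j) := by
  rw [w, w, h.2, h.symm_apply]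

theorem IsSwap.c_eq {i : Fin (n - 1)} {τ τ' : PSYT n μ} (h : IsSwap i τ τ') (j : Fin n) :
    τ'.c j = τ.c (simpleRefl i j) := by
  rw [c, c, h.symm_apply]

theorem IsSwap.symm {i : Fin (n - 1)} {τ τ' : PSYT n μ} (h : IsSwap i τ τ') : IsSwap i τ' τ := by
  refine ⟨?_, h.2.symm⟩
  rw [h.1]
  ext c
  simp

/-- If `s_i(τ)` is a tableau then it is larger or smaller than `τ`. -/
theorem IsSwap.up_or_up {i : Fin (n - 1)} {τ τ' : PSYT n μ} (h : IsSwap i τ τ') :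
    Up i τ ∨ Up i τ' := by
  unfold Up
  rw [h.w_eq, h.w_eq, h.c_eq, h.c_eq, simpleRefl_lo, simpleRefl_hi]
  by_cases hw : τ.w (lo i) = τ.w (hi i)
  · have key : ∀ {τ τ' : PSYT n μ}, IsSwap i τ τ' → ∀ a b : μ.cells, τ.idx a = lo i →
        τ.idx b = hi i → τ.wt a = τ.wt b → ¬ (RowBefore a b ∨ ColBefore a b) := by
      intro τ τ' h a b ha hb hab hr
      have h2 := τ'.strict a b hr
      rw [h.2, hab, h.1] at h2
      simp only [lt_irrefl, false_or, true_and, Equiv.trans_apply, ha, hb,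
        Equiv.swap_apply_left, Equiv.swap_apply_right] at h2
      exact lt_asymm h2 (lo_lt_hi i)
    have h1 := key h _ _ (Equiv.apply_symm_apply _ _) (Equiv.apply_symm_apply _ _) hw
    have h2 : (τ.idx.symm (lo i)).1 ≠ (τ.idx.symm (hi i)).1 := fun e =>
      lo_ne_hi i (τ.idx.symm.injective (Subtype.ext e))
    rcases τ.adj_cases i hw with h5 | h5 | h5
    · refine absurd (Or.inl ⟨h5.1, ?_⟩) h1
      have := h5.2; unfold c content at this; omega
    · refine absurd (Or.inr ⟨h5.1, ?_⟩) h1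
      have := h5.2; unfold c content at this; omega
    · omega
  · omega

/-- The relative position of consecutive numbers whose exchange does not give a tableau. -/
theorem not_isSwap {i : Fin (n - 1)} {τ : PSYT n μ} (h : ¬ ∃ τ', IsSwap i τ τ') :
    τ.w (lo i) = τ.w (hi i) ∧
      (((τ.idx.symm (lo i)).1.1 = (τ.idx.symm (hi i)).1.1 ∧ τ.c (hi i) = τ.c (lo i) + 1) ∨
      ((τ.idx.symm (lo i)).1.2 = (τ.idx.symm (hi i)).1.2 ∧ τ.c (lo i) = τ.c (hi i) + 1)) := by
  have hw : τ.w (lo i) = τ.w (hi i) := by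
    by_contra hw
    exact h (exists_isSwap i τ fun e => absurd e hw)
  refine ⟨hw, ?_⟩
  rcases τ.adj_cases i hw with h5 | h5 | h5
  · exact Or.inl h5
  · exact Or.inr h5
  · exact absurd (exists_isSwap i τ fun _ => h5.2.2) h

/-- `Ψ(τ)`. -/
def psi (τ : PSYT n μ) : PSYT n μ where
  idx := τ.idx.trans (rotDown n)
  wt := fun c => τ.wt c + if (τ.idx c : ℕ) = 0 then 1 else 0
  strict := fun c d h => by
    have h1 := τ.strict c d h
    have h0 : τ.idx c ≠ τ.idx d := by
      intro e
      have := τ.idx.injective e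
      subst this
      rcases h with h | h
      · exact lt_irrefl _ h.2
      · exact lt_irrefl _ h.2
    have h2 := @rotDown_of_pos n (τ.idx c)
    have h3 := @rotDown_of_zero n (τ.idx c)
    have h4 := @rotDown_of_pos n (τ.idx d)
    have h5 := @rotDown_of_zero n (τ.idx d)
    simp only [Fin.lt_def, Fin.ext_iff, Equiv.trans_apply, ne_eq] at *
    split_ifs <;> omega

theorem isPsi_psi (τ : PSYT n μ) : IsPsi τ (psi τ) := fun c => by
  refine ⟨fun h => ⟨rotDown_of_pos h, ?_⟩, fun h => ⟨rotDown_of_zero h, ?_⟩⟩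
  · simp [psi]; omega
  · simp [psi, h]

theorem IsPsi.eq {τ τ' : PSYT n μ} (h : IsPsi τ τ') : τ' = psi τ := by
  have h' := isPsi_psi τ
  apply PSYT.ext
  · ext c
    have h1 := h c
    have h2 := h' c
    omega
  · funext c
    have h1 := h c
    have h2 := h' c
    omega

/-- The total exponent of `q`. -/
def deg (τ : PSYT n μ) : ℕ := ∑ c, τ.wt c

theorem deg_eq_of_wt_eq {τ τ' : PSYT n μ} (h : τ'.wt = τ.wt) : τ'.deg = τ.deg := by
  rw [deg, deg, h]

theorem deg_psi (hn : 0 < n) (τ : PSYT n μ) : (psi τ).deg = τ.deg + 1 := by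
  have : ∀ c, ((τ.idx c : ℕ) = 0) = (c = τ.idx.symm ⟨0, hn⟩) := fun c => by
    rw [Equiv.eq_symm_apply, Fin.ext_iff]
  simp only [deg, psi, Finset.sum_add_distrib, this, Finset.sum_ite_eq', Finset.mem_univ, if_true]

/-- Undoing the shift takes one unit from the exponent of the number `n`, hence the positivity
assumption. -/
theorem exists_psi_eq (hn : 0 < n) (τ : PSYT n μ) (h : 0 < τ.w ⟨n - 1, Nat.sub_lt hn one_pos⟩) :
    ∃ σ, psi σ = τ := by
  have hr : ∀ k : Fin n, ((rotDown n).symm k : ℕ) = if (k : ℕ) + 1 = n then 0 else (k : ℕ) + 1 := by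
    intro k
    have h1 := @rotDown_of_pos n ((rotDown n).symm k)
    have h2 := @rotDown_of_zero n ((rotDown n).symm k)
    rw [Equiv.apply_symm_apply] at h1 h2
    split_ifs <;> omega
  have hw : ∀ c, (τ.idx c : ℕ) + 1 = n → 0 < τ.wt c := fun c hc => by
    have : c = τ.idx.symm ⟨n - 1, Nat.sub_lt hn one_pos⟩ := by
      rw [Equiv.eq_symm_apply, Fin.ext_iff]; simp; omega
    rw [this]; exact h
  refine ⟨⟨τ.idx.trans (rotDown n).symm, fun c => τ.wt c - if (τ.idx c : ℕ) + 1 = n then 1 else 0,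
    fun c d h => ?_⟩, ?_⟩
  · have h1 := τ.strict c d h
    have h0 : τ.idx c ≠ τ.idx d := by
      intro e
      have := τ.idx.injective e
      subst this
      rcases h with h | h
      · exact lt_irrefl _ h.2
      · exact lt_irrefl _ h.2
    have h2 := hr (τ.idx c)
    have h4 := hr (τ.idx d)
    have h6 := hw c
    have h7 := hw d
    simp only [Fin.lt_def, Fin.ext_iff, Equiv.trans_apply, ne_eq] at *
    split_ifs at * <;> omega
  · apply PSYT.ext
    · ext c; simp [psi]
    · funext c
      have h6 := hw c
      simp only [psi, Equiv.trans_apply, hr]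
      split_ifs at * <;> omega

/-- Every periodic standard tableau is obtained from a standard one by upward steps. -/
theorem induction {P : PSYT n μ → Prop} (std : ∀ τ : SYT n μ, P τ.toPSYT)
    (swap : ∀ i τ, Up i τ → P τ → P (sw i τ)) (psi : 0 < n → ∀ τ, P τ → P (psi τ)) (τ : PSYT n μ) :
    P τ := by
  induction hd : τ.deg using Nat.strong_induction_on generalizing τ with
  | _ d ih =>
  subst hd
  by_cases h0 : ∀ c, τ.wt c = 0
  · have : τ = SYT.toPSYT ⟨τ.idx, fun c d h => by have := τ.strict c d h; simpa [h0] using this⟩ :=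
      PSYT.ext rfl (funext h0)
    rw [this]
    exact std _
  · push Not at h0
    obtain ⟨c, hc⟩ := h0
    have hn : 0 < n := (Nat.zero_le _).trans_lt (τ.idx c).2
    -- Induction on the distance from `i` to the last number. If the next number has exponent zero,
    -- exchanging the two gives a smaller tableau with the positive exponent one place further; at
    -- the last number the shift can be undone, which lowers the degree.
    have key : ∀ k (i : Fin n), (i : ℕ) + k + 1 = n → ∀ σ : PSYT n μ, σ.deg = τ.deg → 0 < σ.w i →
        P σ := by
      intro k
      induction k with
      | zero =>
        intro i hi σ hσ hw
        obtain rfl : i = ⟨n - 1, Nat.sub_lt hn one_pos⟩ := by ext; simp; omega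
        obtain ⟨ρ, rfl⟩ := exists_psi_eq hn σ hw
        refine psi hn ρ (ih _ ?_ ρ rfl)
        rw [← hσ, deg_psi hn]
        exact Nat.lt_succ_self _
      | succ k ihk =>
        intro i hik σ hσ hw
        have hj : (i : ℕ) < n - 1 := by omega
        have hl : lo ⟨i, hj⟩ = i := rfl
        by_cases hw' : 0 < σ.w (hi ⟨i, hj⟩)
        · exact ihk (hi ⟨i, hj⟩) (by simp [hi]; omega) σ hσ hw'
        · obtain ⟨ρ, hρ⟩ := exists_isSwap ⟨i, hj⟩ σ (fun e => by rw [hl] at e; omega)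
          have hup : Up ⟨i, hj⟩ ρ := by
            left
            rw [hρ.w_eq, hρ.w_eq, simpleRefl_lo, simpleRefl_hi, hl]
            omega
          rw [← sw_eq hρ.symm]
          refine swap _ _ hup (ihk (hi ⟨i, hj⟩) (by simp [hi]; omega) ρ ?_ ?_)
          · rw [deg_eq_of_wt_eq hρ.2, hσ]
          · rw [hρ.w_eq, simpleRefl_hi, hl]; exact hw
    refine key (n - 1 - τ.idx c) (τ.idx c) (by omega) τ rfl ?_
    rw [w, Equiv.symm_apply_apply]
    omega

/-! ## The largest tableau with given exponents -/

/-- The numbers increase with the exponents decreasing and, for equal exponents, with the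
contents increasing. -/
def Sorted (τ : PSYT n μ) : Prop :=
  ∀ i j : Fin n, i < j → τ.w j < τ.w i ∨ (τ.w i = τ.w j ∧ τ.c i < τ.c j)

theorem Sorted.idx_lt {τ : PSYT n μ} (h : τ.Sorted) {c d : μ.cells} (hne : c ≠ d)
    (hcd : τ.wt d < τ.wt c ∨ (τ.wt c = τ.wt d ∧ content c ≤ content d)) : τ.idx c < τ.idx d := by
  by_contra h1
  have h2 := lt_of_le_of_ne (not_lt.1 h1) fun e => hne (τ.idx.injective e.symm)
  have h3 := h _ _ h2
  simp only [w, PSYT.c, Equiv.symm_apply_apply] at h3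
  omega

/-- Passing from the numbers of one tableau to those of the other is a monotone permutation, hence
the identity. -/
theorem Sorted.unique {τ τ' : PSYT n μ} (h : τ.Sorted) (h' : τ'.Sorted) (hw : τ.wt = τ'.wt) :
    τ = τ' := by
  refine PSYT.ext ?_ hw
  have h1 : τ.idx.symm.trans τ'.idx = 1 := by
    refine (Equiv.Perm.monotone_iff _).1 (StrictMono.monotone fun i j hij => ?_)
    refine h'.idx_lt (fun e => hij.ne (τ.idx.symm.injective e)) ?_
    have := h i j hij
    rw [← hw]
    simp only [w, PSYT.c] at this
    omega
  ext c
  have := Equiv.congr_fun h1 (τ.idx c)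
  simp at this
  rw [this]

/-- Sortedness is strict monotonicity for a lexicographic order, so consecutive numbers suffice.
Without upward exchange the only bad position is two adjacent boxes of a column with equal
exponents, which strict decrease along columns rules out. -/
theorem sorted_of_forall_not_up {τ : PSYT n μ} (hT : IsRSSYT τ.wt) (h : ∀ i, ¬ Up i τ) :
    τ.Sorted := by
  have h1 : StrictMono fun i : Fin n => toLex (OrderDual.toDual (τ.w i), τ.c i) := by
    rcases n with _ | n
    · exact fun a => a.elim0
    · refine Fin.strictMono_iff_lt_succ.2 fun i => ?_
      have h2 := h i
      have hl : lo (n := n + 1) i = i.castSucc := rfl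
      have hh : hi (n := n + 1) i = i.succ := rfl
      have h4 := τ.adj_cases i
      unfold Up at h2
      rw [hl, hh] at h2 h4
      rw [Prod.Lex.toLex_lt_toLex]
      simp only [OrderDual.toDual_lt_toDual, EmbeddingLike.apply_eq_iff_eq]
      by_cases hw : τ.w i.castSucc = τ.w i.succ
      · refine Or.inr ⟨hw, ?_⟩
        rcases h4 hw with h5 | h5 | h5
        · omega
        · have h6 : τ.idx.symm i.castSucc ≠ τ.idx.symm i.succ := fun e =>
            (Fin.castSucc_lt_succ (i := i)).ne (τ.idx.symm.injective e)
          have h7 : ColBefore (τ.idx.symm i.castSucc) (τ.idx.symm i.succ) := by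
            refine ⟨h5.1, ?_⟩
            have := h5.2; unfold c content at this; omega
          have := hT.2 _ _ h7
          unfold w at hw
          omega
        · omega
      · exact Or.inl (by omega)
  intro i j hij
  have h2 := h1 hij
  rw [Prod.Lex.toLex_lt_toLex] at h2
  simpa using h2

/-- Boxes with equal exponents form a horizontal strip, and this meets each diagonal at most once.
-/
theorem rssyt_content_inj {T : μ.cells → ℕ} (hT : IsRSSYT T) {c d : μ.cells} (h : T c = T d)
    (h' : content c = content d) : c = d := by
  have key : ∀ c d : μ.cells, T c = T d → content c = content d → ¬ c.1.1 < d.1.1 := by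
    intro c d h h' hlt
    unfold content at h'
    have he : (c.1.1, d.1.2) ∈ μ.cells :=
      μ.isLowerSet (show (c.1.1, d.1.2) ≤ d.1 from ⟨hlt.le, le_rfl⟩) d.2
    have h1 := hT.1 c ⟨_, he⟩ ⟨rfl, by simp; omega⟩
    have h2 := hT.2 ⟨_, he⟩ d ⟨rfl, hlt⟩
    omega
  have h1 := key c d h h'
  have h2 := key d c h.symm h'.symm
  unfold content at h'
  exact Subtype.ext (Prod.ext (by omega) (by omega))

/-- Number the boxes by decreasing exponent, then by increasing content. The order is total by
`rssyt_content_inj`, and compatible with rows, where contents increase, and columns, where exponents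
drop. -/
theorem exists_sorted {T : μ.cells → ℕ} (hT : IsRSSYT T) (hn : μ.card = n) :
    ∃ τ : PSYT n μ, τ.wt = T ∧ τ.Sorted := by
  obtain ⟨e⟩ : Nonempty (μ.cells ≃ Fin n) := ⟨Fintype.equivFinOfCardEq (by simpa using hn)⟩
  set f : Fin n → ℕᵒᵈ ×ₗ ℤ := fun i =>
    toLex (OrderDual.toDual (T (e.symm i)), content (e.symm i)) with hf
  have hinj : Function.Injective f := fun i j hij => by
    simp only [hf, EmbeddingLike.apply_eq_iff_eq, Prod.mk.injEq] at hij
    exact e.symm.injective (rssyt_content_inj hT hij.1 hij.2)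
  have hmono : StrictMono (f ∘ Tuple.sort f) :=
    (Tuple.monotone_sort f).strictMono_of_injective (hinj.comp (Tuple.sort f).injective)
  have key : ∀ i j, i < j → T (e.symm (Tuple.sort f j)) < T (e.symm (Tuple.sort f i)) ∨
      (T (e.symm (Tuple.sort f i)) = T (e.symm (Tuple.sort f j)) ∧
        content (e.symm (Tuple.sort f i)) < content (e.symm (Tuple.sort f j))) := by
    intro i j hij
    have h2 := hmono hij
    simp only [Function.comp, hf] at h2
    rw [Prod.Lex.toLex_lt_toLex] at h2
    simpa using h2
  refine ⟨⟨e.trans (Tuple.sort f).symm, T, fun c d h => ?_⟩, rfl, ?_⟩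
  · have h1 : T d < T c ∨ (T c = T d ∧ content c < content d) := by
      rcases h with h | h
      · rcases (hT.1 c d h).lt_or_eq with h1 | h1
        · exact Or.inl h1
        · refine Or.inr ⟨h1.symm, ?_⟩
          unfold content
          have := h.1; have := h.2
          omega
      · exact Or.inl (hT.2 c d h)
    refine h1.imp id fun h1 => ⟨h1.1, ?_⟩
    by_contra h2
    have h3 : (Tuple.sort f).symm (e d) ≠ (Tuple.sort f).symm (e c) := fun h3 => by
      have := e.injective ((Tuple.sort f).symm.injective h3)
      subst this
      omega
    have h4 := key _ _ (lt_of_le_of_ne (not_lt.1 h2) h3)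
    simp only [Equiv.trans_apply, Equiv.apply_symm_apply, Equiv.symm_apply_apply] at h4
    omega
  · intro i j hij
    exact key i j hij

/-- Every tableau with given exponents leads to the sorted one by upward exchanges. -/
theorem induction_down {τ₀ : PSYT n μ} (h₀ : τ₀.Sorted) (hT : IsRSSYT τ₀.wt) {P : PSYT n μ → Prop}
    (top : P τ₀) (step : ∀ i τ, τ.wt = τ₀.wt → Up i τ → P (sw i τ) → P τ) (τ : PSYT n μ)
    (hτ : τ.wt = τ₀.wt) : P τ := by
  -- A bounded potential that makes the ascent terminate: the pairing of the numbering with the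
  -- sorted one. An upward exchange corrects a pair that is in the wrong order relative to `τ₀`,
  -- which increases the pairing.
  obtain ⟨m, hm⟩ : ∃ m : PSYT n μ → ℤ, m = fun τ =>
    ∑ c, ((τ.idx c : ℕ) : ℤ) * ((τ₀.idx c : ℕ) : ℤ) := ⟨_, rfl⟩
  have hb : ∀ τ : PSYT n μ, m τ ≤ ∑ c : μ.cells, (n : ℤ) * n := fun τ => by
    rw [hm]
    refine Finset.sum_le_sum fun c _ => ?_
    have h1 : ((τ.idx c : ℕ) : ℤ) ≤ n := by exact_mod_cast (τ.idx c).2.le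
    have h2 : ((τ₀.idx c : ℕ) : ℤ) ≤ n := by exact_mod_cast (τ₀.idx c).2.le
    exact mul_le_mul h1 h2 (by positivity) (by positivity)
  have hup : ∀ i (τ : PSYT n μ), τ.wt = τ₀.wt → Up i τ → m τ < m (sw i τ) := by
    intro i τ hτ hi'
    have hs := isSwap_sw hi'.exists_isSwap
    obtain ⟨a, ha⟩ : ∃ a, a = τ.idx.symm (lo i) := ⟨_, rfl⟩
    obtain ⟨b, hb⟩ : ∃ b, b = τ.idx.symm (hi i) := ⟨_, rfl⟩
    have hab : a ≠ b := by
      rw [ha, hb]; exact fun e => lo_ne_hi i (τ.idx.symm.injective e)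
    have hr : τ₀.idx b < τ₀.idx a := by
      refine h₀.idx_lt hab.symm ?_
      unfold Up w c at hi'
      rw [← ha, ← hb, hτ] at hi'
      omega
    have e : ∀ c, (((sw i τ).idx c : ℕ) : ℤ) = ((τ.idx c : ℕ) : ℤ) + (if c = a then 1 else 0) -
        if c = b then 1 else 0 := by
      intro c
      rw [hs.1, Equiv.trans_apply]
      by_cases hca : c = a
      · subst hca
        rw [if_pos rfl, if_neg hab, ha, Equiv.apply_symm_apply, Equiv.swap_apply_left]
        simp [lo, hi]
      · by_cases hcb : c = b
        · subst hcb
          rw [if_pos rfl, if_neg hca, hb, Equiv.apply_symm_apply, Equiv.swap_apply_right]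
          simp [lo, hi]
        · rw [if_neg hca, if_neg hcb, Equiv.swap_apply_of_ne_of_ne]
          · simp
          · rintro e; exact hca (by rw [ha, ← e, Equiv.symm_apply_apply])
          · rintro e; exact hcb (by rw [hb, ← e, Equiv.symm_apply_apply])
    rw [hm]
    simp only [e, sub_mul, add_mul, Finset.sum_sub_distrib, Finset.sum_add_distrib, ite_mul,
      one_mul, zero_mul, Finset.sum_ite_eq', Finset.mem_univ, if_true]
    have : ((τ₀.idx b : ℕ) : ℤ) < ((τ₀.idx a : ℕ) : ℤ) := by exact_mod_cast hr
    omega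
  generalize hk : (∑ c : μ.cells, (n : ℤ) * n - m τ).toNat = k
  induction k using Nat.strong_induction_on generalizing τ with
  | _ k ih =>
  by_cases h : ∃ i, Up i τ
  · obtain ⟨i, h⟩ := h
    have h1 := hup i τ hτ h
    have h2 := hb (sw i τ)
    exact step i τ hτ h (ih _ (by omega) (sw i τ) ((sw_wt i τ).trans hτ) rfl)
  · push Not at h
    rw [(sorted_of_forall_not_up (hτ ▸ hT) h).unique h₀ hτ]
    exact top

theorem Sorted.isTop {τ₀ : PSYT n μ} (h₀ : τ₀.Sorted) (hT : IsRSSYT τ₀.wt) : IsTop τ₀.wt τ₀ :=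
  ⟨rfl, fun σ hσ => induction_down h₀ hT (P := fun σ => Le σ τ₀) Relation.ReflTransGen.refl
    (fun i _ _ h1 h2 => Relation.ReflTransGen.head (Or.inr ⟨i, h1.swapUp⟩) h2) σ hσ⟩

theorem Sorted.not_up {τ : PSYT n μ} (h : τ.Sorted) (i : Fin (n - 1)) : ¬ Up i τ := by
  have := h _ _ (lo_lt_hi i)
  unfold Up
  omega

theorem Covers.deg_le {τ τ' : PSYT n μ} (h : Covers τ τ') : τ.deg ≤ τ'.deg := by
  rcases h with h | ⟨i, h⟩
  · rcases Nat.eq_zero_or_pos n with hn | hn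
    · subst hn
      rw [deg_eq_of_wt_eq]
      funext c
      exact (τ.idx c).elim0
    · rw [h.eq, deg_psi hn]
      exact Nat.le_succ _
  · rw [deg_eq_of_wt_eq h.1.2]

theorem Le.deg_le {τ τ' : PSYT n μ} (h : Le τ τ') : τ.deg ≤ τ'.deg := by
  induction h with
  | refl => exact le_rfl
  | tail _ h ih => exact ih.trans h.deg_le

/-- A chain that leaves a sorted tableau cannot begin with an exchange, and a shift raises the total
exponent, which must be the same at both ends. For `n = 0` the shift is trivial, but there is only
one tableau. -/
theorem Sorted.eq_of_isTop {τ₀ τ : PSYT n μ} (h₀ : τ₀.Sorted)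
    (h : IsTop τ₀.wt τ) : τ = τ₀ := by
  rcases Nat.eq_zero_or_pos n with hn | hn
  · subst hn
    exact PSYT.ext (Equiv.ext fun c => (τ₀.idx c).elim0) (funext fun c => (τ₀.idx c).elim0)
  rcases Relation.ReflTransGen.cases_head (h.2 τ₀ rfl) with h1 | ⟨σ, h1, h2⟩
  · exact h1.symm
  · exfalso
    rcases h1 with h1 | ⟨i, h1⟩
    · have h3 := Le.deg_le h2
      rw [h1.eq, deg_psi hn, deg_eq_of_wt_eq h.1] at h3
      omega
    · exact h₀.not_up i h1.2

/-! ## Tableaux with given exponents -/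

/-- The periodic tableau in which the box of the standard tableau `τ` with the `k`-th smallest
number has the `k`-th smallest label among `1 q ^ α_1, …, n q ^ α_n`. -/
def ofSYT (α : Fin n → ℕ) (τ : SYT n μ) : PSYT n μ where
  idx := τ.idx.trans (Tuple.sort fun i => OrderDual.toDual (α i))
  wt := fun c => α (Tuple.sort (fun i => OrderDual.toDual (α i)) (τ.idx c))
  strict := fun c d h => by
    have h1 := τ.strict c d h
    have h2 := Tuple.monotone_sort (fun i => OrderDual.toDual (α i)) h1.le
    simp only [Function.comp, OrderDual.toDual_le_toDual] at h2
    rcases h2.lt_or_eq with h2 | h2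
    · exact Or.inl h2
    · refine Or.inr ⟨h2.symm, ?_⟩
      exact ((Tuple.eq_sort_iff (f := fun i => OrderDual.toDual (α i))).1 rfl).2 _ _ h1
        (congrArg OrderDual.toDual h2.symm)

theorem w_ofSYT (α : Fin n → ℕ) (τ : SYT n μ) : (ofSYT α τ).w = α := by
  funext i
  simp [w, ofSYT]

theorem deg_eq_sum_w (τ : PSYT n μ) : τ.deg = ∑ i, τ.w i :=
  (Equiv.sum_comp τ.idx.symm τ.wt).symm

theorem ofSYT_injective {α α' : Fin n → ℕ} {τ τ' : SYT n μ} (h : ofSYT α τ = ofSYT α' τ') :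
    α = α' ∧ τ = τ' := by
  have h1 : α = α' := by rw [← w_ofSYT α τ, h, w_ofSYT]
  subst h1
  refine ⟨rfl, SYT.ext ?_⟩
  have h2 := congrArg PSYT.idx h
  ext c
  have := Equiv.congr_fun h2 c
  simp only [ofSYT, Equiv.trans_apply, EmbeddingLike.apply_eq_iff_eq] at this
  rw [this]

end PSYT

end Murnaghan

end

noncomputable section

namespace Murnaghan

/-! # The seminormal model of the induced module -/

/-- The eigenvalue that belongs to a pair of an exponent and a content. -/
def qtp (u : ℕ × ℤ) : Kqt := qt u.1 u.2

/-- The diagonal coefficient of `t T_i⁻¹`. -/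
def diagCoef (u v : ℕ × ℤ) : Kqt := (1 - t) * qtp v / (qtp u - qtp v)

/-- The condition on the labels of `i` and `i + 1` for an upward exchange. -/
def UpPair (u v : ℕ × ℤ) : Prop := u.1 < v.1 ∨ (u.1 = v.1 ∧ 1 < u.2 - v.2)

open Classical in
/-- The off-diagonal coefficient of `t T_i⁻¹`. -/
def offCoef (u v : ℕ × ℤ) : Kqt :=
  if UpPair u v then 1 else
    (t * qtp u - qtp v) * (qtp u - t * qtp v) / (qtp u - qtp v) ^ 2

theorem qtp_add_one (a : ℕ) (b : ℤ) : qtp (a, b + 1) = t * qtp (a, b) := by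
  rw [qtp, qtp, qt, qt, zpow_add_one₀ t_ne_zero]; ring

theorem qtp_succ (u : ℕ × ℤ) : qtp (u.1 + 1, u.2) = q * qtp u := by
  rw [qtp, qtp, qt, qt, pow_succ]; ring

theorem qtp_ne_zero (u : ℕ × ℤ) : qtp u ≠ 0 := qt_ne_zero _ _

theorem qtp_injective : Function.Injective qtp := fun _ _ h =>
  Prod.ext (qt_inj h).1 (qt_inj h).2

/-- The eigenvalues have quotient `t` or `t⁻¹`, so one factor of the numerator vanishes. This makes
the span of the tableaux stable inside that of all labellings. -/
theorem offCoef_of_adj {u v : ℕ × ℤ} (h : u.1 = v.1) (h' : v.2 = u.2 + 1 ∨ u.2 = v.2 + 1) :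
    offCoef u v = 0 := by
  obtain ⟨a, b⟩ := u
  obtain ⟨a', b'⟩ := v
  simp only at h h'
  subst h
  rw [offCoef, if_neg (by simp only [UpPair]; omega)]
  rcases h' with rfl | rfl
  · simp [qtp_add_one]
  · simp [qtp_add_one]

/-- Only this product matters for the relations, and it is symmetric: one direction carries the
whole factor, the other carries `1`. When neither direction is upward, the contents differ by one
and both coefficients vanish. -/
theorem offCoef_mul {u v : ℕ × ℤ} (h : qtp u ≠ qtp v) : offCoef u v * offCoef v u =
    (t * qtp u - qtp v) * (qtp u - t * qtp v) / (qtp u - qtp v) ^ 2 := by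
  have hs : (t * qtp v - qtp u) * (qtp v - t * qtp u) / (qtp v - qtp u) ^ 2 =
      (t * qtp u - qtp v) * (qtp u - t * qtp v) / (qtp u - qtp v) ^ 2 := by
    congr 1 <;> ring
  by_cases h1 : UpPair u v
  · have h2 : ¬ UpPair v u := by unfold UpPair at *; omega
    rw [offCoef, offCoef, if_pos h1, if_neg h2, one_mul, hs]
  · by_cases h2 : UpPair v u
    · rw [offCoef, offCoef, if_neg h1, if_pos h2, mul_one]
    · have h4 : u.1 = v.1 := by unfold UpPair at *; omega
      have h3 : u.2 ≠ v.2 := fun e => h (congrArg qtp (Prod.ext h4 e))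
      have h5 : v.2 = u.2 + 1 ∨ u.2 = v.2 + 1 := by unfold UpPair at *; omega
      have h6 := offCoef_of_adj h4 h5
      rw [h6, zero_mul, ← h6, offCoef, if_neg h1]

/-- The coefficient is homogeneous of degree zero in the two eigenvalues, hence unaffected by two
shifts, which multiply both of them by `q`. -/
theorem diagCoef_succ (u v : ℕ × ℤ) :
    diagCoef (u.1 + 1, u.2) (v.1 + 1, v.2) = diagCoef u v := by
  rw [diagCoef, diagCoef, qtp_succ, qtp_succ, ← mul_sub, mul_left_comm,
    mul_div_mul_left _ _ q_ne_zero]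

theorem offCoef_succ (u v : ℕ × ℤ) :
    offCoef (u.1 + 1, u.2) (v.1 + 1, v.2) = offCoef u v := by
  have : UpPair (u.1 + 1, u.2) (v.1 + 1, v.2) ↔ UpPair u v := by simp [UpPair]
  rw [offCoef, offCoef, qtp_succ, qtp_succ]
  by_cases h : UpPair u v
  · rw [if_pos h, if_pos (this.2 h)]
  rw [if_neg h, if_neg (mt this.1 h), show (t * (q * qtp u) - q * qtp v) * (q * qtp u - t * (q * qtp v)) =
    q ^ 2 * ((t * qtp u - qtp v) * (qtp u - t * qtp v)) by ring,
    show (q * qtp u - q * qtp v) ^ 2 = q ^ 2 * (qtp u - qtp v) ^ 2 by ring,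
    mul_div_mul_left _ _ (pow_ne_zero _ q_ne_zero)]

/-! ## Arbitrary labellings -/

/-- Labellings of the boxes, without conditions on the rows and columns. -/
abbrev Labelling (n : ℕ) (μ : YoungDiagram) : Type := (μ.cells ≃ Fin n) × (μ.cells → ℕ)

variable {n N : ℕ} {μ : YoungDiagram}

namespace Labelling

/-- The exponent and the content of a number. -/
def wc (p : Labelling n μ) (i : Fin n) : ℕ × ℤ := (p.2 (p.1.symm i), content (p.1.symm i))

/-- Exchange of `i` and `i + 1`. -/
def swap (i : Fin (n - 1)) (p : Labelling n μ) : Labelling n μ := (p.1.trans (simpleRefl i), p.2)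

/-- The shift of all labels. -/
def psi (p : Labelling n μ) : Labelling n μ :=
  (p.1.trans (rotDown n), fun c => p.2 c + if (p.1 c : ℕ) = 0 then 1 else 0)

theorem wc_swap (i : Fin (n - 1)) (p : Labelling n μ) (j : Fin n) :
    (p.swap i).wc j = p.wc (simpleRefl i j) := rfl

theorem swap_swap (i : Fin (n - 1)) (p : Labelling n μ) : (p.swap i).swap i = p := by
  refine Prod.ext (Equiv.ext fun c => ?_) rfl
  show simpleRefl i (simpleRefl i (p.1 c)) = _
  rw [← Equiv.Perm.mul_apply, simpleRefl_mul_self, Equiv.Perm.one_apply]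

theorem wc_psi (p : Labelling n μ) (j k : Fin n) (h : (k : ℕ) = j + 1) :
    p.psi.wc j = p.wc k := by
  have h1 : (rotDown n).symm j = k := by
    rw [Equiv.symm_apply_eq, Fin.ext_iff]
    have := @rotDown_of_pos n k (by omega)
    omega
  have h2 : (p.1.trans (rotDown n)).symm j = p.1.symm k := by
    rw [Equiv.symm_trans_apply, h1]
  simp only [wc, psi, h2, Equiv.apply_symm_apply]
  rw [if_neg (by omega), add_zero]

theorem wc_psi_last (p : Labelling n μ) (j k : Fin n) (h : (k : ℕ) = 0) (h' : (j : ℕ) + 1 = n) :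
    p.psi.wc j = ((p.wc k).1 + 1, (p.wc k).2) := by
  have h1 : (rotDown n).symm j = k := by
    rw [Equiv.symm_apply_eq, Fin.ext_iff]
    have := @rotDown_of_zero n k h
    omega
  have h2 : (p.1.trans (rotDown n)).symm j = p.1.symm k := by
    rw [Equiv.symm_trans_apply, h1]
  simp only [wc, psi, h2, Equiv.apply_symm_apply]
  rw [if_pos h]

theorem simpleRefl_val_of_ne (i : Fin (n - 1)) (k : Fin n) :
    ((simpleRefl i k : Fin n) : ℕ) =
      if (k : ℕ) = i then (i : ℕ) + 1 else if (k : ℕ) = i + 1 then (i : ℕ) else k := by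
  simp only [simpleRefl, Equiv.swap_apply_def, Fin.ext_iff, lo, hi]
  split_ifs <;> simp

theorem rotDown_val (k : Fin n) :
    ((rotDown n k : Fin n) : ℕ) = if (k : ℕ) = 0 then n - 1 else (k : ℕ) - 1 := by
  have h1 := @rotDown_of_zero n k
  have h2 := @rotDown_of_pos n k
  split_ifs <;> omega

theorem psi_swap (p : Labelling n μ) (i j : Fin (n - 1)) (h : (j : ℕ) = i + 1) :
    (p.swap j).psi = p.psi.swap i := by
  refine Prod.ext (Equiv.ext fun c => Fin.ext ?_) (funext fun c => ?_)
  · simp only [psi, swap, Equiv.trans_apply, rotDown_val, simpleRefl_val_of_ne]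
    have := (p.1 c).2
    have := i.2
    have := j.2
    generalize ((p.1 c : Fin n) : ℕ) = k at *
    split_ifs <;> first | omega | contradiction
  · simp only [psi, swap, Equiv.trans_apply, simpleRefl_val_of_ne]
    congr 1
    split_ifs <;> omega

/-- Two shifts carry the numbers `1, 2` to `n - 1, n`, each passing once around the end. -/
theorem psi_psi_swap (p : Labelling n μ) (i j : Fin (n - 1)) (h : (i : ℕ) = 0)
    (h' : (j : ℕ) + 1 = n - 1) : (p.swap i).psi.psi = p.psi.psi.swap j := by
  refine Prod.ext (Equiv.ext fun c => Fin.ext ?_) (funext fun c => ?_)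
  · simp only [psi, swap, Equiv.trans_apply, rotDown_val, simpleRefl_val_of_ne]
    have := (p.1 c).2
    have := i.2
    generalize ((p.1 c : Fin n) : ℕ) = k at *
    rcases k with _ | _ | k
    all_goals split_ifs <;> first | omega | contradiction
  · simp only [psi, swap, Equiv.trans_apply, simpleRefl_val_of_ne, rotDown_val]
    have := (p.1 c).2
    have := i.2
    generalize ((p.1 c : Fin n) : ℕ) = k at *
    rcases k with _ | _ | k
    all_goals split_ifs <;> omega

theorem swap_braid (p : Labelling n μ) (i j : Fin (n - 1)) (h : (j : ℕ) = i + 1) :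
    ((p.swap i).swap j).swap i = ((p.swap j).swap i).swap j := by
  refine Prod.ext (Equiv.ext fun c => ?_) rfl
  exact Equiv.congr_fun (simpleRefl_braid h) (p.1 c)

theorem swap_comm (p : Labelling n μ) (i j : Fin (n - 1)) (h : (i : ℕ) + 1 < j) :
    (p.swap i).swap j = (p.swap j).swap i := by
  refine Prod.ext (Equiv.ext fun c => ?_) rfl
  exact Equiv.congr_fun (simpleRefl_comm h) (p.1 c)

/-- The operator `t T_i⁻¹`. -/
def opR (i : Fin (n - 1)) : (Labelling n μ →₀ Kqt) →ₗ[Kqt] (Labelling n μ →₀ Kqt) :=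
  Finsupp.linearCombination Kqt fun p =>
    diagCoef (p.wc (lo i)) (p.wc (hi i)) • Finsupp.single p (1 : Kqt) +
      offCoef (p.wc (lo i)) (p.wc (hi i)) • Finsupp.single (p.swap i) 1

/-- The operator `θ_i`. -/
def opθ (i : Fin n) : (Labelling n μ →₀ Kqt) →ₗ[Kqt] (Labelling n μ →₀ Kqt) :=
  Finsupp.linearCombination Kqt fun p => qtp (p.wc i) • Finsupp.single p (1 : Kqt)

/-- The raising operator. -/
def opγ (hn : 0 < n) : (Labelling n μ →₀ Kqt) →ₗ[Kqt] (Labelling n μ →₀ Kqt) :=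
  Finsupp.linearCombination Kqt fun p =>
    (q ^ (p.wc ⟨0, hn⟩).1)⁻¹ • Finsupp.single p.psi (1 : Kqt)

theorem opR_single (i : Fin (n - 1)) (p : Labelling n μ) : opR i (Finsupp.single p 1) =
    diagCoef (p.wc (lo i)) (p.wc (hi i)) • Finsupp.single p (1 : Kqt) +
      offCoef (p.wc (lo i)) (p.wc (hi i)) • Finsupp.single (p.swap i) 1 := by
  rw [opR, Finsupp.linearCombination_single, one_smul]

theorem opθ_single (i : Fin n) (p : Labelling n μ) : opθ i (Finsupp.single p 1) =
    qtp (p.wc i) • Finsupp.single p (1 : Kqt) := by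
  rw [opθ, Finsupp.linearCombination_single, one_smul]

theorem opγ_single (hn : 0 < n) (p : Labelling n μ) : opγ hn (Finsupp.single p 1) =
    (q ^ (p.wc ⟨0, hn⟩).1)⁻¹ • Finsupp.single p.psi (1 : Kqt) := by
  rw [opγ, Finsupp.linearCombination_single, one_smul]

/-- On the span of `p` and its exchange the operator has trace `t - 1` and determinant `-t`; `e2`
and `e1` are these two facts. -/
theorem opR_sq (i : Fin (n - 1)) (p : Labelling n μ)
    (h : qtp (p.wc (lo i)) ≠ qtp (p.wc (hi i))) :
    opR i (opR i (Finsupp.single p 1)) =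
      (t - 1) • opR i (Finsupp.single p 1) + t • Finsupp.single p (1 : Kqt) := by
  simp only [opR_single, map_add, map_smul, wc_swap, swap_swap, simpleRefl_lo, simpleRefl_hi]
  have h1 := offCoef_mul h
  have h2 : qtp (p.wc (lo i)) - qtp (p.wc (hi i)) ≠ 0 := sub_ne_zero.2 h
  have h3 : qtp (p.wc (hi i)) - qtp (p.wc (lo i)) ≠ 0 := sub_ne_zero.2 h.symm
  have e1 : diagCoef (p.wc (lo i)) (p.wc (hi i)) * diagCoef (p.wc (lo i)) (p.wc (hi i)) +
      offCoef (p.wc (lo i)) (p.wc (hi i)) * offCoef (p.wc (hi i)) (p.wc (lo i)) =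
      (t - 1) * diagCoef (p.wc (lo i)) (p.wc (hi i)) + t := by
    rw [h1, diagCoef]
    field_simp
    ring
  have e2 : diagCoef (p.wc (lo i)) (p.wc (hi i)) + diagCoef (p.wc (hi i)) (p.wc (lo i)) =
      t - 1 := by
    rw [diagCoef, diagCoef]
    field_simp
    ring
  linear_combination (norm := module) e1 • Finsupp.single p (1 : Kqt) +
    e2 • offCoef (p.wc (lo i)) (p.wc (hi i)) • Finsupp.single (p.swap i) (1 : Kqt)

theorem opR_θ_opR (i : Fin (n - 1)) (p : Labelling n μ)
    (h : qtp (p.wc (lo i)) ≠ qtp (p.wc (hi i))) :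
    opR i (opθ (lo i) (opR i (Finsupp.single p 1))) =
      t • opθ (hi i) (Finsupp.single p (1 : Kqt)) := by
  simp only [opR_single, opθ_single, map_add, map_smul, wc_swap, swap_swap, simpleRefl_lo,
    simpleRefl_hi]
  have h1 := offCoef_mul h
  have h2 : qtp (p.wc (lo i)) - qtp (p.wc (hi i)) ≠ 0 := sub_ne_zero.2 h
  have h3 : qtp (p.wc (hi i)) - qtp (p.wc (lo i)) ≠ 0 := sub_ne_zero.2 h.symm
  have e1 : diagCoef (p.wc (lo i)) (p.wc (hi i)) ^ 2 * qtp (p.wc (lo i)) +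
      qtp (p.wc (hi i)) *
        (offCoef (p.wc (lo i)) (p.wc (hi i)) * offCoef (p.wc (hi i)) (p.wc (lo i))) =
      t * qtp (p.wc (hi i)) := by
    rw [h1, diagCoef]
    field_simp
    ring
  have e2 : diagCoef (p.wc (lo i)) (p.wc (hi i)) * qtp (p.wc (lo i)) +
      diagCoef (p.wc (hi i)) (p.wc (lo i)) * qtp (p.wc (hi i)) = 0 := by
    rw [diagCoef, diagCoef]
    field_simp
    ring
  linear_combination (norm := module) e1 • Finsupp.single p (1 : Kqt) +
    e2 • offCoef (p.wc (lo i)) (p.wc (hi i)) • Finsupp.single (p.swap i) (1 : Kqt)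

theorem opR_comm (i j : Fin (n - 1)) (h : (i : ℕ) + 1 < j) (p : Labelling n μ) :
    opR i (opR j (Finsupp.single p 1)) = opR j (opR i (Finsupp.single p 1)) := by
  have e1 := simpleRefl_lo_of_lt h
  have e2 : simpleRefl i (hi j) = hi j := simpleRefl_hi_of_lt (by omega)
  have e3 : simpleRefl j (lo i) = lo i := simpleRefl_lo_of_gt (by omega)
  have e4 := simpleRefl_hi_of_gt h
  simp only [opR_single, map_add, map_smul, wc_swap, e1, e2, e3, e4, swap_comm p i j h]
  module

theorem opR_opθ (i : Fin (n - 1)) (j : Fin n) (h : j ≠ lo i) (h' : j ≠ hi i)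
    (p : Labelling n μ) :
    opR i (opθ j (Finsupp.single p 1)) = opθ j (opR i (Finsupp.single p 1)) := by
  simp only [opR_single, opθ_single, map_add, map_smul, wc_swap, simpleRefl_of_ne i h h']
  module

/-- Both sides are expanded over the labellings that arise from `p` by permuting three numbers. Only
the coefficients at `p`, `s_i p` and `s_j p` need an identity of rational functions; these are `c1`,
`c2`, `c3`. -/
theorem opR_braid (i j : Fin (n - 1)) (h : (j : ℕ) = i + 1) (p : Labelling n μ)
    (h1 : qtp (p.wc (lo i)) ≠ qtp (p.wc (hi i))) (h2 : qtp (p.wc (hi i)) ≠ qtp (p.wc (hi j)))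
    (h3 : qtp (p.wc (lo i)) ≠ qtp (p.wc (hi j))) :
    opR i (opR j (opR i (Finsupp.single p 1))) = opR j (opR i (opR j (Finsupp.single p 1))) := by
  have hlj := lo_eq_hi h
  have e0 : simpleRefl i (hi j) = hi j := simpleRefl_hi_of_lt (by omega)
  have e1 : simpleRefl j (lo i) = lo i := simpleRefl_lo_of_gt (by omega)
  have e2 : simpleRefl j (hi i) = hi j := by rw [← hlj, simpleRefl_lo]
  have e3 : simpleRefl j (hi j) = hi i := by rw [simpleRefl_hi, hlj]
  have hb := p.swap_braid i j h
  have b1 := offCoef_mul h1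
  have b2 := offCoef_mul h2
  simp only [opR_single, map_add, map_smul, wc_swap, hlj, e0, e1, e2, e3, simpleRefl_lo,
    simpleRefl_hi, swap_swap, hb]
  generalize p.wc (lo i) = x at *
  generalize p.wc (hi i) = y at *
  generalize p.wc (hi j) = z at *
  have n1 : qtp x - qtp y ≠ 0 := sub_ne_zero.2 h1
  have n2 : qtp y - qtp z ≠ 0 := sub_ne_zero.2 h2
  have n3 : qtp x - qtp z ≠ 0 := sub_ne_zero.2 h3
  have n1' : qtp y - qtp x ≠ 0 := sub_ne_zero.2 h1.symm
  have n2' : qtp z - qtp y ≠ 0 := sub_ne_zero.2 h2.symm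
  have c1 : diagCoef x y ^ 2 * diagCoef y z + diagCoef x z * (offCoef x y * offCoef y x) =
      diagCoef y z ^ 2 * diagCoef x y + diagCoef x z * (offCoef y z * offCoef z y) := by
    rw [b1, b2, diagCoef, diagCoef, diagCoef]
    field_simp
    ring
  have c2 : diagCoef x y * diagCoef y z + diagCoef x z * diagCoef y x =
      diagCoef y z * diagCoef x z := by
    simp only [diagCoef]
    field_simp
    ring
  have c3 : diagCoef x y * diagCoef x z =
      diagCoef y z * diagCoef x y + diagCoef x z * diagCoef z y := by
    simp only [diagCoef]
    field_simp
    ring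
  linear_combination (norm := module) c1 • Finsupp.single p (1 : Kqt) +
    c2 • offCoef x y • Finsupp.single (p.swap i) (1 : Kqt) +
    c3 • offCoef y z • Finsupp.single (p.swap j) (1 : Kqt)

theorem opγ_opR (hn : 0 < n) (i j : Fin (n - 1)) (h : (j : ℕ) = i + 1) (p : Labelling n μ) :
    opγ hn (opR j (Finsupp.single p 1)) = opR i (opγ hn (Finsupp.single p 1)) := by
  have e1 : simpleRefl j ⟨0, hn⟩ = ⟨0, hn⟩ := simpleRefl_of_ne j
    (by simp [Fin.ext_iff, lo]; omega) (by simp [Fin.ext_iff, hi])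
  simp only [opR_single, opγ_single, map_add, map_smul, wc_swap, e1, psi_swap p i j h,
    wc_psi p (lo i) (lo j) h, wc_psi p (hi i) (hi j) (by simp [hi]; omega)]
  module

/-- After two shifts both eigenvalues are multiplied by `q`, which leaves the coefficients alone.
The rescaling factors also agree, since together they depend symmetrically on the exponents of the
first two numbers. -/
theorem opγ_opγ_opR (hn : 0 < n) (i j : Fin (n - 1)) (h : (i : ℕ) = 0) (h' : (j : ℕ) + 1 = n - 1)
    (p : Labelling n μ) : opγ hn (opγ hn (opR i (Finsupp.single p 1))) =
      opR j (opγ hn (opγ hn (Finsupp.single p 1))) := by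
  have e0 : (⟨0, hn⟩ : Fin n) = lo i := Fin.ext h.symm
  have e1 : ∀ p : Labelling n μ, p.psi.psi.wc (lo j) =
      ((p.wc (lo i)).1 + 1, (p.wc (lo i)).2) := fun p => by
    rw [wc_psi p.psi (lo j) (hi j) rfl, wc_psi_last p (hi j) (lo i) h (by simp [hi]; omega)]
  have e2 : ∀ p : Labelling n μ, p.psi.psi.wc (hi j) =
      ((p.wc (hi i)).1 + 1, (p.wc (hi i)).2) := fun p => by
    rw [wc_psi_last p.psi (hi j) (lo i) h (by simp [hi]; omega), wc_psi p (lo i) (hi i) rfl]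
  simp only [opR_single, opγ_single, map_add, map_smul, psi_psi_swap p i j h h', e1, e2, e0,
    diagCoef_succ, offCoef_succ, wc_psi _ (lo i) (hi i) rfl, wc_swap, simpleRefl_lo, simpleRefl_hi]
  module

theorem opγ_opθ (hn : 0 < n) (i j : Fin n) (h : (j : ℕ) = i + 1) (p : Labelling n μ) :
    opγ hn (opθ j (Finsupp.single p 1)) = opθ i (opγ hn (Finsupp.single p 1)) := by
  simp only [opθ_single, opγ_single, map_smul, wc_psi p i j h]
  module

theorem opθ_opγ (hn : 0 < n) (i j : Fin n) (h : (i : ℕ) = 0) (h' : (j : ℕ) + 1 = n)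
    (p : Labelling n μ) :
    opθ j (opγ hn (Finsupp.single p 1)) = q • opγ hn (opθ i (Finsupp.single p 1)) := by
  simp only [opθ_single, opγ_single, map_smul, wc_psi_last p j i h h', qtp_succ]
  module

end Labelling

/-! ## Periodic standard tableaux -/

namespace PSYT

/-- The labelling that belongs to a periodic standard tableau. -/
def toLabelling (τ : PSYT n μ) : Labelling n μ := (τ.idx, τ.wt)

theorem toLabelling_injective : Function.Injective (toLabelling (n := n) (μ := μ)) :=
  fun _ _ h => PSYT.ext (congrArg Prod.fst h) (congrArg Prod.snd h)

/-- The exponent and the content of a number. -/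
def wc (τ : PSYT n μ) (i : Fin n) : ℕ × ℤ := (τ.w i, τ.c i)

theorem IsSwap.toLabelling {i : Fin (n - 1)} {τ τ' : PSYT n μ} (h : IsSwap i τ τ') :
    τ'.toLabelling = τ.toLabelling.swap i := Prod.ext h.1 h.2

theorem offCoef_of_not_isSwap {i : Fin (n - 1)} {τ : PSYT n μ} (h : ¬ ∃ τ', IsSwap i τ τ') :
    offCoef (τ.wc (lo i)) (τ.wc (hi i)) = 0 := by
  have h1 := not_isSwap h
  exact offCoef_of_adj h1.1 (h1.2.imp And.right And.right)

end PSYT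

/-- The model of the induced module with a basis of periodic standard tableaux. -/
def Model (n : ℕ) (μ : YoungDiagram) : Type := PSYT n μ →₀ Kqt

instance : AddCommGroup (Model n μ) := inferInstanceAs (AddCommGroup (PSYT n μ →₀ Kqt))

instance : Module Kqt (Model n μ) := inferInstanceAs (Module Kqt (PSYT n μ →₀ Kqt))

namespace Model

/-- The basis vector `τ`. -/
def e (τ : PSYT n μ) : Model n μ := Finsupp.single τ (1 : Kqt)

/-- The linear map with given values on the basis. -/
def lin {M : Type} [AddCommGroup M] [Module Kqt M] (f : PSYT n μ → M) : Model n μ →ₗ[Kqt] M :=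
  (Finsupp.linearCombination Kqt f : (PSYT n μ →₀ Kqt) →ₗ[Kqt] M)

theorem lin_e {M : Type} [AddCommGroup M] [Module Kqt M] (f : PSYT n μ → M) (τ : PSYT n μ) :
    lin f (e τ) = f τ :=
  (Finsupp.linearCombination_single Kqt 1 τ).trans (one_smul _ _)

/-- The embedding in the space spanned by all labellings. -/
def incl : Model n μ →ₗ[Kqt] (Labelling n μ →₀ Kqt) :=
  (Finsupp.lmapDomain Kqt Kqt PSYT.toLabelling :
    (PSYT n μ →₀ Kqt) →ₗ[Kqt] (Labelling n μ →₀ Kqt))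

theorem incl_e (τ : PSYT n μ) : incl (e τ) = Finsupp.single τ.toLabelling 1 :=
  Finsupp.mapDomain_single

theorem incl_injective : Function.Injective (incl (n := n) (μ := μ)) :=
  Finsupp.mapDomain_injective PSYT.toLabelling_injective

theorem ext_e {M : Type} [AddCommGroup M] [Module Kqt M] {f g : Model n μ →ₗ[Kqt] M}
    (h : ∀ τ, f (e τ) = g (e τ)) : f = g :=
  Finsupp.lhom_ext' fun τ => LinearMap.ext_ring (h τ)

/-- The operator `t T_i⁻¹`. -/
def R (i : Fin (n - 1)) : Module.End Kqt (Model n μ) :=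
  lin fun τ =>
    diagCoef (τ.wc (lo i)) (τ.wc (hi i)) • e τ + offCoef (τ.wc (lo i)) (τ.wc (hi i)) • e (τ.sw i)

/-- The operator `θ_i`. -/
def θ (i : Fin n) : Module.End Kqt (Model n μ) :=
  lin fun τ => qtp (τ.wc i) • e τ

/-- The raising operator. -/
def γ (hn : 0 < n) : Module.End Kqt (Model n μ) :=
  lin fun τ => (q ^ τ.w ⟨0, hn⟩)⁻¹ • e τ.psi

theorem R_e (i : Fin (n - 1)) (τ : PSYT n μ) : R i (e τ) =
    diagCoef (τ.wc (lo i)) (τ.wc (hi i)) • e τ +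
      offCoef (τ.wc (lo i)) (τ.wc (hi i)) • e (τ.sw i) := by
  rw [R, lin_e]

theorem θ_e (i : Fin n) (τ : PSYT n μ) : θ i (e τ) = qtp (τ.wc i) • e τ := by
  rw [θ, lin_e]

theorem γ_e (hn : 0 < n) (τ : PSYT n μ) : γ hn (e τ) = (q ^ τ.w ⟨0, hn⟩)⁻¹ • e τ.psi := by
  rw [γ, lin_e]

/-- When the exchange is not a tableau, `sw` returns `τ` itself while the exchanged labelling lies
outside the image; both terms carry the coefficient zero. -/
theorem incl_R (i : Fin (n - 1)) (v : Model n μ) : incl (R i v) = Labelling.opR i (incl v) := by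
  have : incl ∘ₗ R i = Labelling.opR i ∘ₗ incl (n := n) (μ := μ) := ext_e fun τ => by
    simp only [LinearMap.comp_apply, incl_e, R_e, Labelling.opR_single, map_add, map_smul]
    congr 1
    by_cases h : ∃ τ', PSYT.IsSwap i τ τ'
    · rw [(PSYT.isSwap_sw h).toLabelling]; rfl
    · have h1 := PSYT.offCoef_of_not_isSwap h
      rw [h1, zero_smul]
      exact (smul_eq_zero_of_left h1 _).symm
  exact LinearMap.congr_fun this v

theorem incl_θ (i : Fin n) (v : Model n μ) : incl (θ i v) = Labelling.opθ i (incl v) := by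
  have : incl ∘ₗ θ i = Labelling.opθ i ∘ₗ incl (n := n) (μ := μ) := ext_e fun τ => by
    simp only [LinearMap.comp_apply, incl_e, θ_e, Labelling.opθ_single, map_smul]
    rfl
  exact LinearMap.congr_fun this v

theorem incl_γ (hn : 0 < n) (v : Model n μ) : incl (γ hn v) = Labelling.opγ hn (incl v) := by
  have : incl ∘ₗ γ hn = Labelling.opγ hn ∘ₗ incl (n := n) (μ := μ) := ext_e fun τ => by
    simp only [LinearMap.comp_apply, incl_e, γ_e, Labelling.opγ_single, map_smul]
    rfl
  exact LinearMap.congr_fun this v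

theorem end_ext {f g : Module.End Kqt (Model n μ)}
    (h : ∀ τ, incl (f (e τ)) = incl (g (e τ))) : f = g :=
  ext_e fun τ => incl_injective (h τ)

theorem R_sq (i : Fin (n - 1)) : R i * R i =
    (t - 1) • R i + t • (1 : Module.End Kqt (Model n μ)) := end_ext fun τ => by
  simp only [Module.End.mul_apply, LinearMap.add_apply, LinearMap.smul_apply, Module.End.one_apply,
    map_add, map_smul, incl_R, incl_e]
  exact Labelling.opR_sq i _ (τ.ev_ne (lo_lt_hi i) (by simp [lo, hi]))

/-- The operator `T_i`. -/
def T (i : Fin (n - 1)) : Module.End Kqt (Model n μ) := R i - (t - 1) • 1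

theorem T_quad (i : Fin (n - 1)) :
    (T i - 1) * (T i + algebraMap Kqt (Module.End Kqt (Model n μ)) t) = 0 := by
  have h := R_sq (μ := μ) i
  rw [T, Algebra.algebraMap_eq_smul_one]
  have e : (R i - (t - 1) • (1 : Module.End Kqt (Model n μ)) - 1) *
      (R i - (t - 1) • 1 + t • 1) = R i * R i - ((t - 1) • R i + t • 1) := by
    simp only [sub_mul, mul_add, mul_sub, smul_mul_assoc, mul_smul_comm, mul_one, one_mul]
    module
  rw [e, h, sub_self]

theorem tInv_T (i : Fin (n - 1)) : tInv (T i : Module.End Kqt (Model n μ)) = t⁻¹ • R i := by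
  rw [tInv, T, Algebra.algebraMap_eq_smul_one, sub_add_cancel]

theorem R_braid (i j : Fin (n - 1)) (h : (j : ℕ) = i + 1) :
    (R i * R j * R i : Module.End Kqt (Model n μ)) = R j * R i * R j := end_ext fun τ => by
  simp only [Module.End.mul_apply, incl_R, incl_e]
  exact Labelling.opR_braid i j h _ (τ.ev_ne (lo_lt_hi i) (by simp [lo, hi]))
    (τ.ev_ne (by simp [hi]; omega) (by simp [hi]; omega))
    (τ.ev_ne (by simp [lo, hi]; omega) (by simp [lo, hi]; omega))

/-- Since `T_i = R_i - (t - 1)`, the two braid relations differ by terms that the quadratic relation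
balances. -/
theorem T_braid (i j : Fin (n - 1)) (h : (j : ℕ) = i + 1) :
    (T i * T j * T i : Module.End Kqt (Model n μ)) = T j * T i * T j := by
  have h1 := R_braid (μ := μ) i j h
  have h2 := R_sq (μ := μ) i
  have h3 := R_sq (μ := μ) j
  simp only [T, sub_mul, mul_sub, smul_mul_assoc, mul_smul_comm, mul_one, one_mul, h1, h2, h3]
  module

theorem T_comm (i j : Fin (n - 1)) (h : (i : ℕ) + 1 < j) :
    Commute (T i : Module.End Kqt (Model n μ)) (T j) := by
  have h1 : Commute (R i : Module.End Kqt (Model n μ)) (R j) := end_ext fun τ => by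
    simp only [Module.End.mul_apply, incl_R, incl_e]
    exact Labelling.opR_comm i j h _
  have h2 : ∀ x : Module.End Kqt (Model n μ), Commute x ((t - 1) • 1) := fun x =>
    (Commute.one_right x).smul_right _
  exact (h1.sub_right (h2 _)).sub_left ((h2 _).symm.sub_right (h2 _))

/-- Each relation is checked on a basis vector after embedding in the span of all labellings, where
exchange and shift are total. -/
theorem raisingData : RaisingData N (extendFin (T (n := N + 1) (μ := μ)))
    (extendFin fun i => tInv (T (n := N + 1) (μ := μ) i)) (extendFin (θ (n := N + 1) (μ := μ)))
    (γ (Nat.succ_pos N)) := by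
  have eT : ∀ i (h : i < N), extendFin (T (n := N + 1) (μ := μ)) i = T (n := N + 1) ⟨i, h⟩ :=
    fun i h => extendFin_of_lt (m := N) _ h
  have eT' : ∀ i (h : i < N), extendFin (fun i => tInv (T (n := N + 1) (μ := μ) i)) i =
      tInv (T (n := N + 1) ⟨i, h⟩) :=
    fun i h => extendFin_of_lt (m := N) (fun i => tInv (T (n := N + 1) (μ := μ) i)) h
  have eθ : ∀ i (h : i < N + 1), extendFin (θ (n := N + 1) (μ := μ)) i = θ ⟨i, h⟩ :=
    fun i h => extendFin_of_lt _ h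
  constructor
  · constructor
    · constructor
      · intro i h; rw [eT i h, eT' i h]; exact mul_tInv (T_quad _)
      · intro i h; rw [eT i h, eT' i h]; exact tInv_mul (T_quad _)
      · intro i h; rw [eT i (by omega), eT (i + 1) h]; exact T_braid _ _ rfl
      · intro i j h h'; rw [eT i (by omega), eT j h']; exact T_comm _ _ h
    · intro i h
      rw [eT' i h, eθ i (by omega), eθ (i + 1) (by omega), tInv_T, smul_mul_assoc, mul_smul_comm,
        smul_mul_assoc, smul_smul, smul_smul, mul_inv_cancel₀ t_ne_zero, one_mul]
      have : (R (n := N + 1) (μ := μ) ⟨i, h⟩ * θ (lo ⟨i, h⟩) * R ⟨i, h⟩) =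
          t • θ (hi ⟨i, h⟩) := end_ext fun τ => by
        simp only [Module.End.mul_apply, LinearMap.smul_apply, map_smul, incl_R, incl_θ, incl_e]
        exact Labelling.opR_θ_opR _ _ (τ.ev_ne (lo_lt_hi _) (by simp [lo, hi]))
      change _ = t⁻¹ • (R (n := N + 1) (μ := μ) ⟨i, h⟩ * θ (lo ⟨i, h⟩) * R ⟨i, h⟩)
      rw [this, smul_smul, inv_mul_cancel₀ t_ne_zero, one_smul]
      rfl
    · intro i h
      rw [eT _ h, eθ 0 (by omega), T]
      refine Commute.sub_left ?_ ((Commute.one_left _).smul_left _)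
      refine end_ext fun τ => ?_
      simp only [Module.End.mul_apply, incl_R, incl_θ, incl_e]
      exact Labelling.opR_opθ _ _ (by simp [Fin.ext_iff, lo]) (by simp [Fin.ext_iff, hi]) _
    · intro h
      rw [eθ 0 (by omega), eθ 1 (by omega)]
      refine ext_e fun τ => ?_
      simp only [Module.End.mul_apply, θ_e, map_smul]
      module
  · intro i h
    rw [eT i (by omega), eT (i + 1) h, T, T, mul_sub, sub_mul, mul_smul_comm, smul_mul_assoc, mul_one,
      one_mul]
    congr 1
    refine end_ext fun τ => ?_
    simp only [Module.End.mul_apply, incl_R, incl_γ, incl_e]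
    exact Labelling.opγ_opR _ _ _ rfl _
  · intro h
    rw [eT 0 h, eT (N - 1) (by omega), T, T, mul_sub, sub_mul, mul_smul_comm, smul_mul_assoc, mul_one,
      one_mul]
    congr 1
    refine end_ext fun τ => ?_
    simp only [Module.End.mul_apply, incl_R, incl_γ, incl_e]
    exact Labelling.opγ_opγ_opR _ _ _ rfl (by simp; omega) _
  · intro i h
    rw [eθ i (by omega), eθ (i + 1) (by omega)]
    refine end_ext fun τ => ?_
    simp only [Module.End.mul_apply, incl_θ, incl_γ, incl_e]
    exact Labelling.opγ_opθ _ _ _ rfl _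
  · rw [eθ N (by omega), eθ 0 (by omega)]
    refine end_ext fun τ => ?_
    simp only [Module.End.mul_apply, LinearMap.smul_apply, map_smul, incl_θ, incl_γ, incl_e]
    exact Labelling.opθ_opγ _ _ _ rfl rfl _

variable (n μ) in
/-- The double affine Hecke algebra acts on the model. -/
theorem exists_hom : ∃ f : DAHA n →ₐ[Kqt] Module.End Kqt (Model n μ),
    (∀ i, t • tInv (f (DAHA.T i)) = R i) ∧ (∀ i, f (DAHA.θ i) = θ i) ∧
    ∀ hn, f (DAHA.X ⟨n - 1, Nat.sub_lt hn one_pos⟩) = γ hn * f (DAHA.π hn) := by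
  rcases n with _ | N
  · refine ⟨Presented.lift (fun g => match g with
      | DGen.T i => i.elim0
      | DGen.θ i => i.elim0
      | DGen.X i => i.elim0) ?_, fun i => i.elim0, fun i => i.elim0, fun hn => absurd hn (lt_irrefl _)⟩
    intro x y h
    cases h with
    | quad i => exact i.elim0
    | braid i => exact i.elim0
    | far i => exact i.elim0
    | θθ i => exact i.elim0
    | θsucc i => exact i.elim0
    | Tθ i => exact i.elim0
    | XX i => exact i.elim0
    | Xsucc i => exact i.elim0
    | TX i => exact i.elim0
    | πX hn => exact absurd hn (lt_irrefl _)
    | πXlast hn => exact absurd hn (lt_irrefl _)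
  · obtain ⟨f, h1, h2, h3⟩ := exists_DAHA_hom (A := Module.End Kqt (Model (N + 1) μ))
      (T (n := N + 1)) θ (γ (Nat.succ_pos N)) T_quad raisingData
    refine ⟨f, fun i => ?_, h2, h3⟩
    have h1' : f (DAHA.T i) = T i := h1 i
    rw [h1', tInv_T, smul_smul, mul_inv_cancel₀ t_ne_zero, one_smul]

end Model

end Murnaghan

end

noncomputable section

namespace Murnaghan

variable {n : ℕ} {μ : YoungDiagram}

/-! # Relations of the double affine Hecke algebra -/

theorem Presented.induction {X : Type} {r : FreeAlgebra Kqt X → FreeAlgebra Kqt X → Prop}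
    (S : Subalgebra Kqt (Presented r)) (h : ∀ x, Presented.mk r (FreeAlgebra.ι Kqt x) ∈ S)
    (d : Presented r) : d ∈ S := by
  obtain ⟨x, rfl⟩ : ∃ x, Presented.mk r x = d := RingQuot.mkAlgHom_surjective Kqt r d
  induction x using FreeAlgebra.induction with
  | grade0 a => rw [AlgHom.commutes]; exact S.algebraMap_mem a
  | grade1 x => exact h x
  | mul a b ha hb => rw [map_mul]; exact S.mul_mem ha hb
  | add a b ha hb => rw [map_add]; exact S.add_mem ha hb

namespace DAHA

theorem quad (i : Fin (n - 1)) : (T i - 1) * (T i + algebraMap Kqt (DAHA n) t) = 0 := by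
  simpa [T] using Presented.mk_rel (DRel.quad (n := n) i)

theorem θ_hi (i : Fin (n - 1)) :
    (θ (hi i) : DAHA n) = t • (tInv (T i) * θ (lo i) * tInv (T i)) := by
  simpa [θ, T, map_tInv] using Presented.mk_rel (DRel.θsucc (n := n) i)

theorem X_comm (i j : Fin n) : Commute (X i : DAHA n) (X j) := by
  show _ = _
  simpa [X] using Presented.mk_rel (DRel.XX (n := n) i j)

theorem X_hi (i : Fin (n - 1)) :
    (X (hi i) : DAHA n) = t • (tInv (T i) * X (lo i) * tInv (T i)) := by
  simpa [X, T, map_tInv] using Presented.mk_rel (DRel.Xsucc (n := n) i)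

theorem T_mul_X_of_ne (i : Fin (n - 1)) (j : Fin n) (h : j ≠ lo i ∧ j ≠ hi i) :
    (T i * X j : DAHA n) = X j * T i := by
  simpa [X, T] using Presented.mk_rel (DRel.TX (n := n) i j h)

theorem π_eq (hn : 0 < n) :
    (π hn : DAHA n) = Presented.mk (DRel n) (piElt hn DGen.fT DGen.fθ) :=
  (map_piElt hn (Presented.mk (DRel n)) DGen.fT DGen.fθ).symm

theorem π_mul_X_lo (hn : 0 < n) (i : Fin (n - 1)) :
    (π hn * X (lo i) : DAHA n) = X (hi i) * π hn := by
  simpa [X, π_eq] using Presented.mk_rel (DRel.πX (n := n) hn i)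

theorem π_mul_X_last (hn : 0 < n) :
    (π hn * X ⟨n - 1, Nat.sub_lt hn one_pos⟩ : DAHA n) = q • (X ⟨0, hn⟩ * π hn) := by
  simpa [X, π_eq] using Presented.mk_rel (DRel.πXlast (n := n) hn)

theorem T_mul_tInv (i : Fin (n - 1)) : (T i * tInv (T i) : DAHA n) = 1 := mul_tInv (quad i)

theorem tInv_mul_T (i : Fin (n - 1)) : (tInv (T i) * T i : DAHA n) = 1 := tInv_mul (quad i)

theorem T_mul_X_hi (i : Fin (n - 1)) : (T i * X (hi i) : DAHA n) = t • (X (lo i) * tInv (T i)) := by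
  rw [X_hi, mul_smul_comm, ← mul_assoc, ← mul_assoc, T_mul_tInv, one_mul]

theorem tInv_eq {R : Type} [Ring R] [Algebra Kqt R] (x : R) :
    t • tInv x = x + (t - 1) • (1 : R) := by
  rw [tInv, smul_smul, mul_inv_cancel₀ t_ne_zero, one_smul, Algebra.algebraMap_eq_smul_one]

theorem T_mul_X_hi' (i : Fin (n - 1)) :
    (T i * X (hi i) : DAHA n) = X (lo i) * T i + (t - 1) • X (lo i) := by
  rw [T_mul_X_hi, ← mul_smul_comm, tInv_eq, mul_add, mul_smul_comm, mul_one]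

theorem X_lo (i : Fin (n - 1)) : (X (lo i) : DAHA n) = t⁻¹ • (T i * X (hi i) * T i) := by
  rw [T_mul_X_hi, smul_mul_assoc, mul_assoc, tInv_mul_T, mul_one, smul_smul,
    inv_mul_cancel₀ t_ne_zero, one_smul]

theorem T_mul_X_lo (i : Fin (n - 1)) :
    (T i * X (lo i) : DAHA n) = X (hi i) * T i + (1 - t) • X (lo i) := by
  have h := sq_of_quad (quad (n := n) i)
  rw [X_lo, mul_smul_comm, ← mul_assoc, ← mul_assoc, h]
  simp only [add_mul, smul_mul_assoc, one_mul, smul_add, smul_smul, inv_mul_cancel₀ t_ne_zero,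
    one_smul]
  rw [mul_comm (1 - t)]
  abel

/-- The product of the inverses of the `T_i` has a right inverse. -/
theorem exists_right_inv (S : Subalgebra Kqt (DAHA n)) (hS : ∀ i, T i ∈ S) :
    ∃ u ∈ S, (List.ofFn fun i => tInv (T i : DAHA n)).prod * u = 1 := by
  rw [List.ofFn_eq_map]
  generalize List.finRange (n - 1) = l
  induction l with
  | nil => exact ⟨1, S.one_mem, by simp⟩
  | cons i l ih =>
    obtain ⟨u, hu, hu'⟩ := ih
    refine ⟨u * T i, S.mul_mem hu (hS i), ?_⟩
    rw [List.map_cons, List.prod_cons, mul_assoc, ← mul_assoc _ u, hu', one_mul, tInv_mul_T]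

theorem tInv_mem (S : Subalgebra Kqt (DAHA n)) {x : DAHA n} (h : x ∈ S) : tInv x ∈ S :=
  S.smul_mem (S.add_mem h (S.algebraMap_mem _)) _

/-- A subalgebra that contains the `T_i`, the `X_i` and `π` is the whole algebra. -/
theorem mem_subalgebra (S : Subalgebra Kqt (DAHA n)) (hT : ∀ i, T i ∈ S) (hX : ∀ i, X i ∈ S)
    (hπ : ∀ hn, π hn ∈ S) (d : DAHA n) : d ∈ S := by
  -- The first `θ` is recovered from `π` by cancelling the inverse generators, the others from the
  -- recursion.
  have hθ : ∀ k (hk : k < n), θ ⟨k, hk⟩ ∈ S := by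
    intro k
    induction k with
    | zero =>
      intro hk
      obtain ⟨u, hu, hu'⟩ := exists_right_inv S hT
      have : θ ⟨0, hk⟩ = (t ^ (n - 1))⁻¹ • (π hk * u) := by
        rw [π, piElt, smul_mul_assoc, smul_smul, inv_mul_cancel₀ (pow_ne_zero _ t_ne_zero), one_smul,
          mul_assoc, hu', mul_one]
      rw [this]
      exact S.smul_mem (S.mul_mem (hπ hk) hu) _
    | succ k ih =>
      intro hk
      have := θ_hi (n := n) ⟨k, by omega⟩
      rw [show (θ ⟨k + 1, hk⟩ : DAHA n) = θ (hi ⟨k, by omega⟩) from rfl, this]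
      exact S.smul_mem (S.mul_mem (S.mul_mem (tInv_mem S (hT _)) (ih (by omega)))
        (tInv_mem S (hT _))) _
  refine Presented.induction S (fun x => ?_) d
  cases x with
  | T i => exact hT i
  | θ i => exact hθ i i.2
  | X i => exact hX i

end DAHA

/-- The elements of an algebra that preserve a subspace of a module. -/
def stabilizer {R M : Type} [Ring R] [Algebra Kqt R] [AddCommGroup M] [Module Kqt M] [Module R M]
    [IsScalarTower Kqt R M] (P : Submodule Kqt M) : Subalgebra Kqt R where
  carrier := {d | ∀ v ∈ P, d • v ∈ P}
  mul_mem' := fun ha hb v hv => by rw [mul_smul]; exact ha _ (hb _ hv)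
  add_mem' := fun ha hb v hv => by rw [add_smul]; exact P.add_mem (ha _ hv) (hb _ hv)
  algebraMap_mem' := fun a v hv => by rw [algebraMap_smul]; exact P.smul_mem a hv

/-! # The module `S_μ` -/

namespace Specht

theorem of_rel {x : SYT n μ →₀ Hecke n} (h : x ∈ spechtRels n μ) :
    (Submodule.Quotient.mk x : Specht n μ) = 0 :=
  (Submodule.Quotient.mk_eq_zero _).2 (Submodule.subset_span h)

theorem mk_single (τ : SYT n μ) (h : Hecke n) :
    (Submodule.Quotient.mk (Finsupp.single τ h) : Specht n μ) = h • of τ := by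
  rw [of, ← Submodule.Quotient.mk_smul, Finsupp.smul_single, smul_eq_mul, mul_one]

theorem mk_smul_single (τ : SYT n μ) (a : Kqt) :
    (Submodule.Quotient.mk (a • Finsupp.single τ (1 : Hecke n)) : Specht n μ) = a • of τ := rfl

theorem θbar_of (τ : SYT n μ) (i : Fin n) :
    Hecke.θbar i • (of τ : Specht n μ) = t ^ τ.toPSYT.c i • of τ := by
  have := of_rel (Or.inl (Or.inl (Or.inl ⟨τ, i, rfl⟩)))
  rwa [Submodule.Quotient.mk_sub, mk_single, mk_smul_single, sub_eq_zero] at this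

theorem φbar_of (τ τ' : SYT n μ) (i : Fin (n - 1)) (h : PSYT.SwapUp i τ.toPSYT τ'.toPSYT) :
    Hecke.φbar i • (of τ : Specht n μ) =
      (t ^ τ.toPSYT.c (lo i) - t ^ τ.toPSYT.c (hi i)) • of τ' := by
  have := of_rel (Or.inl (Or.inl (Or.inr ⟨i, τ, τ', h, rfl⟩)))
  rwa [Submodule.Quotient.mk_sub, mk_single, mk_smul_single, sub_eq_zero] at this

theorem T_of_row (τ : SYT n μ) (i : Fin (n - 1))
    (h : (τ.idx.symm (lo i)).1.1 = (τ.idx.symm (hi i)).1.1) :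
    Hecke.T i • (of τ : Specht n μ) = of τ := by
  have := of_rel (Or.inl (Or.inr ⟨i, τ, h, rfl⟩))
  rwa [Submodule.Quotient.mk_sub, mk_single, mk_single, one_smul, sub_eq_zero] at this

theorem T_of_col (τ : SYT n μ) (i : Fin (n - 1))
    (h : (τ.idx.symm (lo i)).1.2 = (τ.idx.symm (hi i)).1.2) :
    Hecke.T i • (of τ : Specht n μ) = (-t) • of τ := by
  have := of_rel (Or.inr ⟨i, τ, h, rfl⟩)
  rwa [Submodule.Quotient.mk_sub, mk_single, mk_smul_single, sub_eq_zero] at this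

end Specht

theorem Hecke.θbar_hi (i : Fin (n - 1)) :
    (Hecke.θbar (hi i) : Hecke n) =
      t • (tInv (Hecke.T i) * Hecke.θbar (lo i) * tInv (Hecke.T i)) := rfl

/-- By the recursion `θbar_i (t T_i⁻¹) = T_i θbar_{i+1}`. In this form all `θbar` stand on the right
and act on `τ` by scalars. -/
theorem Hecke.φbar_eq (i : Fin (n - 1)) : (Hecke.φbar i : Hecke n) =
    (Hecke.T i + (t - 1) • 1) * Hecke.θbar (lo i) - Hecke.T i * Hecke.θbar (hi i) := by
  rw [Hecke.φbar, Hecke.θbar_hi, DAHA.tInv_eq, mul_smul_comm, ← mul_assoc, ← mul_assoc,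
    mul_tInv (Hecke.quad i), one_mul, ← mul_smul_comm, DAHA.tInv_eq]

namespace Specht

/-- A standard tableau from a periodic one with exponents zero. -/
theorem exists_toPSYT {τ : PSYT n μ} (h : τ.wt = fun _ => 0) : ∃ σ : SYT n μ, σ.toPSYT = τ :=
  ⟨⟨τ.idx, fun c d hcd => by have := τ.strict c d hcd; simpa [h] using this⟩,
    PSYT.ext rfl h.symm⟩

/-- The intertwiner acts on `τ` as `(x - y) T_i + (t - 1) x` for the eigenvalues `x ≠ y` of `i` and
`i + 1`, so its defining relation can be solved for `T_i`. -/
theorem T_of_up (τ τ' : SYT n μ) (i : Fin (n - 1)) (h : PSYT.SwapUp i τ.toPSYT τ'.toPSYT) :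
    ∃ a : Kqt, Hecke.T i • (of τ : Specht n μ) = of τ' + a • of τ := by
  have h1 := φbar_of τ τ' i h
  have hne : t ^ τ.toPSYT.c (lo i) - t ^ τ.toPSYT.c (hi i) ≠ 0 := by
    rw [sub_ne_zero]
    have := τ.toPSYT.ev_ne (lo_lt_hi i) (by simp [lo, hi])
    simpa [PSYT.ev, qt, PSYT.w, SYT.toPSYT] using this
  rw [Hecke.φbar_eq, sub_smul, mul_smul, mul_smul, θbar_of, θbar_of, smul_comm (Hecke.T i),
    smul_comm (Hecke.T i + _), add_smul, smul_assoc, one_smul] at h1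
  generalize t ^ τ.toPSYT.c (lo i) = x at *
  generalize t ^ τ.toPSYT.c (hi i) = y at *
  refine ⟨-((t - 1) * x / (x - y)), ?_⟩
  have h2 : (x - y) • Hecke.T i • (of τ : Specht n μ) =
      (x - y) • (of τ' + (-((t - 1) * x / (x - y))) • of τ) := by
    rw [smul_add, smul_smul, mul_neg, mul_div_cancel₀ _ hne, ← h1]
    generalize Hecke.T i • (of τ : Specht n μ) = u
    generalize (of τ : Specht n μ) = v
    simp only [smul_add, smul_smul]
    module
  exact smul_right_injective _ hne h2

theorem T_of_mem (i : Fin (n - 1)) (τ : SYT n μ) :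
    Hecke.T i • (of τ : Specht n μ) ∈ Submodule.span Kqt (Set.range (of (n := n) (μ := μ))) := by
  have hm : ∀ σ : SYT n μ, of σ ∈ Submodule.span Kqt (Set.range (of (n := n) (μ := μ))) :=
    fun σ => Submodule.subset_span ⟨σ, rfl⟩
  by_cases h : ∃ τ', PSYT.IsSwap i τ.toPSYT τ'
  · obtain ⟨τ', h⟩ := h
    obtain ⟨τ', rfl⟩ := exists_toPSYT (τ := τ') (h.2.trans rfl)
    rcases h.up_or_up with h1 | h1
    · obtain ⟨a, ha⟩ := T_of_up τ τ' i ⟨h, h1⟩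
      rw [ha]
      exact add_mem (hm _) (Submodule.smul_mem _ _ (hm _))
    · obtain ⟨a, ha⟩ := T_of_up τ' τ i ⟨h.symm, h1⟩
      -- In the downward case apply `T_i` to `τ = T_i τ' - a τ'` and use the quadratic relation.
      have e : Hecke.T i • (of τ : Specht n μ) = (1 - t) • Hecke.T i • of τ' + t • of τ' -
          a • Hecke.T i • of τ' := by
        rw [eq_sub_iff_add_eq.2 ha.symm, smul_sub, ← mul_smul, sq_of_quad (Hecke.quad i), add_smul,
          smul_assoc, smul_assoc, one_smul, smul_comm (Hecke.T i)]
      have h2 : Hecke.T i • (of τ' : Specht n μ) ∈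
          Submodule.span Kqt (Set.range (of (n := n) (μ := μ))) := by
        rw [ha]
        exact add_mem (hm _) (Submodule.smul_mem _ _ (hm _))
      rw [e]
      exact sub_mem (add_mem (Submodule.smul_mem _ _ h2) (Submodule.smul_mem _ _ (hm _)))
        (Submodule.smul_mem _ _ h2)
  · rcases (PSYT.not_isSwap h).2 with h1 | h1
    · rw [T_of_row τ i h1.1]; exact hm _
    · rw [T_of_col τ i h1.1]; exact Submodule.smul_mem _ _ (hm _)

theorem span_of : Submodule.span Kqt (Set.range (of (n := n) (μ := μ))) = ⊤ := by
  refine Submodule.eq_top_iff'.2 fun v => ?_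
  have hs : ∀ h : Hecke n, h ∈ stabilizer (R := Hecke n)
      (Submodule.span Kqt (Set.range (of (n := n) (μ := μ)))) := by
    refine Presented.induction _ fun i v hv => ?_
    change Hecke.T i • v ∈ _
    induction hv using Submodule.span_induction with
    | mem v hv => obtain ⟨τ, rfl⟩ := hv; exact T_of_mem i τ
    | zero => rw [smul_zero]; exact zero_mem _
    | add v w _ _ hv hw => rw [smul_add]; exact add_mem hv hw
    | smul a v _ hv => rw [smul_comm]; exact Submodule.smul_mem _ _ hv
  obtain ⟨x, rfl⟩ := Submodule.Quotient.mk_surjective _ v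
  induction x using Finsupp.induction_linear with
  | zero => exact zero_mem _
  | add x y hx hy => exact add_mem hx hy
  | single τ h =>
    rw [mk_single]
    exact hs h _ (Submodule.subset_span ⟨τ, rfl⟩)

end Specht

/-! # The induced module -/

namespace V

/-- The vector `1 ⊗ v`. -/
def emb : Specht n μ →ₗ[Kqt] V n μ where
  toFun v := Submodule.Quotient.mk ((1 : DAHA n) ⊗ₜ[Kqt] v)
  map_add' v w := by rw [TensorProduct.tmul_add, Submodule.Quotient.mk_add]
  map_smul' a v := by rw [TensorProduct.tmul_smul]; rfl

theorem mk_tmul (d : DAHA n) (v : Specht n μ) :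
    (Submodule.Quotient.mk (d ⊗ₜ[Kqt] v) : V n μ) = d • emb v := by
  change _ = d • Submodule.Quotient.mk _
  rw [← Submodule.Quotient.mk_smul, TensorProduct.smul_tmul', smul_eq_mul, mul_one]

theorem affine_smul_emb (a : Affine n) (v : Specht n μ) :
    affineToDAHA n a • emb v = emb (rho n a • v) := by
  have h : (Submodule.Quotient.mk (((1 : DAHA n) * affineToDAHA n a) ⊗ₜ[Kqt] v -
      (1 : DAHA n) ⊗ₜ[Kqt] (rho n a • v)) : V n μ) = 0 :=
    (Submodule.Quotient.mk_eq_zero _).2 (Submodule.subset_span ⟨1, a, v, rfl⟩)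
  rw [Submodule.Quotient.mk_sub, sub_eq_zero, one_mul, mk_tmul, mk_tmul, one_smul] at h
  exact h

theorem affineToDAHA_T (i : Fin (n - 1)) : affineToDAHA n (Affine.T i) = DAHA.T i := by
  rw [affineToDAHA, Affine.T, Presented.lift_mk]
  simp [AGen.fT]

theorem affineToDAHA_θ (i : Fin n) : affineToDAHA n (Affine.θ i) = DAHA.θ i := by
  rw [affineToDAHA, Affine.θ, Presented.lift_mk]
  simp [AGen.fθ]

theorem rho_T (i : Fin (n - 1)) : rho n (Affine.T i) = Hecke.T i := by
  rw [rho, Affine.T, Presented.lift_mk]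
  simp [AGen.fT, rhoGen]

theorem rho_θ (i : Fin n) : rho n (Affine.θ i) = Hecke.θbar i := by
  rw [rho, Affine.θ, Presented.lift_mk]
  simp [AGen.fθ, rhoGen]

theorem heckeToDAHA_T (i : Fin (n - 1)) : heckeToDAHA n (Hecke.T i) = DAHA.T i := by
  rw [heckeToDAHA, Hecke.T, Presented.lift_mk]
  simp

theorem T_smul_emb (i : Fin (n - 1)) (v : Specht n μ) :
    DAHA.T i • emb v = emb (Hecke.T i • v) := by
  rw [← affineToDAHA_T, affine_smul_emb, rho_T]

theorem θ_smul_emb (i : Fin n) (v : Specht n μ) :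
    DAHA.θ i • emb v = emb (Hecke.θbar i • v) := by
  rw [← affineToDAHA_θ, affine_smul_emb, rho_θ]

/-- The action of `D_n` commutes with scalars. -/
theorem smul_smul_comm (d : DAHA n) (a : Kqt) (v : V n μ) : d • a • v = a • d • v := by
  rw [← algebraMap_smul (DAHA n) a v, ← mul_smul, ← Algebra.commutes, mul_smul, algebraMap_smul]

variable (n μ) in
/-- The span of the vectors `X_i ⋯ X_j ⊗ v`. -/
def wordSpan : Submodule Kqt (V n μ) :=
  Submodule.span Kqt {x | ∃ (l : List (Fin n)) (v : Specht n μ), x = (l.map DAHA.X).prod • emb v}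

theorem wordSpan_le {P : Submodule Kqt (V n μ)} (h : ∀ v, emb v ∈ P)
    (hX : ∀ i : Fin n, ∀ v ∈ P, DAHA.X i • v ∈ P) : wordSpan n μ ≤ P := by
  refine Submodule.span_le.2 ?_
  rintro x ⟨l, v, rfl⟩
  induction l with
  | nil => simpa using h v
  | cons i l ih =>
    rw [List.map_cons, List.prod_cons, mul_smul]
    exact hX i _ ih

theorem emb_mem_wordSpan (v : Specht n μ) : emb v ∈ wordSpan n μ :=
  Submodule.subset_span ⟨[], v, by simp⟩

theorem X_smul_mem_wordSpan (i : Fin n) {v : V n μ} (hv : v ∈ wordSpan n μ) :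
    DAHA.X i • v ∈ wordSpan n μ := by
  induction hv using Submodule.span_induction with
  | mem v hv =>
    obtain ⟨l, v, rfl⟩ := hv
    exact Submodule.subset_span ⟨i :: l, v, by rw [List.map_cons, List.prod_cons, mul_smul]⟩
  | zero => rw [smul_zero]; exact zero_mem _
  | add v w _ _ hv hw => rw [smul_add]; exact add_mem hv hw
  | smul a v _ hv => rw [smul_smul_comm]; exact Submodule.smul_mem _ _ hv

/-- The subspace of the vectors which an element of `D_n` maps to a given subspace. -/
def comap (d : DAHA n) (P : Submodule Kqt (V n μ)) : Submodule Kqt (V n μ) :=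
  P.comap (act μ d)

theorem mem_comap {d : DAHA n} {P : Submodule Kqt (V n μ)} {v : V n μ} :
    v ∈ comap d P ↔ d • v ∈ P := Iff.rfl

theorem exists_affine_π (hn : 0 < n) : ∃ a, affineToDAHA n a = DAHA.π hn := by
  refine ⟨piElt hn Affine.T Affine.θ, ?_⟩
  rw [map_piElt]
  simp only [affineToDAHA_T, affineToDAHA_θ]
  rfl

/-- The generators `T_i` and `π` can be moved to the right past the variables, and there they act on
`S_μ`. So the span is stable under `T_i`, `X_i` and `π`, which generate the algebra. -/
theorem wordSpan_eq_top : wordSpan n μ = ⊤ := by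
  have hT : ∀ i : Fin (n - 1), DAHA.T i ∈ stabilizer (wordSpan n μ) := by
    intro i v hv
    refine (?_ : wordSpan n μ ≤ wordSpan n μ ⊓ comap (DAHA.T i) (wordSpan n μ)) hv |>.2
    refine wordSpan_le (fun v => ⟨emb_mem_wordSpan v, ?_⟩) fun j v hv =>
      ⟨X_smul_mem_wordSpan j hv.1, ?_⟩
    · rw [SetLike.mem_coe, mem_comap, T_smul_emb]
      exact emb_mem_wordSpan _
    · have h2 : DAHA.T i • v ∈ wordSpan n μ := hv.2
      rw [SetLike.mem_coe, mem_comap, ← mul_smul]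
      by_cases h : j ≠ lo i ∧ j ≠ hi i
      · rw [DAHA.T_mul_X_of_ne i j h, mul_smul]
        exact X_smul_mem_wordSpan j h2
      · by_cases h' : j = lo i
        · rw [h', DAHA.T_mul_X_lo, add_smul, mul_smul, smul_assoc]
          exact add_mem (X_smul_mem_wordSpan _ h2)
            (Submodule.smul_mem _ _ (X_smul_mem_wordSpan _ hv.1))
        · have h'' : j = hi i := by tauto
          rw [h'', DAHA.T_mul_X_hi', add_smul, mul_smul, smul_assoc]
          exact add_mem (X_smul_mem_wordSpan _ h2)
            (Submodule.smul_mem _ _ (X_smul_mem_wordSpan _ hv.1))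
  have hπ : ∀ hn : 0 < n, DAHA.π hn ∈ stabilizer (wordSpan n μ) := by
    intro hn v hv
    refine (?_ : wordSpan n μ ≤ comap (DAHA.π hn) (wordSpan n μ)) hv
    refine wordSpan_le (fun v => ?_) fun j v hv => ?_
    · obtain ⟨a, ha⟩ := exists_affine_π hn
      rw [mem_comap, ← ha, affine_smul_emb]
      exact emb_mem_wordSpan _
    · rw [mem_comap] at hv ⊢
      rw [← mul_smul]
      by_cases h : (j : ℕ) = n - 1
      · obtain rfl : j = ⟨n - 1, Nat.sub_lt hn one_pos⟩ := Fin.ext h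
        rw [DAHA.π_mul_X_last, smul_assoc, mul_smul]
        exact Submodule.smul_mem _ _ (X_smul_mem_wordSpan _ hv)
      · obtain ⟨i, rfl⟩ : ∃ i : Fin (n - 1), lo i = j := ⟨⟨j, by omega⟩, rfl⟩
        rw [DAHA.π_mul_X_lo, mul_smul]
        exact X_smul_mem_wordSpan _ hv
  have hs := DAHA.mem_subalgebra (stabilizer (wordSpan n μ)) hT
    (fun i v hv => X_smul_mem_wordSpan i hv) hπ
  refine Submodule.eq_top_iff'.2 fun v => ?_
  obtain ⟨x, rfl⟩ := Submodule.Quotient.mk_surjective _ v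
  induction x using TensorProduct.induction_on with
  | zero => exact zero_mem _
  | add x y hx hy => exact add_mem hx hy
  | tmul d v =>
    rw [mk_tmul]
    exact hs d _ (emb_mem_wordSpan v)

/-- A subspace that contains the `1 ⊗ τ` and is preserved by the `X_i` is the whole space. -/
theorem eq_top_of_X {P : Submodule Kqt (V n μ)} (h : ∀ τ, emb (Specht.of τ) ∈ P)
    (hX : ∀ i : Fin n, ∀ v ∈ P, DAHA.X i • v ∈ P) : P = ⊤ := by
  rw [eq_top_iff, ← wordSpan_eq_top]
  refine wordSpan_le (fun v => ?_) hX
  have : (⊤ : Submodule Kqt (Specht n μ)) ≤ P.comap emb := by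
    rw [← Specht.span_of, Submodule.span_le]
    rintro _ ⟨τ, rfl⟩
    exact h τ
  exact this trivial

/-! ## Monomials -/

/-- The monomial `X^α`. -/
def monoX (α : Fin n → ℕ) : DAHA n := (List.ofFn fun i => DAHA.X i ^ α i).prod

theorem monoTensor_eq (α : Fin n → ℕ) (v : Specht n μ) : monoTensor α v = monoX α • emb v :=
  mk_tmul _ _

/-- An extra factor in place `i` of an ordered product of commuting powers can be pulled to the
front. -/
theorem prodUpTo_pow_add {A : Type} [Ring A] [Algebra Kqt A] (f : ℕ → A) (α : ℕ → ℕ)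
    (hf : ∀ i j, Commute (f i) (f j)) (i k : ℕ) :
    prodUpTo (fun j => f j ^ (α j + if j = i then 1 else 0)) k =
      (if i < k then f i else 1) * prodUpTo (fun j => f j ^ α j) k := by
  induction k with
  | zero => simp [prodUpTo]
  | succ k ih =>
    rw [prodUpTo_succ, prodUpTo_succ, ih]
    have hc : Commute (f k) (prodUpTo (fun j => f j ^ α j) k) :=
      prodUpTo_commute _ _ _ fun j _ => (hf k j).pow_right _
    by_cases h : k = i
    · subst h
      rw [if_pos rfl, if_neg (lt_irrefl _), if_pos (Nat.lt_succ_self _), pow_succ', one_mul,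
        ← mul_assoc, ← hc.eq, mul_assoc]
    · rw [if_neg h, add_zero, ← mul_assoc]
      by_cases h' : i < k
      · rw [if_pos h', if_pos (by omega)]
      · rw [if_neg h', if_neg (by omega)]

theorem X_mul_monoX (i : Fin n) (α : Fin n → ℕ) :
    DAHA.X i * monoX α = monoX (α + Pi.single i 1) := by
  have hf : ∀ j k, Commute (extendFin (DAHA.X (n := n)) j) (extendFin DAHA.X k) := by
    intro j k
    unfold extendFin
    split_ifs
    · exact DAHA.X_comm _ _
    · exact Commute.one_right _
    · exact Commute.one_left _
    · exact Commute.one_left _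
  let a : ℕ → ℕ := fun j => if h : j < n then α ⟨j, h⟩ else 0
  have h1 := prodUpTo_pow_add _ a hf i n
  rw [if_pos i.2, extendFin_coe, ← prod_ofFn_eq_prodUpTo
      (fun j : Fin n => DAHA.X j ^ (α + (Pi.single i 1 : Fin n → ℕ)) j),
    ← prod_ofFn_eq_prodUpTo (fun j => DAHA.X j ^ α j)] at h1
  · exact h1.symm
  · intro j
    simp only [extendFin_coe, a, j.2, dif_pos]
  · intro j
    simp only [extendFin_coe, a, j.2, dif_pos, Pi.add_apply, Pi.single_apply, Fin.ext_iff]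

theorem X_smul_monoTensor (i : Fin n) (α : Fin n → ℕ) (v : Specht n μ) :
    DAHA.X i • (monoTensor α v : V n μ) = monoTensor (α + Pi.single i 1) v := by
  rw [monoTensor_eq, monoTensor_eq, ← mul_smul, X_mul_monoX]

theorem monoX_zero : monoX (0 : Fin n → ℕ) = 1 := by
  rw [monoX]
  simp

theorem monoTensor_zero (v : Specht n μ) : (monoTensor 0 v : V n μ) = emb v := by
  rw [monoTensor_eq, monoX_zero, one_smul]

/-- The vectors `X^α ⊗ τ`. -/
def mono (x : (Fin n → ℕ) × SYT n μ) : V n μ := monoTensor x.1 (Specht.of x.2)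

theorem X_smul_mono (i : Fin n) (x : (Fin n → ℕ) × SYT n μ) :
    DAHA.X i • mono x = mono (x.1 + Pi.single i 1, x.2) := X_smul_monoTensor i _ _

theorem span_mono : Submodule.span Kqt (Set.range (mono (n := n) (μ := μ))) = ⊤ := by
  refine eq_top_of_X (fun τ => Submodule.subset_span ⟨(0, τ), monoTensor_zero _⟩) fun i v hv => ?_
  induction hv using Submodule.span_induction with
  | mem v hv =>
    obtain ⟨x, rfl⟩ := hv
    exact Submodule.subset_span ⟨_, (X_smul_mono i x).symm⟩
  | zero => rw [smul_zero]; exact zero_mem _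
  | add v w _ _ hv hw => rw [smul_add]; exact add_mem hv hw
  | smul a v _ hv => rw [smul_smul_comm]; exact Submodule.smul_mem _ _ hv

/-- Every monomial is obtained from `1` by multiplication by variables. -/
theorem mono_induction {P : (Fin n → ℕ) → Prop} (h0 : P 0)
    (h : ∀ i α, P α → P (α + Pi.single i 1)) (α : Fin n → ℕ) : P α := by
  induction hd : ∑ i, α i generalizing α with
  | zero =>
    have : α = 0 := funext fun i => (Finset.sum_eq_zero_iff.1 hd) i (Finset.mem_univ i)
    rw [this]; exact h0
  | succ d ih =>
    obtain ⟨i, hi⟩ : ∃ i, α i ≠ 0 := by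
      by_contra! hc
      simp [hc] at hd
    have e : α = Function.update α i (α i - 1) + Pi.single i 1 := by
      funext j
      by_cases hj : j = i
      · subst hj; simp; omega
      · simp [hj]
    rw [e] at hd ⊢
    refine h i _ (ih _ ?_)
    simp only [Pi.add_apply, Finset.sum_add_distrib] at hd
    rw [Finset.sum_pi_single' i 1 Finset.univ] at hd
    simpa using hd

end V

end Murnaghan

end

noncomputable section

namespace Murnaghan

variable {n : ℕ} {μ : YoungDiagram}

/-! # The comparison of the induced module with the model -/

namespace Model

variable (n μ) in
/-- The action of the double affine Hecke algebra on the model. -/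
def hom : DAHA n →ₐ[Kqt] Module.End Kqt (Model n μ) := (exists_hom n μ).choose

instance : Module (DAHA n) (Model n μ) :=
  Module.compHom (Model n μ) (hom n μ : DAHA n →+* Module.End Kqt (Model n μ))

theorem smul_def (d : DAHA n) (v : Model n μ) : d • v = hom n μ d v := rfl

instance : IsScalarTower Kqt (DAHA n) (Model n μ) :=
  ⟨fun a d v => by rw [smul_def, smul_def, map_smul]; rfl⟩

instance : SMulCommClass Kqt (DAHA n) (Model n μ) :=
  ⟨fun a d v => by rw [smul_def, smul_def, map_smul]⟩

instance : SMulCommClass (DAHA n) Kqt (Model n μ) := SMulCommClass.symm _ _ _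

instance : Module (Hecke n) (Model n μ) :=
  Module.compHom (Model n μ) (heckeToDAHA n : Hecke n →+* DAHA n)

theorem hecke_smul_def (h : Hecke n) (v : Model n μ) : h • v = heckeToDAHA n h • v := rfl

instance : IsScalarTower Kqt (Hecke n) (Model n μ) :=
  ⟨fun a d v => by rw [hecke_smul_def, hecke_smul_def, map_smul, smul_assoc]⟩

theorem R_eq_smul (i : Fin (n - 1)) (v : Model n μ) : t • tInv (DAHA.T i) • v = R i v := by
  rw [← (exists_hom n μ).choose_spec.1 i, smul_def, map_tInv]; rfl

theorem T_smul (i : Fin (n - 1)) (v : Model n μ) : DAHA.T i • v = R i v - (t - 1) • v := by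
  rw [← R_eq_smul, ← smul_assoc, DAHA.tInv_eq, add_smul, smul_assoc, one_smul, add_sub_cancel_right]

theorem θ_smul (i : Fin n) (v : Model n μ) : DAHA.θ i • v = θ i v :=
  LinearMap.congr_fun ((exists_hom n μ).choose_spec.2.1 i) v

theorem X_last_smul (hn : 0 < n) (v : Model n μ) :
    DAHA.X ⟨n - 1, Nat.sub_lt hn one_pos⟩ • v = γ hn (DAHA.π hn • v) :=
  LinearMap.congr_fun ((exists_hom n μ).choose_spec.2.2 hn) v

/-! ## The part of degree zero -/

variable (n μ) in
/-- The span of the standard tableaux. -/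
def stdSpan : Submodule Kqt (Model n μ) :=
  Submodule.span Kqt {x | ∃ τ : PSYT n μ, (τ.wt = fun _ => 0) ∧ x = e τ}

theorem e_mem_stdSpan (τ : SYT n μ) : e τ.toPSYT ∈ stdSpan n μ :=
  Submodule.subset_span ⟨_, rfl, rfl⟩

theorem R_mem_stdSpan (i : Fin (n - 1)) {v : Model n μ} (hv : v ∈ stdSpan n μ) :
    R i v ∈ stdSpan n μ := by
  induction hv using Submodule.span_induction with
  | mem v hv =>
    obtain ⟨τ, h, rfl⟩ := hv
    rw [R_e]
    exact add_mem (Submodule.smul_mem _ _ (Submodule.subset_span ⟨τ, h, rfl⟩))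
      (Submodule.smul_mem _ _ (Submodule.subset_span ⟨_, (PSYT.sw_wt i τ).trans h, rfl⟩))
  | zero => rw [map_zero]; exact zero_mem _
  | add v w _ _ hv hw => rw [map_add]; exact add_mem hv hw
  | smul a v _ hv => rw [map_smul]; exact Submodule.smul_mem _ _ hv

theorem tInv_smul (i : Fin (n - 1)) (v : Model n μ) : tInv (DAHA.T i) • v = t⁻¹ • R i v := by
  rw [← R_eq_smul, smul_smul, inv_mul_cancel₀ t_ne_zero, one_smul]

/-- The smallest number of a standard tableau lies in the corner. -/
theorem c_zero (hn : 0 < n) {τ : PSYT n μ} (h : τ.wt = fun _ => 0) : τ.wc ⟨0, hn⟩ = (0, 0) := by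
  have h2 : (τ.idx (τ.idx.symm ⟨0, hn⟩) : ℕ) = 0 := by rw [Equiv.apply_symm_apply]
  have h1 : (τ.idx.symm ⟨0, hn⟩).1 = (0, 0) := by
    generalize τ.idx.symm ⟨0, hn⟩ = c at *
    by_contra hc
    have h0 : (0, 0) ∈ μ.cells := μ.isLowerSet (show (0, 0) ≤ c.1 from ⟨zero_le, zero_le⟩) c.2
    have h3 := τ.strict_of_le (c := ⟨_, h0⟩) (d := c) zero_le zero_le
      (fun e => hc (by rw [← e]))
    rw [h] at h3
    simp only [Fin.lt_def] at h3
    omega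
  rw [PSYT.wc, PSYT.w, PSYT.c, h, h1]
  simp [content]

theorem θ_zero_smul (hn : 0 < n) {v : Model n μ} (hv : v ∈ stdSpan n μ) :
    DAHA.θ (⟨0, hn⟩ : Fin n) • v = v := by
  rw [θ_smul]
  induction hv using Submodule.span_induction with
  | mem v hv =>
    obtain ⟨τ, h, rfl⟩ := hv
    rw [θ_e, c_zero hn h]
    simp [qtp, qt]
  | zero => rw [map_zero]
  | add v w _ _ hv hw => rw [map_add, hv, hw]
  | smul a v _ hv => rw [map_smul, hv]

/-- In degree zero `θ_1` is the identity, because the number `1` sits in the corner; afterwards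
`θ_i` and `θbar_i` obey the same recursion. Thus the affine algebra acts there through `ρ_n`. -/
theorem θbar_smul (i : Fin n) {v : Model n μ} (hv : v ∈ stdSpan n μ) :
    Hecke.θbar i • v = DAHA.θ i • v := by
  obtain ⟨i, hi'⟩ := i
  induction i generalizing v with
  | zero => rw [θ_zero_smul _ hv]; exact one_smul _ _
  | succ i ih =>
    have e1 : (⟨i + 1, hi'⟩ : Fin n) = hi ⟨i, by omega⟩ := rfl
    have hR := R_mem_stdSpan (⟨i, by omega⟩ : Fin (n - 1)) hv
    rw [e1, Hecke.θbar_hi, DAHA.θ_hi, hecke_smul_def, map_smul, map_mul, map_mul, map_tInv,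
      V.heckeToDAHA_T, smul_assoc, smul_assoc, mul_smul, mul_smul, mul_smul, mul_smul,
      tInv_smul _ v, ← hecke_smul_def (Hecke.θbar _)]
    have := ih (Submodule.smul_mem _ t⁻¹ hR) (by omega)
    exact congrArg _ (congrArg _ this)

theorem wc_toPSYT (τ : SYT n μ) (i : Fin n) : τ.toPSYT.wc i = (0, τ.toPSYT.c i) := rfl

theorem θ_e_std (τ : SYT n μ) (i : Fin n) :
    DAHA.θ i • e τ.toPSYT = t ^ τ.toPSYT.c i • e τ.toPSYT := by
  rw [θ_smul, θ_e, wc_toPSYT]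
  simp [qtp, qt]

theorem hecke_T_smul (i : Fin (n - 1)) (v : Model n μ) : Hecke.T i • v = R i v - (t - 1) • v := by
  rw [hecke_smul_def, V.heckeToDAHA_T, T_smul]

theorem R_e_of_up {i : Fin (n - 1)} {τ τ' : PSYT n μ} (h : PSYT.SwapUp i τ τ') : R i (e τ) =
    diagCoef (τ.wc (lo i)) (τ.wc (hi i)) • e τ + e τ' := by
  have h1 : UpPair (τ.wc (lo i)) (τ.wc (hi i)) := h.2
  rw [R_e, offCoef, if_pos h1, one_smul, PSYT.sw_eq h.1]

/-- The eigenvalues have quotient `t`, which makes the diagonal coefficient `t`; hence `T_i` acts by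
`1`. -/
theorem R_e_of_row {i : Fin (n - 1)} {τ : PSYT n μ} (hw : τ.w (lo i) = τ.w (hi i))
    (h : τ.c (hi i) = τ.c (lo i) + 1) : R i (e τ) = t • e τ := by
  have h1 : offCoef (τ.wc (lo i)) (τ.wc (hi i)) = 0 := offCoef_of_adj hw (Or.inl h)
  have h2 : qtp (τ.wc (hi i)) = t * qtp (τ.wc (lo i)) := by
    rw [← qtp_add_one, PSYT.wc, PSYT.wc, hw, h]
  have h3 := qtp_ne_zero (τ.wc (lo i))
  rw [R_e, h1, zero_smul, add_zero, diagCoef, h2]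
  congr 1
  have := one_sub_t_ne_zero
  rw [show qtp (τ.wc (lo i)) - t * qtp (τ.wc (lo i)) = (1 - t) * qtp (τ.wc (lo i)) by ring]
  field_simp

/-- Here the quotient is inverted and the diagonal coefficient is `-1`; hence `T_i` acts by `-t`. -/
theorem R_e_of_col {i : Fin (n - 1)} {τ : PSYT n μ} (hw : τ.w (lo i) = τ.w (hi i))
    (h : τ.c (lo i) = τ.c (hi i) + 1) : R i (e τ) = - e τ := by
  have h1 : offCoef (τ.wc (lo i)) (τ.wc (hi i)) = 0 := offCoef_of_adj hw (Or.inr h)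
  have h2 : qtp (τ.wc (lo i)) = t * qtp (τ.wc (hi i)) := by
    rw [← qtp_add_one, PSYT.wc, PSYT.wc, hw, h]
  have h3 := qtp_ne_zero (τ.wc (hi i))
  rw [R_e, h1, zero_smul, add_zero, diagCoef, h2, ← neg_one_smul Kqt (e τ)]
  congr 1
  have := one_sub_t_ne_zero
  rw [show t * qtp (τ.wc (hi i)) - qtp (τ.wc (hi i)) = -((1 - t) * qtp (τ.wc (hi i))) by ring,
    div_neg, div_self (mul_ne_zero this h3)]

theorem content_sub_one_of_row {τ : SYT n μ} {i : Fin (n - 1)}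
    (h : (τ.idx.symm (lo i)).1.1 = (τ.idx.symm (hi i)).1.1) :
    τ.toPSYT.c (hi i) = τ.toPSYT.c (lo i) + 1 := by
  have h2 : (τ.toPSYT.idx.symm (lo i)).1.1 = (τ.toPSYT.idx.symm (hi i)).1.1 := h
  have h3 := τ.toPSYT.adj_cases i rfl
  rcases h3 with h3 | h3 | h3
  · exact h3.2
  · exfalso
    have : τ.toPSYT.idx.symm (lo i) = τ.toPSYT.idx.symm (hi i) := Subtype.ext (Prod.ext h2 h3.1)
    exact lo_ne_hi i (τ.toPSYT.idx.symm.injective this)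
  · exact absurd h2 h3.1

theorem content_add_one_of_col {τ : SYT n μ} {i : Fin (n - 1)}
    (h : (τ.idx.symm (lo i)).1.2 = (τ.idx.symm (hi i)).1.2) :
    τ.toPSYT.c (lo i) = τ.toPSYT.c (hi i) + 1 := by
  have h2 : (τ.toPSYT.idx.symm (lo i)).1.2 = (τ.toPSYT.idx.symm (hi i)).1.2 := h
  have h3 := τ.toPSYT.adj_cases i rfl
  rcases h3 with h3 | h3 | h3
  · exfalso
    have : τ.toPSYT.idx.symm (lo i) = τ.toPSYT.idx.symm (hi i) := Subtype.ext (Prod.ext h3.1 h2)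
    exact lo_ne_hi i (τ.toPSYT.idx.symm.injective this)
  · exact h3.2
  · exact absurd h2 h3.2.1

variable (n μ) in
/-- The map from the module `S_μ` to the model. -/
def ofSpecht : Specht n μ →ₗ[Hecke n] Model n μ :=
  Submodule.liftQ _ (Finsupp.linearCombination (Hecke n) fun τ : SYT n μ => e τ.toPSYT) (by
    refine Submodule.span_le.2 ?_
    have hs : ∀ (τ : SYT n μ) (h : Hecke n), Finsupp.linearCombination (Hecke n)
        (fun τ : SYT n μ => e τ.toPSYT) (Finsupp.single τ h) = h • e τ.toPSYT :=
      fun τ h => Finsupp.linearCombination_single _ _ _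
    have hs' : ∀ (τ : SYT n μ) (a : Kqt), Finsupp.linearCombination (Hecke n)
        (fun τ : SYT n μ => e τ.toPSYT) (a • Finsupp.single τ (1 : Hecke n)) = a • e τ.toPSYT :=
      fun τ a => by rw [Finsupp.smul_single, hs, smul_assoc, one_smul]
    rintro x (((⟨τ, i, rfl⟩ | ⟨i, τ, τ', h, rfl⟩) | ⟨i, τ, h, rfl⟩) | ⟨i, τ, h, rfl⟩)
    all_goals rw [SetLike.mem_coe, LinearMap.mem_ker, map_sub, hs, sub_eq_zero]
    all_goals first | rw [hs'] | rw [hs, one_smul]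
    · rw [θbar_smul i (e_mem_stdSpan τ), θ_e_std]
    · have h1 := R_e_of_up h
      have h2 := R_mem_stdSpan i (e_mem_stdSpan τ)
      -- In `φbar` an element `θbar` also acts after `T_i⁻¹`; stability of the degree zero part
      -- allows replacing it by `θ` there too.
      have h3 : ∀ v ∈ stdSpan n μ, Hecke.φbar i • v =
          R i (DAHA.θ (lo i) • v) - DAHA.θ (lo i) • R i v := by
        intro v hv
        have e1 : ∀ v : Model n μ, tInv (Hecke.T i : Hecke n) • v = t⁻¹ • R i v := fun v => by
          rw [hecke_smul_def, map_tInv, V.heckeToDAHA_T, tInv_smul]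
        rw [Hecke.φbar, sub_smul, mul_smul, mul_smul, smul_assoc, smul_assoc, e1, e1, smul_smul,
          smul_smul, mul_inv_cancel₀ t_ne_zero, one_smul, one_smul, θbar_smul _ hv,
          θbar_smul _ (R_mem_stdSpan i hv)]
      rw [h3 _ (e_mem_stdSpan τ), θ_e_std, map_smul, h1, smul_add, smul_add, smul_comm (DAHA.θ _), θ_e_std,
        θ_e_std, h.1.c_eq, simpleRefl_lo]
      module
    · rw [hecke_T_smul, R_e_of_row rfl (content_sub_one_of_row h)]
      module
    · rw [hecke_T_smul, R_e_of_col rfl (content_add_one_of_col h)]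
      module)

theorem ofSpecht_of (τ : SYT n μ) : ofSpecht n μ (Specht.of τ) = e τ.toPSYT := by
  rw [ofSpecht, Specht.of, Submodule.liftQ_apply, Finsupp.linearCombination_single, one_smul]

theorem ofSpecht_smul (a : Kqt) (v : Specht n μ) : ofSpecht n μ (a • v) = a • ofSpecht n μ v :=
  LinearMap.map_smul_of_tower _ a v

theorem ofSpecht_mem (v : Specht n μ) : ofSpecht n μ v ∈ stdSpan n μ := by
  have hv : v ∈ Submodule.span Kqt (Set.range (Specht.of (n := n) (μ := μ))) := by
    rw [Specht.span_of]; trivial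
  induction hv using Submodule.span_induction with
  | mem v hv => obtain ⟨τ, rfl⟩ := hv; rw [ofSpecht_of]; exact e_mem_stdSpan τ
  | zero => rw [map_zero]; exact zero_mem _
  | add v w _ _ hv hw => rw [map_add]; exact add_mem hv hw
  | smul a v _ hv => rw [ofSpecht_smul]; exact Submodule.smul_mem _ _ hv

/-- The elements of the affine algebra for which the map to the model is compatible. -/
def compatible (n : ℕ) (μ : YoungDiagram) : Subalgebra Kqt (Affine n) where
  carrier := {a | ∀ v, affineToDAHA n a • ofSpecht n μ v = ofSpecht n μ (rho n a • v)}
  mul_mem' := fun {a b} ha hb v => by rw [map_mul, map_mul, mul_smul, mul_smul, hb, ha]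
  add_mem' := fun {a b} ha hb v => by rw [map_add, map_add, add_smul, add_smul, hb, ha, map_add]
  algebraMap_mem' := fun a v => by
    rw [AlgHom.commutes, AlgHom.commutes, algebraMap_smul, algebraMap_smul, ofSpecht_smul]

theorem mem_compatible (a : Affine n) : a ∈ compatible n μ := by
  refine Presented.induction _ (fun x v => ?_) a
  cases x with
  | T i =>
    change affineToDAHA n (Affine.T i) • _ = ofSpecht n μ (rho n (Affine.T i) • _)
    rw [V.affineToDAHA_T, V.rho_T, map_smul, hecke_smul_def, V.heckeToDAHA_T]
  | θ i =>
    change affineToDAHA n (Affine.θ i) • _ = ofSpecht n μ (rho n (Affine.θ i) • _)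
    rw [V.affineToDAHA_θ, V.rho_θ, map_smul, θbar_smul _ (ofSpecht_mem v)]

end Model

namespace V

variable (n μ) in
/-- The map from the induced module to the model. -/
def toModel : V n μ →ₗ[DAHA n] Model n μ :=
  Submodule.liftQ _ (TensorProduct.AlgebraTensorModule.lift (LinearMap.toSpanSingleton (DAHA n)
    (Specht n μ →ₗ[Kqt] Model n μ)
    { toFun := Model.ofSpecht n μ
      map_add' := map_add _
      map_smul' := Model.ofSpecht_smul })) (by
    refine Submodule.span_le.2 ?_
    rintro x ⟨d, a, v, rfl⟩
    rw [SetLike.mem_coe, LinearMap.mem_ker, map_sub, TensorProduct.AlgebraTensorModule.lift_tmul,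
      TensorProduct.AlgebraTensorModule.lift_tmul, sub_eq_zero]
    change (d * affineToDAHA n a) • Model.ofSpecht n μ v = d • Model.ofSpecht n μ (rho n a • v)
    rw [mul_smul, Model.mem_compatible a v])

theorem toModel_emb (v : Specht n μ) : toModel n μ (emb v) = Model.ofSpecht n μ v := by
  change (1 : DAHA n) • Model.ofSpecht n μ v = _
  rw [one_smul]

theorem toModel_smul (a : Kqt) (v : V n μ) : toModel n μ (a • v) = a • toModel n μ v :=
  LinearMap.map_smul_of_tower _ a v

end V

end Murnaghan

end

noncomputable section

namespace Murnaghan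

variable {n : ℕ} {μ : YoungDiagram}

/-! # The monomials form a basis -/

/-- A family of homogeneous vectors is linearly independent if its homogeneous parts are. -/
theorem linearIndependent_of_graded {ι M : Type} [AddCommGroup M] [Module Kqt M] {w : ι → M}
    (deg : ι → ℕ) (p : ℕ → M →ₗ[Kqt] M) (hp : ∀ d x, p d (w x) = if deg x = d then w x else 0)
    (h : ∀ d, LinearIndependent Kqt fun x : {x // deg x = d} => w x) :
    LinearIndependent Kqt w := by
  rw [linearIndependent_iff]
  intro l hl
  have key : ∀ d, l.filter (fun x => deg x = d) = 0 := by
    intro d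
    have h1 : LinearIndepOn Kqt w {x | deg x = d} := h d
    rw [linearIndepOn_iff] at h1
    refine h1 _ (fun x hx => ?_) ?_
    · by_contra hc
      exact Finsupp.mem_support_iff.1 hx (Finsupp.filter_apply_neg (fun x => deg x = d) _ hc)
    · have h2 : Finsupp.linearCombination Kqt w (l.filter fun x => deg x = d) =
          p d (Finsupp.linearCombination Kqt w l) := by
        clear hl
        induction l using Finsupp.induction_linear with
        | zero => rw [Finsupp.filter_zero, map_zero, map_zero]
        | add f g hf hg => rw [Finsupp.filter_add, map_add, map_add, map_add, hf, hg]
        | single x a =>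
          rw [Finsupp.linearCombination_single, map_smul, hp]
          split_ifs with h
          · rw [Finsupp.filter_single_of_pos (fun x => deg x = d) h, Finsupp.linearCombination_single]
          · rw [Finsupp.filter_single_of_neg (fun x => deg x = d) h, map_zero, smul_zero]
      rw [h2, hl, map_zero]
  ext x
  have := DFunLike.congr_fun (key (deg x)) x
  rwa [Finsupp.filter_apply_pos (fun y => deg y = deg x) _ rfl] at this

/-! ### Generation of the model by the standard tableaux, and its grading -/

namespace Model

/-- A preimage under `π` inside a given submodule: divide by the nonzero `θ_1`-eigenvalue of `τ`,
then undo the product of the `T_i⁻¹`. -/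
theorem exists_π_smul (hn : 0 < n) (N : Submodule (DAHA n) (Model n μ)) {τ : PSYT n μ}
    (h : e τ ∈ N) : ∃ u ∈ N, DAHA.π hn • u = e τ := by
  obtain ⟨U, -, hU⟩ := DAHA.exists_right_inv (n := n) ⊤ fun _ => trivial
  have hx := qtp_ne_zero (τ.wc ⟨0, hn⟩)
  have ht := pow_ne_zero (n - 1) t_ne_zero
  refine ⟨(t ^ (n - 1))⁻¹ • (qtp (τ.wc ⟨0, hn⟩))⁻¹ • U • e τ,
    N.smul_of_tower_mem _ (N.smul_of_tower_mem _ (N.smul_mem _ h)), ?_⟩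
  rw [smul_comm (DAHA.π hn), smul_comm (DAHA.π hn), ← mul_smul (DAHA.π hn), DAHA.π, piElt, smul_mul_assoc,
    mul_assoc, hU, mul_one, smul_assoc, smul_comm _ (t ^ (n - 1)), smul_smul, inv_mul_cancel₀ ht,
    one_smul, θ_smul, θ_e, smul_smul, inv_mul_cancel₀ hx, one_smul]

/-- A submodule that contains the standard tableaux is the whole model. -/
theorem eq_top_of_std {N : Submodule (DAHA n) (Model n μ)} (h : ∀ τ : SYT n μ, e τ.toPSYT ∈ N) :
    N = ⊤ := by
  have key : ∀ τ : PSYT n μ, e τ ∈ N := fun τ => by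
    induction τ using PSYT.induction with
    | std τ => exact h τ
    | swap i τ hτ ih =>
      have h1 := R_e_of_up hτ.swapUp
      rw [← sub_eq_iff_eq_add'.2 h1, ← R_eq_smul]
      exact sub_mem (N.smul_of_tower_mem _ (N.smul_mem _ ih)) (N.smul_of_tower_mem _ ih)
    | psi hn τ ih =>
      obtain ⟨u, hu, hu'⟩ := exists_π_smul hn N ih
      have h1 := X_last_smul hn u
      rw [hu', γ_e] at h1
      have h2 : e τ.psi = q ^ τ.w ⟨0, hn⟩ • DAHA.X ⟨n - 1, Nat.sub_lt hn one_pos⟩ • u := by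
        rw [h1, smul_smul, mul_inv_cancel₀ (pow_ne_zero _ q_ne_zero), one_smul]
      rw [h2]
      exact N.smul_of_tower_mem _ (N.smul_mem _ hu)
  refine Submodule.eq_top_iff'.2 fun v => ?_
  have hv : lin (M := Model n μ) e v = v := LinearMap.congr_fun
    (ext_e (f := lin e) (g := LinearMap.id) fun τ => by rw [lin_e, LinearMap.id_apply]) v
  have h2 : lin (M := Model n μ) e v =
      Finsupp.sum (show PSYT n μ →₀ Kqt from v) fun τ a => a • e τ :=
    Finsupp.linearCombination_apply _ _
  rw [← hv, h2]
  exact sum_mem fun τ _ => N.smul_of_tower_mem _ (key τ)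

/-! ## The grading of the model -/

variable (n μ) in
/-- The homogeneous part of degree `d`. -/
def graded (d : ℕ) : Submodule Kqt (Model n μ) :=
  Submodule.span Kqt {x | ∃ τ : PSYT n μ, τ.deg = d ∧ x = e τ}

theorem e_mem_graded (τ : PSYT n μ) : e τ ∈ graded n μ τ.deg := Submodule.subset_span ⟨τ, rfl, rfl⟩

theorem map_mem_graded {f : Model n μ →ₗ[Kqt] Model n μ} {d d' : ℕ}
    (h : ∀ τ : PSYT n μ, τ.deg = d → f (e τ) ∈ graded n μ d') {v : Model n μ}
    (hv : v ∈ graded n μ d) : f v ∈ graded n μ d' := by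
  refine (Submodule.span_le.2 ?_ : graded n μ d ≤ (graded n μ d').comap f) hv
  rintro _ ⟨τ, hτ, rfl⟩
  exact h τ hτ

theorem R_mem_graded (i : Fin (n - 1)) {d : ℕ} {v : Model n μ} (hv : v ∈ graded n μ d) :
    R i v ∈ graded n μ d :=
  map_mem_graded (fun τ h => by
    subst h
    rw [R_e]
    refine add_mem (Submodule.smul_mem _ _ (e_mem_graded τ)) (Submodule.smul_mem _ _ ?_)
    rw [← PSYT.deg_eq_of_wt_eq (PSYT.sw_wt i τ)]
    exact e_mem_graded _) hv

theorem γ_mem_graded (hn : 0 < n) {d : ℕ} {v : Model n μ} (hv : v ∈ graded n μ d) :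
    γ hn v ∈ graded n μ (d + 1) :=
  map_mem_graded (fun τ h => by
    subst h
    rw [γ_e, ← PSYT.deg_psi hn]
    exact Submodule.smul_mem _ _ (e_mem_graded _)) hv

theorem affine_mem_graded (a : Affine n) {d : ℕ} {v : Model n μ} (hv : v ∈ graded n μ d) :
    affineToDAHA n a • v ∈ graded n μ d := by
  have key : a ∈ (stabilizer (R := DAHA n) (graded n μ d)).comap (affineToDAHA n) := by
    refine Presented.induction _ (fun x => ?_) a
    cases x with
    | T i =>
      intro v hv
      change affineToDAHA n (Affine.T i) • v ∈ _
      rw [V.affineToDAHA_T, T_smul]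
      exact sub_mem (R_mem_graded i hv) (Submodule.smul_mem _ _ hv)
    | θ i =>
      intro v hv
      change affineToDAHA n (Affine.θ i) • v ∈ _
      rw [V.affineToDAHA_θ, θ_smul]
      refine map_mem_graded (fun τ h => ?_) hv
      subst h
      rw [θ_e]
      exact Submodule.smul_mem _ _ (e_mem_graded τ)
  exact key v hv

/-- The last variable acts as `γ π`, where `γ` raises the degree by one. The others follow downwards
from `X_i = t⁻¹ T_i X_{i+1} T_i`. -/
theorem X_mem_graded (i : Fin n) {d : ℕ} {v : Model n μ} (hv : v ∈ graded n μ d) :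
    DAHA.X i • v ∈ graded n μ (d + 1) := by
  obtain ⟨k, hk⟩ : ∃ k, k = n - 1 - i := ⟨_, rfl⟩
  induction k generalizing i v with
  | zero =>
    have hn : 0 < n := i.pos
    obtain rfl : i = ⟨n - 1, Nat.sub_lt hn one_pos⟩ := Fin.ext (by simp; omega)
    obtain ⟨a, ha⟩ := V.exists_affine_π hn
    rw [X_last_smul hn, ← ha]
    exact γ_mem_graded hn (affine_mem_graded a hv)
  | succ k ih =>
    have hT : ∀ (j : Fin (n - 1)) {d : ℕ} {v : Model n μ}, v ∈ graded n μ d →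
        DAHA.T j • v ∈ graded n μ d := fun j _ _ hv => by
      rw [← V.affineToDAHA_T]
      exact affine_mem_graded _ hv
    have hl : i = lo ⟨i, by omega⟩ := rfl
    rw [hl, DAHA.X_lo, smul_assoc, mul_smul, mul_smul]
    exact Submodule.smul_mem _ _ (hT _ (ih _ (hT _ hv) (by simp [hi]; omega)))

variable (n μ) in
/-- The projection to the homogeneous part of degree `d`. -/
def proj (d : ℕ) : Model n μ →ₗ[Kqt] Model n μ :=
  lin fun τ => if τ.deg = d then e τ else 0

theorem proj_of_mem {d d' : ℕ} {v : Model n μ} (hv : v ∈ graded n μ d) :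
    proj n μ d' v = if d = d' then v else 0 := by
  induction hv using Submodule.span_induction with
  | mem v hv =>
    obtain ⟨τ, rfl, rfl⟩ := hv
    rw [proj, lin_e]
  | zero => rw [map_zero, ite_self]
  | add v w _ _ hv hw => rw [map_add, hv, hw]; split_ifs <;> simp
  | smul a v _ hv => rw [map_smul, hv]; split_ifs <;> simp

theorem linearIndependent_e : LinearIndependent Kqt (e (n := n) (μ := μ)) := by
  have h := (Finsupp.basisSingleOne : Module.Basis (PSYT n μ) Kqt
    (PSYT n μ →₀ Kqt)).linearIndependent
  rw [Finsupp.coe_basisSingleOne] at h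
  exact h

end Model

/-- There are finitely many tableaux with a given total exponent. -/
instance PSYT.finite_deg (d : ℕ) : Finite {τ : PSYT n μ // τ.deg = d} := by
  have hb : ∀ (τ : {τ : PSYT n μ // τ.deg = d}) c, τ.1.wt c < d + 1 := fun τ c => by
    have := Finset.single_le_sum (f := τ.1.wt) (fun _ _ => Nat.zero_le _) (Finset.mem_univ c)
    have h2 := τ.2
    unfold PSYT.deg at h2
    omega
  refine Finite.of_injective (β := (μ.cells ≃ Fin n) × (μ.cells → Fin (d + 1)))
    (fun τ => (τ.1.idx, fun c => ⟨τ.1.wt c, hb τ c⟩)) fun τ σ h => ?_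
  simp only [Prod.mk.injEq] at h
  refine Subtype.ext (PSYT.ext h.1 (funext fun c => ?_))
  have := congrFun h.2 c
  simpa using this

/-! ### Comparison of graded dimensions -/

namespace V

theorem toModel_surjective : Function.Surjective (toModel n μ) := by
  rw [← LinearMap.range_eq_top]
  refine Model.eq_top_of_std fun τ => ⟨emb (Specht.of τ), ?_⟩
  rw [toModel_emb, Model.ofSpecht_of]

theorem toModel_mono_mem (x : (Fin n → ℕ) × SYT n μ) :
    toModel n μ (mono x) ∈ Model.graded n μ (∑ i, x.1 i) := by
  obtain ⟨α, τ⟩ := x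
  induction α using mono_induction with
  | h0 =>
    have h1 : (mono ((0 : Fin n → ℕ), τ) : V n μ) = emb (Specht.of τ) := monoTensor_zero _
    rw [h1, toModel_emb, Model.ofSpecht_of]
    have h2 := Model.e_mem_graded τ.toPSYT
    have h3 : τ.toPSYT.deg = 0 := by simp [PSYT.deg, SYT.toPSYT]
    rw [h3] at h2
    simpa using h2
  | h i α ih =>
    have h1 : (mono (α + Pi.single i 1, τ) : V n μ) = DAHA.X i • mono (α, τ) :=
      (X_smul_mono i (α, τ)).symm
    have h2 : ∑ j, (α + Pi.single i 1 : Fin n → ℕ) j = ∑ j, α j + 1 := by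
      simp [Finset.sum_add_distrib]
    rw [h1, map_smul, h2]
    exact Model.X_mem_graded i ih

theorem span_toModel_mono : Submodule.span Kqt (Set.range fun x => toModel n μ (mono x)) = ⊤ := by
  refine Submodule.eq_top_iff'.2 fun v => ?_
  obtain ⟨v, rfl⟩ := toModel_surjective v
  have hv : v ∈ Submodule.span Kqt (Set.range (mono (n := n) (μ := μ))) := by
    rw [span_mono]; trivial
  induction hv using Submodule.span_induction with
  | mem v hv => obtain ⟨x, rfl⟩ := hv; exact Submodule.subset_span ⟨x, rfl⟩
  | zero => rw [map_zero]; exact zero_mem _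
  | add v w _ _ hv hw => rw [map_add]; exact add_mem hv hw
  | smul a v _ hv => rw [toModel_smul]; exact Submodule.smul_mem _ _ hv

/-- Monomials of a given degree. -/
abbrev MonoDeg (n : ℕ) (μ : YoungDiagram) (d : ℕ) : Type :=
  {x : (Fin n → ℕ) × SYT n μ // ∑ i, x.1 i = d}

/-- A dimension count: the monomials of degree `d` are at most as numerous as the tableaux of total
exponent `d`, whose vectors are independent and lie in the span of these monomials. -/
theorem linearIndependent_toModel_mono_deg (d : ℕ) :
    LinearIndependent Kqt fun x : MonoDeg n μ d => toModel n μ (mono x.1) := by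
  let g : MonoDeg n μ d → {τ : PSYT n μ // τ.deg = d} := fun x =>
    ⟨PSYT.ofSYT x.1.1 x.1.2, by rw [PSYT.deg_eq_sum_w, PSYT.w_ofSYT, x.2]⟩
  have hg : Function.Injective g := fun x y h => by
    have := PSYT.ofSYT_injective (congrArg Subtype.val h)
    exact Subtype.ext (Prod.ext this.1 this.2)
  have : Finite (MonoDeg n μ d) := Finite.of_injective g hg
  have := Fintype.ofFinite (MonoDeg n μ d)
  have := Fintype.ofFinite {τ : PSYT n μ // τ.deg = d}
  rw [linearIndependent_iff_card_le_finrank_span]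
  refine (Fintype.card_le_of_injective g hg).trans ?_
  have h1 : LinearIndependent Kqt fun τ : {τ : PSYT n μ // τ.deg = d} => Model.e τ.1 :=
    Model.linearIndependent_e.comp _ Subtype.val_injective
  rw [← finrank_span_eq_card h1, Set.finrank]
  have := FiniteDimensional.span_of_finite Kqt
    (Set.finite_range fun x : MonoDeg n μ d => toModel n μ (mono x.1))
  refine Submodule.finrank_mono (Submodule.span_le.2 ?_)
  rintro _ ⟨τ, rfl⟩
  have h2 : Model.proj n μ d (Model.e τ.1) = Model.e τ.1 := by
    rw [Model.proj_of_mem (Model.e_mem_graded _), if_pos τ.2]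
  -- All monomials together span, and the projection to degree `d` annihilates those of other
  -- degrees.
  have h3 : (⊤ : Submodule Kqt (Model n μ)) ≤ (Submodule.span Kqt
      (Set.range fun x : MonoDeg n μ d => toModel n μ (mono x.1))).comap (Model.proj n μ d) := by
    rw [← span_toModel_mono, Submodule.span_le]
    rintro _ ⟨x, rfl⟩
    rw [SetLike.mem_coe, Submodule.mem_comap, Model.proj_of_mem (toModel_mono_mem x)]
    split_ifs with h
    · exact Submodule.subset_span ⟨⟨x, h⟩, rfl⟩
    · exact zero_mem _
  have h4 := h3 (show Model.e τ.1 ∈ _ from trivial)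
  rwa [Submodule.mem_comap, h2] at h4

theorem linearIndependent_toModel_mono :
    LinearIndependent Kqt fun x => toModel n μ (mono x) :=
  linearIndependent_of_graded (fun x : (Fin n → ℕ) × SYT n μ => ∑ i, x.1 i) (Model.proj n μ)
    (fun _ x => Model.proj_of_mem (toModel_mono_mem x)) linearIndependent_toModel_mono_deg

/-- The spanning family of monomials has linearly independent images. -/
theorem toModel_injective : Function.Injective (toModel n μ) := by
  rw [injective_iff_map_eq_zero]
  intro v hv
  have h1 : v ∈ Submodule.span Kqt (Set.range (mono (n := n) (μ := μ))) := by
    rw [span_mono]; trivial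
  obtain ⟨l, rfl⟩ := Finsupp.mem_span_range_iff_exists_finsupp.1 h1
  have h2 : Finsupp.linearCombination Kqt (fun x => toModel n μ (mono x)) l = 0 := by
    rw [← hv, Finsupp.linearCombination_apply, Finsupp.sum, Finsupp.sum, map_sum]
    exact Finset.sum_congr rfl fun x _ => (toModel_smul _ _).symm
  rw [linearIndependent_iff.1 linearIndependent_toModel_mono l h2, Finsupp.sum_zero_index]

theorem linearIndependent_mono : LinearIndependent Kqt (mono (n := n) (μ := μ)) :=
  LinearIndependent.of_comp ((toModel n μ).restrictScalars Kqt) linearIndependent_toModel_mono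

variable (n μ) in
/-- The induced module is isomorphic to the model. -/
def equivModel : V n μ ≃ₗ[DAHA n] Model n μ :=
  LinearEquiv.ofBijective (toModel n μ) ⟨toModel_injective, toModel_surjective⟩

variable (n μ) in
/-- The basis of monomials. -/
def monoBasis : Module.Basis ((Fin n → ℕ) × SYT n μ) Kqt (V n μ) :=
  Module.Basis.mk linearIndependent_mono span_mono.ge

theorem monoBasis_apply (x : (Fin n → ℕ) × SYT n μ) : monoBasis n μ x = mono x := by
  rw [monoBasis, Module.Basis.mk_apply]

end V

end Murnaghan

end

noncomputable section

namespace Murnaghan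

variable {n : ℕ} {μ : YoungDiagram}

/-! # Non-symmetric Macdonald polynomials -/

namespace V

/-- The vector of the induced module that corresponds to a basis vector of the model. -/
def F (τ : PSYT n μ) : V n μ := (equivModel n μ).symm (Model.e τ)

theorem toModel_F (τ : PSYT n μ) : toModel n μ (F τ) = Model.e τ :=
  (equivModel n μ).apply_symm_apply _

theorem linearIndependent_F : LinearIndependent Kqt (F (n := n) (μ := μ)) := by
  refine LinearIndependent.of_comp ((toModel n μ).restrictScalars Kqt) ?_
  have : ((toModel n μ).restrictScalars Kqt) ∘ F = Model.e := funext toModel_F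
  rw [this]
  exact Model.linearIndependent_e

theorem mem_span_F (v : V n μ) : v ∈ Submodule.span Kqt (Set.range (F (n := n) (μ := μ))) := by
  let g : Model n μ →ₗ[Kqt] V n μ := Model.lin F
  have h1 : toModel n μ (g (toModel n μ v)) = toModel n μ v := by
    have : ((toModel n μ).restrictScalars Kqt) ∘ₗ g = LinearMap.id :=
      Model.ext_e fun τ => by
        rw [LinearMap.comp_apply, Model.lin_e]
        exact toModel_F τ
    exact LinearMap.congr_fun this _
  rw [← toModel_injective h1]
  have h2 : LinearMap.range g = Submodule.span Kqt (Set.range F) :=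
    Finsupp.range_linearCombination Kqt
  rw [← h2]
  exact ⟨_, rfl⟩

theorem span_F : Submodule.span Kqt (Set.range (F (n := n) (μ := μ))) = ⊤ :=
  Submodule.eq_top_iff'.2 mem_span_F

variable (n μ) in
/-- The basis of the non-symmetric Macdonald polynomials. -/
def basisF : Module.Basis (PSYT n μ) Kqt (V n μ) :=
  Module.Basis.mk linearIndependent_F span_F.ge

theorem basisF_apply (τ : PSYT n μ) : basisF n μ τ = F τ := by
  rw [basisF, Module.Basis.mk_apply]

/-- The coefficient of `F_τ`. -/
def coef (τ : PSYT n μ) : V n μ →ₗ[Kqt] Kqt := (basisF n μ).coord τ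

open Classical in
theorem coef_F (τ σ : PSYT n μ) : coef τ (F σ) = if σ = τ then 1 else 0 := by
  rw [coef, Module.Basis.coord_apply, ← basisF_apply, Module.Basis.repr_self,
    Finsupp.single_apply]

theorem mem_span_iff_coef {p : PSYT n μ → Prop} {v : V n μ} :
    v ∈ Submodule.span Kqt {x | ∃ τ, p τ ∧ x = F τ} ↔ ∀ τ, ¬ p τ → coef τ v = 0 := by
  have h : {x | ∃ τ, p τ ∧ x = F τ} = basisF n μ '' {τ | p τ} := by
    ext x
    simp only [Set.mem_ofPred_eq, Set.mem_image, basisF_apply, eq_comm]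
  rw [h, Module.Basis.mem_span_image]
  refine ⟨fun h τ hτ => ?_, fun h τ hτ => ?_⟩
  · by_contra hc
    exact hτ (h (Finsupp.mem_support_iff.2 hc))
  · by_contra hc
    exact Finsupp.mem_support_iff.1 hτ (h τ hc)

theorem eq_zero_of_coef {v : V n μ} (h : ∀ τ, coef τ v = 0) : v = 0 :=
  (basisF n μ).ext_elem fun τ => (h τ).trans (by simp)

theorem linearMap_ext_F {M : Type} [AddCommGroup M] [Module Kqt M] {f g : V n μ →ₗ[Kqt] M}
    (h : ∀ τ, f (F τ) = g (F τ)) : f = g :=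
  (basisF n μ).ext fun τ => by rw [basisF_apply, h]

/-! ## The action on the basis -/

theorem R_F (i : Fin (n - 1)) (τ : PSYT n μ) : t • tInv (DAHA.T i) • F τ =
    diagCoef (τ.wc (lo i)) (τ.wc (hi i)) • F τ +
      offCoef (τ.wc (lo i)) (τ.wc (hi i)) • F (τ.sw i) := by
  apply toModel_injective
  rw [toModel_smul, map_smul, toModel_F, Model.R_eq_smul, Model.R_e, map_add, toModel_smul,
    toModel_smul, toModel_F, toModel_F]

theorem T_smul (i : Fin (n - 1)) (v : V n μ) :
    DAHA.T i • v = t • tInv (DAHA.T i) • v - (t - 1) • v := by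
  rw [← smul_assoc, DAHA.tInv_eq, add_smul, smul_assoc, one_smul, add_sub_cancel_right]

theorem θ_F (i : Fin n) (τ : PSYT n μ) : DAHA.θ i • F τ = qtp (τ.wc i) • F τ := by
  apply toModel_injective
  rw [toModel_smul, map_smul, toModel_F, Model.θ_smul, Model.θ_e]

theorem F_std (τ : SYT n μ) : F τ.toPSYT = emb (Specht.of τ) := by
  apply toModel_injective
  rw [toModel_F, toModel_emb, Model.ofSpecht_of]

theorem F_of_up {i : Fin (n - 1)} {τ τ' : PSYT n μ} (h : PSYT.SwapUp i τ τ') : F τ' =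
    t • tInv (DAHA.T i) • F τ - diagCoef (τ.wc (lo i)) (τ.wc (hi i)) • F τ := by
  have h1 : UpPair (τ.wc (lo i)) (τ.wc (hi i)) := h.2
  rw [R_F, offCoef, if_pos h1, one_smul, PSYT.sw_eq h.1, add_sub_cancel_left]

theorem X_last_smul_of_π (hn : 0 < n) {u : V n μ} {τ : PSYT n μ} (h : DAHA.π hn • u = F τ) :
    F τ.psi = q ^ τ.w ⟨0, hn⟩ • DAHA.X ⟨n - 1, Nat.sub_lt hn one_pos⟩ • u := by
  apply toModel_injective
  rw [toModel_smul, map_smul (toModel n μ), toModel_F, Model.X_last_smul hn,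
    ← map_smul (toModel n μ), h, toModel_F, Model.γ_e, smul_smul, mul_inv_cancel₀ (pow_ne_zero _ q_ne_zero), one_smul]

/-! ## The operator `π` is invertible -/

theorem act_apply (d : DAHA n) (v : V n μ) : act μ d v = d • v := rfl

theorem act_mul (d d' : DAHA n) : act μ (d * d') = act μ d * act μ d' :=
  map_mul (Algebra.lsmul Kqt Kqt (V n μ)) d d'

theorem isUnit_act_θ (i : Fin n) : IsUnit (act μ (DAHA.θ i)) := by
  rw [isUnit_iff_exists]
  refine ⟨(basisF n μ).constr Kqt fun τ => (qtp (τ.wc i))⁻¹ • F τ, ?_, ?_⟩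
  all_goals
    refine linearMap_ext_F fun τ => ?_
    have h1 := (basisF n μ).constr_basis Kqt (fun τ => (qtp (τ.wc i))⁻¹ • F τ) τ
    rw [basisF_apply] at h1
    have h2 := qtp_ne_zero (τ.wc i)
  · rw [Module.End.mul_apply, h1, map_smul, act_apply, θ_F, smul_smul, inv_mul_cancel₀ h2, one_smul,
      Module.End.one_apply]
  · rw [Module.End.mul_apply, act_apply, θ_F, map_smul, h1, smul_smul, mul_inv_cancel₀ h2, one_smul,
      Module.End.one_apply]

/-- On the module `θ_1` is diagonal with nonzero eigenvalues; the remaining factors of `π` are units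
of the algebra. -/
theorem isUnit_act_π (hn : 0 < n) : IsUnit (act μ (DAHA.π hn)) := by
  have h1 : ∀ i : Fin (n - 1), IsUnit (tInv (DAHA.T i : DAHA n)) := fun i =>
    ⟨⟨_, _, DAHA.tInv_mul_T i, DAHA.T_mul_tInv i⟩, rfl⟩
  have h2 : IsUnit (List.ofFn fun i => tInv (DAHA.T i : DAHA n)).prod := by
    rw [List.ofFn_eq_map]
    generalize List.finRange (n - 1) = l
    induction l with
    | nil => simp
    | cons i l ih =>
      rw [List.map_cons, List.prod_cons]
      exact (h1 i).mul ih
  have h3 : IsUnit (act μ (List.ofFn fun i => tInv (DAHA.T i : DAHA n)).prod) :=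
    h2.map (Algebra.lsmul Kqt Kqt (V n μ))
  have h4 : act μ (DAHA.π hn) = t ^ (n - 1) • (act μ (DAHA.θ ⟨0, hn⟩) *
      act μ (List.ofFn fun i => tInv (DAHA.T i : DAHA n)).prod) := by
    rw [← act_mul]
    exact map_smul (Algebra.lsmul Kqt Kqt (V n μ)) (t ^ (n - 1)) _
  rw [h4]
  exact ((isUnit_act_θ ⟨0, hn⟩).mul h3).smul (Units.mk0 _ (pow_ne_zero (n - 1) t_ne_zero))

theorem π_smul_inverse (hn : 0 < n) (v : V n μ) :
    DAHA.π hn • Ring.inverse (act μ (DAHA.π hn)) v = v :=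
  LinearMap.congr_fun (Ring.mul_inverse_cancel _ (isUnit_act_π hn)) v

/-! ## Existence and uniqueness -/

theorem qtp_wc (τ : PSYT n μ) (i : Fin n) : qtp (τ.wc i) = q ^ τ.w i * t ^ τ.c i := rfl

theorem isNonsymMacdonald_F : IsNonsymMacdonald n μ F where
  linInd := linearIndependent_F
  span := span_F
  weight τ i := θ_F i τ
  standard τ := by rw [F_std, monoTensor_zero]
  swap i τ τ' h := by
    rw [F_of_up h, ← qtp_wc, ← qtp_wc, sub_eq_add_neg, ← neg_smul, diagCoef, ← neg_div]
    congr 3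
    ring
  psi hn τ τ' h := by
    rw [h.eq]
    exact X_last_smul_of_π hn (π_smul_inverse hn (F τ))

/-- Every tableau is reached from a standard one by the two recursions, each of which computes the
next vector from the previous one. -/
theorem eq_F {G : PSYT n μ → V n μ} (h : IsNonsymMacdonald n μ G) : G = F := by
  have h' := isNonsymMacdonald_F (n := n) (μ := μ)
  funext τ
  induction τ using PSYT.induction with
  | std τ => rw [h.standard, h'.standard]
  | swap i τ hτ ih => rw [h.swap i τ _ hτ.swapUp, h'.swap i τ _ hτ.swapUp, ih]
  | psi hn τ ih => rw [h.psi hn τ _ (PSYT.isPsi_psi τ), h'.psi hn τ _ (PSYT.isPsi_psi τ), ih]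

theorem nonsymMacdonald_eq : nonsymMacdonald n μ = F :=
  eq_F (Classical.epsilon_spec ⟨F, isNonsymMacdonald_F⟩)

/-- Monomials have homogeneous images in the model. Hence in a monomial expansion of `F_τ` the terms
of other degrees can be dropped, by injectivity of the comparison map. -/
theorem F_mem_degLE (τ : PSYT n μ) : F τ ∈ degLE n μ τ.deg := by
  have key : ∀ v : V n μ, ∃ w ∈ degLE n μ τ.deg,
      toModel n μ w = Model.proj n μ τ.deg (toModel n μ v) := by
    intro v
    have hv : v ∈ Submodule.span Kqt (Set.range (mono (n := n) (μ := μ))) := by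
      rw [span_mono]; trivial
    induction hv using Submodule.span_induction with
    | mem v hv =>
      obtain ⟨x, rfl⟩ := hv
      rw [Model.proj_of_mem (toModel_mono_mem x)]
      split_ifs with h
      · exact ⟨_, Submodule.subset_span ⟨x.1, x.2, h.le, rfl⟩, rfl⟩
      · exact ⟨0, zero_mem _, map_zero _⟩
    | zero => exact ⟨0, zero_mem _, by rw [map_zero, map_zero]⟩
    | add v w _ _ hv hw =>
      obtain ⟨v', hv, hv'⟩ := hv
      obtain ⟨w', hw, hw'⟩ := hw
      exact ⟨v' + w', add_mem hv hw, by rw [map_add, map_add, map_add, hv', hw']⟩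
    | smul a v _ hv =>
      obtain ⟨v', hv, hv'⟩ := hv
      exact ⟨a • v', Submodule.smul_mem _ _ hv, by rw [toModel_smul, toModel_smul, map_smul, hv']⟩
  obtain ⟨w, hw, hw'⟩ := key (F τ)
  rw [toModel_F, Model.proj_of_mem (Model.e_mem_graded τ), if_pos rfl, ← toModel_F] at hw'
  rwa [← toModel_injective hw']

/-! # Invariant vectors -/

theorem T_smul_eq_self_iff (i : Fin (n - 1)) (v : V n μ) :
    DAHA.T i • v = v ↔ t • tInv (DAHA.T i) • v = t • v := by
  rw [T_smul, sub_smul, one_smul, sub_sub_eq_add_sub, sub_eq_iff_eq_add, add_comm v, add_left_inj]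

theorem T_smul_ε (i : Fin (n - 1)) (v : V n μ) :
    DAHA.T i • heckeToDAHA n (Hecke.ε n) • v = heckeToDAHA n (Hecke.ε n) • v := by
  rw [← mul_smul, ← heckeToDAHA_T, ← map_mul, Hecke.T_mul_ε]

/-- The vector `v` is fixed by the finite Hecke algebra. -/
def IsInv (v : V n μ) : Prop := ∀ i : Fin (n - 1), DAHA.T i • v = v

theorem exists_ε_smul_eq : ∃ c : Kqt, c ≠ 0 ∧ ∀ v : V n μ, IsInv v →
    heckeToDAHA n (Hecke.ε n) • v = c • v := by
  obtain ⟨c, hc, h⟩ := exists_ε_apply_eq (n := n)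
  refine ⟨c, hc, fun v hv => ?_⟩
  refine h (V n μ) ((Algebra.lsmul Kqt Kqt (V n μ)).comp (heckeToDAHA n)) v fun i => ?_
  change heckeToDAHA n (Hecke.T i) • v = v
  rw [heckeToDAHA_T, hv]

/-- The idempotent maps into the invariant vectors and acts on them by a nonzero scalar, so in a
stable subspace its image is the space of invariants. This avoids evaluating the normalization. -/
theorem mem_map_ε_iff {P : Submodule Kqt (V n μ)}
    (hP : ∀ i : Fin (n - 1), ∀ v ∈ P, DAHA.T i • v ∈ P) (v : V n μ) :
    v ∈ P.map (act μ (heckeToDAHA n (Hecke.ε n))) ↔ v ∈ P ∧ IsInv v := by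
  constructor
  · rintro ⟨v, hv, rfl⟩
    refine ⟨?_, fun i => T_smul_ε i v⟩
    have h : ∀ h : Hecke n, h ∈ (stabilizer (R := DAHA n) P).comap (heckeToDAHA n) :=
      Presented.induction _ fun i v hv => by
        have := hP i v hv
        rwa [← heckeToDAHA_T] at this
    exact h _ v hv
  · rintro ⟨hv, h⟩
    obtain ⟨c, hc, hc'⟩ := exists_ε_smul_eq (n := n) (μ := μ)
    refine ⟨c⁻¹ • v, P.smul_mem _ hv, ?_⟩
    rw [map_smul, act_apply, hc' v h, smul_smul, inv_mul_cancel₀ hc, one_smul]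

theorem mem_W_iff (v : V n μ) : v ∈ W n μ ↔ IsInv v := by
  rw [W, LinearMap.range_eq_map, mem_map_ε_iff (P := ⊤) fun _ _ _ => Submodule.mem_top]
  exact ⟨fun h => h.2, fun h => ⟨Submodule.mem_top, h⟩⟩

end V

end Murnaghan

end

noncomputable section

namespace Murnaghan

variable {n : ℕ} {μ : YoungDiagram}

/-! # Symmetric Macdonald polynomials -/

namespace PSYT

theorem sw_sw (i : Fin (n - 1)) (τ : PSYT n μ) : sw i (sw i τ) = τ := by
  by_cases h : ∃ τ', IsSwap i τ τ'
  · exact sw_eq (isSwap_sw h).symm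
  · have h1 : sw i τ = τ := by rw [sw, dif_neg h]
    rw [h1, h1]

theorem Up.wc_lo {i : Fin (n - 1)} {τ : PSYT n μ} (h : Up i τ) : (sw i τ).wc (lo i) = τ.wc (hi i) := by
  rw [wc, wc, (isSwap_sw h.exists_isSwap).w_eq, (isSwap_sw h.exists_isSwap).c_eq, simpleRefl_lo]

theorem Up.wc_hi {i : Fin (n - 1)} {τ : PSYT n μ} (h : Up i τ) : (sw i τ).wc (hi i) = τ.wc (lo i) := by
  rw [wc, wc, (isSwap_sw h.exists_isSwap).w_eq, (isSwap_sw h.exists_isSwap).c_eq, simpleRefl_hi]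

end PSYT

open Classical in
/-- The factor of a pair of labels in the coefficients of the symmetric Macdonald polynomials. -/
def pairFactor (u v : ℕ × ℤ) : Kqt := if UpPair u v then t - diagCoef v u else 1

/-- The numerator splits into the factors for `T_i`-invariance in the two directions; this is why a
product over pairs can give the coefficients. -/
theorem offCoef_eq_mul {u v : ℕ × ℤ} (h : ¬ UpPair u v) (hne : qtp u ≠ qtp v) :
    offCoef u v = (t - diagCoef u v) * (t - diagCoef v u) := by
  have h1 : qtp u - qtp v ≠ 0 := sub_ne_zero.2 hne
  have h2 : qtp v - qtp u ≠ 0 := sub_ne_zero.2 hne.symm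
  rw [offCoef, if_neg h, diagCoef, diagCoef]
  field_simp
  ring

/-- The label of a box: its exponent and its content. -/
def boxLabel (T : μ.cells → ℕ) (c : μ.cells) : ℕ × ℤ := (T c, content c)

/-- The coefficients of the symmetric Macdonald polynomials. -/
def PSYT.kappa (τ : PSYT n μ) : Kqt :=
  ∏ p : μ.cells × μ.cells,
    if τ.idx p.1 < τ.idx p.2 then pairFactor (boxLabel τ.wt p.1) (boxLabel τ.wt p.2) else 1

theorem PSYT.kappa_of_sorted {τ : PSYT n μ} (h : τ.Sorted) : τ.kappa = 1 := by
  refine Finset.prod_eq_one fun p _ => ?_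
  split_ifs with h1
  · rw [pairFactor, if_neg]
    have h2 := h _ _ h1
    simp only [PSYT.w, PSYT.c, Equiv.symm_apply_apply] at h2
    unfold UpPair boxLabel
    dsimp only
    omega
  · rfl

/-- An exchange changes the relative order of one pair of boxes only. That pair contributes a factor
in `τ` and, since its reversal is not upward, the factor `1` in `s_i(τ)`. -/
theorem PSYT.kappa_of_up {i : Fin (n - 1)} {τ : PSYT n μ} (h : PSYT.Up i τ) :
    τ.kappa = (t - diagCoef (τ.wc (hi i)) (τ.wc (lo i))) * (PSYT.sw i τ).kappa := by
  classical
  have hs := PSYT.isSwap_sw h.exists_isSwap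
  have hu : UpPair (τ.wc (lo i)) (τ.wc (hi i)) := h
  have hu' : ¬ UpPair (τ.wc (hi i)) (τ.wc (lo i)) := by unfold UpPair at *; omega
  obtain ⟨a, ha⟩ : ∃ a, a = τ.idx.symm (lo i) := ⟨_, rfl⟩
  obtain ⟨b, hb⟩ : ∃ b, b = τ.idx.symm (hi i) := ⟨_, rfl⟩
  have ha' : τ.idx a = lo i := by rw [ha, Equiv.apply_symm_apply]
  have hb' : τ.idx b = hi i := by rw [hb, Equiv.apply_symm_apply]
  have hla : boxLabel τ.wt a = τ.wc (lo i) := by rw [ha]; rfl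
  have hlb : boxLabel τ.wt b = τ.wc (hi i) := by rw [hb]; rfl
  have hidx : ∀ c, (PSYT.sw i τ).idx c = simpleRefl i (τ.idx c) := fun c => by rw [hs.1]; rfl
  -- The extra factor is written as a product over all pairs, so that both sides can be compared
  -- pair by pair.
  have hprod : ∏ p : μ.cells × μ.cells,
      (if p = (a, b) then t - diagCoef (τ.wc (hi i)) (τ.wc (lo i)) else 1) =
        t - diagCoef (τ.wc (hi i)) (τ.wc (lo i)) := by
    rw [Finset.prod_ite_eq' Finset.univ (a, b) fun _ => t - diagCoef (τ.wc (hi i)) (τ.wc (lo i)),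
      if_pos (Finset.mem_univ _)]
  conv_rhs => rw [← hprod]
  rw [PSYT.kappa, PSYT.kappa, ← Finset.prod_mul_distrib]
  refine Finset.prod_congr rfl fun p _ => ?_
  obtain ⟨c, d⟩ := p
  dsimp only
  rw [hidx, hidx, hs.2]
  have hlt := lo_lt_hi i
  by_cases h1 : (c, d) = (a, b)
  · obtain ⟨rfl, rfl⟩ := Prod.mk.inj h1
    rw [if_pos rfl, ha', hb', simpleRefl_lo, simpleRefl_hi, if_pos hlt, if_neg hlt.asymm, mul_one,
      hla, hlb, pairFactor, if_pos hu]
  rw [if_neg h1, one_mul]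
  by_cases h2 : (d, c) = (a, b)
  · obtain ⟨rfl, rfl⟩ := Prod.mk.inj h2
    rw [ha', hb', simpleRefl_lo, simpleRefl_hi, if_pos hlt, if_neg hlt.asymm, hla, hlb, pairFactor,
      if_neg hu']
  have key : ∀ c d : μ.cells, (c, d) ≠ (a, b) → τ.idx c < τ.idx d →
      simpleRefl i (τ.idx c) < simpleRefl i (τ.idx d) := fun c d hcd hlt =>
    simpleRefl_lt i hlt fun hc => hcd (by
      rw [ha, hb, ← hc.1, ← hc.2, Equiv.symm_apply_apply, Equiv.symm_apply_apply])
  have hiff : τ.idx c < τ.idx d ↔ simpleRefl i (τ.idx c) < simpleRefl i (τ.idx d) := by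
    refine ⟨key c d h1, fun hlt => ?_⟩
    by_contra hc
    rcases (not_lt.1 hc).lt_or_eq with hc | hc
    · exact (key d c h2 hc).asymm hlt
    · rw [hc] at hlt
      exact lt_irrefl _ hlt
  simp only [hiff]

/-! ### Coefficients of invariant vectors -/

namespace V

/-- The coefficients of `t T_i⁻¹ v`. -/
theorem coef_R_of_up {i : Fin (n - 1)} {τ : PSYT n μ} (h : PSYT.Up i τ) (v : V n μ) :
    coef (τ.sw i) (t • tInv (DAHA.T i) • v) =
      diagCoef (τ.wc (hi i)) (τ.wc (lo i)) * coef (τ.sw i) v + coef τ v := by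
  have hs := PSYT.isSwap_sw h.exists_isSwap
  have hne : PSYT.sw i τ ≠ τ := fun e => by
    have h1 := h.wc_lo
    rw [e] at h1
    have := τ.ev_ne (lo_lt_hi i) (by simp [lo, hi])
    exact this (congrArg qtp h1)
  have key : (coef (τ.sw i)) ∘ₗ (act μ (t • tInv (DAHA.T i))) =
      diagCoef (τ.wc (hi i)) (τ.wc (lo i)) • coef (τ.sw i) + coef τ := by
    refine linearMap_ext_F fun σ => ?_
    rw [LinearMap.comp_apply, act_apply, smul_assoc, R_F, map_add, map_smul, map_smul,
      LinearMap.add_apply, LinearMap.smul_apply, coef_F, coef_F, coef_F]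
    by_cases h1 : σ = PSYT.sw i τ
    · rw [if_pos h1, if_neg (fun e => hne (h1 ▸ e)), h1, PSYT.sw_sw, if_neg hne.symm, h.wc_lo,
        h.wc_hi]
      simp
    · rw [if_neg h1]
      by_cases h2 : σ = τ
      · have hu : UpPair (τ.wc (lo i)) (τ.wc (hi i)) := h
        rw [if_pos h2, h2, if_pos rfl, offCoef, if_pos hu]
        simp
      · rw [if_neg h2, if_neg fun e => h2 (by rw [← PSYT.sw_sw i σ, e, PSYT.sw_sw])]
        simp
  have := LinearMap.congr_fun key v
  rwa [LinearMap.comp_apply, act_apply, smul_assoc] at this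

/-- Compare the coefficients of `F` at `s_i(τ)` in `t T_i⁻¹ v = t v`; the upward off-diagonal
coefficient is `1`, so the one at `τ` appears without a factor. -/
theorem coef_of_isInv {i : Fin (n - 1)} {τ : PSYT n μ} (h : PSYT.Up i τ) {v : V n μ}
    (hv : IsInv v) : coef τ v = (t - diagCoef (τ.wc (hi i)) (τ.wc (lo i))) * coef (τ.sw i) v := by
  have h1 := coef_R_of_up h v
  rw [(T_smul_eq_self_iff i v).1 (hv i), map_smul, smul_eq_mul] at h1
  linear_combination -h1

/-- An invariant vector of `U_T` is determined by its leading coefficient. -/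
theorem eq_zero_of_isInv {τ₀ : PSYT n μ} (h₀ : τ₀.Sorted) (hT : IsRSSYT τ₀.wt) {v : V n μ}
    (hv : IsInv v) (hU : ∀ τ : PSYT n μ, τ.wt ≠ τ₀.wt → coef τ v = 0) (h : coef τ₀ v = 0) :
    v = 0 := by
  refine eq_zero_of_coef fun τ => ?_
  by_cases hτ : τ.wt = τ₀.wt
  · refine PSYT.induction_down h₀ hT (P := fun τ => coef τ v = 0) h ?_ τ hτ
    intro i τ _ hup ih
    rw [coef_of_isInv hup hv, ih, mul_zero]
  · exact hU τ hτ

/-! ## Existence -/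

instance finite_wt (T : μ.cells → ℕ) : Finite {τ : PSYT n μ // τ.wt = T} :=
  Finite.of_injective (β := μ.cells ≃ Fin n) (fun τ => τ.1.idx) fun τ σ h =>
    Subtype.ext (PSYT.ext h (τ.2.trans σ.2.symm))

/-- This is the coefficient at `τ` of the equation `t T_i⁻¹ P = t P` for `P = ∑ κ_τ F_τ`. In the
downward direction it rests on the factorization of the off-diagonal coefficient. -/
theorem kappa_relation {τ : PSYT n μ} (hT : IsRSSYT τ.wt) (i : Fin (n - 1)) :
    τ.kappa * diagCoef (τ.wc (lo i)) (τ.wc (hi i)) +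
      (τ.sw i).kappa * offCoef ((τ.sw i).wc (lo i)) ((τ.sw i).wc (hi i)) = t * τ.kappa := by
  by_cases h : ∃ τ', PSYT.IsSwap i τ τ'
  · rcases (PSYT.isSwap_sw h).up_or_up with h1 | h1
    · have hu : UpPair (τ.wc (lo i)) (τ.wc (hi i)) := h1
      have hu' : ¬ UpPair (τ.wc (hi i)) (τ.wc (lo i)) := by unfold UpPair at *; omega
      have hne : qtp (τ.wc (hi i)) ≠ qtp (τ.wc (lo i)) :=
        (τ.ev_ne (lo_lt_hi i) (by simp [lo, hi])).symm
      rw [PSYT.kappa_of_up h1, h1.wc_lo, h1.wc_hi, offCoef_eq_mul hu' hne]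
      ring
    · have hu : UpPair ((τ.sw i).wc (lo i)) ((τ.sw i).wc (hi i)) := h1
      have e1 := h1.wc_lo
      have e2 := h1.wc_hi
      rw [PSYT.sw_sw] at e1 e2
      rw [PSYT.kappa_of_up h1, PSYT.sw_sw, offCoef, if_pos hu, e1, e2]
      ring
  · have h1 : PSYT.sw i τ = τ := by rw [PSYT.sw, dif_neg h]
    have h2 := PSYT.not_isSwap h
    rw [h1, PSYT.offCoef_of_not_isSwap h, mul_zero, add_zero, mul_comm]
    congr 1
    rcases h2.2 with h3 | h3
    · have h4 : qtp (τ.wc (hi i)) = t * qtp (τ.wc (lo i)) := by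
        rw [← qtp_add_one, PSYT.wc, PSYT.wc, h2.1, h3.2]
      have h5 := qtp_ne_zero (τ.wc (lo i))
      have h6 := one_sub_t_ne_zero
      rw [diagCoef, h4,
        show qtp (τ.wc (lo i)) - t * qtp (τ.wc (lo i)) = (1 - t) * qtp (τ.wc (lo i)) by ring]
      field_simp
    -- Two boxes of one column with equal exponents, where `T_i` would act by `-t`, do not occur
    -- when the exponents decrease strictly down columns.
    · exfalso
      have h4 := h3.2
      unfold PSYT.c content at h4
      have h5 := hT.2 (τ.idx.symm (lo i)) (τ.idx.symm (hi i)) ⟨h3.1, by have := h3.1; omega⟩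
      have h6 := h2.1
      unfold PSYT.w at h6
      omega

/-- The symmetric Macdonald polynomial, as a combination of the non-symmetric ones. -/
theorem exists_isInv {τ₀ : PSYT n μ} (h₀ : τ₀.Sorted) (hT : IsRSSYT τ₀.wt) :
    ∃ P : V n μ, IsInv P ∧ (∀ τ : PSYT n μ, τ.wt ≠ τ₀.wt → coef τ P = 0) ∧ coef τ₀ P = 1 := by
  classical
  have := Fintype.ofFinite {τ : PSYT n μ // τ.wt = τ₀.wt}
  refine ⟨∑ τ : {τ : PSYT n μ // τ.wt = τ₀.wt}, τ.1.kappa • F τ.1, fun i => ?_, fun τ hτ => ?_, ?_⟩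
  · rw [T_smul_eq_self_iff]
    -- The off-diagonal sum is reindexed by the involution `s_i`, which collects the coefficient of
    -- each `F`.
    let s : {τ : PSYT n μ // τ.wt = τ₀.wt} → {τ : PSYT n μ // τ.wt = τ₀.wt} :=
      fun τ => ⟨τ.1.sw i, (PSYT.sw_wt i τ.1).trans τ.2⟩
    have hs : Function.Involutive s := fun τ => Subtype.ext (PSYT.sw_sw i τ.1)
    have h1 : t • tInv (DAHA.T i) • ∑ τ : {τ : PSYT n μ // τ.wt = τ₀.wt}, τ.1.kappa • F τ.1 =
        ∑ τ : {τ : PSYT n μ // τ.wt = τ₀.wt},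
          (τ.1.kappa * diagCoef (τ.1.wc (lo i)) (τ.1.wc (hi i))) • F τ.1 +
        ∑ τ : {τ : PSYT n μ // τ.wt = τ₀.wt},
          (τ.1.kappa * offCoef (τ.1.wc (lo i)) (τ.1.wc (hi i))) • F (s τ).1 := by
      rw [Finset.smul_sum, Finset.smul_sum, ← Finset.sum_add_distrib]
      refine Finset.sum_congr rfl fun τ _ => ?_
      rw [smul_smul_comm, smul_comm t, R_F, smul_add, smul_smul, smul_smul]
    rw [h1, ← Equiv.sum_comp (hs.toPerm s) fun τ : {τ : PSYT n μ // τ.wt = τ₀.wt} =>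
      (τ.1.kappa * offCoef (τ.1.wc (lo i)) (τ.1.wc (hi i))) • F (s τ).1, ← Finset.sum_add_distrib,
      Finset.smul_sum]
    refine Finset.sum_congr rfl fun τ _ => ?_
    have h2 : s ((hs.toPerm s) τ) = τ := by rw [Function.Involutive.coe_toPerm]; exact hs τ
    have h3 : ((hs.toPerm s) τ).1 = τ.1.sw i := rfl
    rw [h2, h3, ← add_smul, smul_smul, kappa_relation (by rw [τ.2]; exact hT)]
  · rw [map_sum]
    refine Finset.sum_eq_zero fun σ _ => ?_
    rw [map_smul, coef_F, if_neg (fun e => hτ (by rw [← e, σ.2])), smul_zero]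
  · rw [map_sum, Finset.sum_eq_single ⟨τ₀, rfl⟩]
    · rw [map_smul, coef_F, if_pos rfl, PSYT.kappa_of_sorted h₀, smul_eq_mul, mul_one]
    · intro σ _ hσ
      rw [map_smul, coef_F, if_neg (fun e => hσ (Subtype.ext e)), smul_zero]
    · intro h
      exact absurd (Finset.mem_univ _) h

theorem mem_U_iff {T : μ.cells → ℕ} {v : V n μ} :
    v ∈ U n T ↔ ∀ τ : PSYT n μ, τ.wt ≠ T → coef τ v = 0 := by
  rw [U, nonsymMacdonald_eq, mem_span_iff_coef]

theorem T_smul_mem_U {T : μ.cells → ℕ} (i : Fin (n - 1)) {v : V n μ} (hv : v ∈ U n T) :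
    DAHA.T i • v ∈ U n T := by
  rw [U, nonsymMacdonald_eq] at hv ⊢
  induction hv using Submodule.span_induction with
  | mem v hv =>
    obtain ⟨τ, h, rfl⟩ := hv
    have h1 : F τ ∈ Submodule.span Kqt {x | ∃ τ : PSYT n μ, τ.wt = T ∧ x = F τ} :=
      Submodule.subset_span ⟨τ, h, rfl⟩
    rw [T_smul, R_F]
    exact sub_mem (add_mem (Submodule.smul_mem _ _ h1) (Submodule.smul_mem _ _
      (Submodule.subset_span ⟨_, (PSYT.sw_wt i τ).trans h, rfl⟩))) (Submodule.smul_mem _ _ h1)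
  | zero => rw [smul_zero]; exact zero_mem _
  | add v w _ _ hv hw => rw [smul_add]; exact add_mem hv hw
  | smul a v _ hv => rw [smul_smul_comm]; exact Submodule.smul_mem _ _ hv

/-- A characterization of the symmetric Macdonald polynomials. -/
theorem isSymMacdonald_iff {τ₀ : PSYT n μ} (h₀ : τ₀.Sorted) (hT : IsRSSYT τ₀.wt) (P : V n μ) :
    IsSymMacdonald n τ₀.wt P ↔
      IsInv P ∧ (∀ τ : PSYT n μ, τ.wt ≠ τ₀.wt → coef τ P = 0) ∧ coef τ₀ P = 1 := by
  have hset : {x | ∃ y : PSYT n μ, y.wt = τ₀.wt ∧ y ≠ τ₀ ∧ x = F y} =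
      {x | ∃ y : PSYT n μ, (y.wt = τ₀.wt ∧ y ≠ τ₀) ∧ x = F y} := by
    simp only [and_assoc]
  rw [IsSymMacdonald, mem_map_ε_iff fun i v hv => T_smul_mem_U i hv, mem_U_iff, nonsymMacdonald_eq]
  constructor
  · rintro ⟨⟨h1, h2⟩, τ, hτ, h3⟩
    obtain rfl := h₀.eq_of_isTop hτ
    refine ⟨h2, h1, ?_⟩
    rw [hset, mem_span_iff_coef] at h3
    have h4 := h3 τ fun h => h.2 rfl
    rw [map_sub, coef_F, if_pos rfl, sub_eq_zero] at h4
    exact h4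
  · rintro ⟨h1, h2, h3⟩
    refine ⟨⟨h2, h1⟩, τ₀, h₀.isTop hT, ?_⟩
    rw [hset, mem_span_iff_coef]
    intro τ hτ
    rw [map_sub, coef_F]
    by_cases h : τ₀ = τ
    · rw [if_pos h, ← h, h3, sub_self]
    · rw [if_neg h, sub_zero]
      exact h2 τ fun e => hτ ⟨e, fun e => h e.symm⟩

theorem isSymMacdonald_unique {τ₀ : PSYT n μ} (h₀ : τ₀.Sorted) (hT : IsRSSYT τ₀.wt) {P Q : V n μ}
    (hP : IsSymMacdonald n τ₀.wt P) (hQ : IsSymMacdonald n τ₀.wt Q) : P = Q := by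
  rw [isSymMacdonald_iff h₀ hT] at hP hQ
  rw [← sub_eq_zero]
  refine eq_zero_of_isInv h₀ hT (fun i => ?_) (fun τ hτ => ?_) ?_
  · rw [smul_sub, hP.1 i, hQ.1 i]
  · rw [map_sub, hP.2.1 τ hτ, hQ.2.1 τ hτ, sub_zero]
  · rw [map_sub, hP.2.2, hQ.2.2, sub_self]

theorem existsUnique_isSymMacdonald {T : μ.cells → ℕ} (hT : IsRSSYT T) (hn : μ.card = n) :
    ∃! P, IsSymMacdonald n T P := by
  obtain ⟨τ₀, rfl, h₀⟩ := PSYT.exists_sorted hT hn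
  obtain ⟨P, hP⟩ := exists_isInv h₀ hT
  have hP' := (isSymMacdonald_iff h₀ hT P).2 hP
  exact ⟨P, hP', fun Q hQ => isSymMacdonald_unique h₀ hT hQ hP'⟩

theorem isSymMacdonald_symMacdonald {T : μ.cells → ℕ} (hT : IsRSSYT T) (hn : μ.card = n) :
    IsSymMacdonald n T (symMacdonald n T) :=
  Classical.epsilon_spec (existsUnique_isSymMacdonald hT hn).exists

end V

end Murnaghan

end

noncomputable section

namespace Murnaghan

/-! # Addition of a box -/

/-- The diagram `μ'` is obtained from `μ` by addition of the box `b`, which has the largest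
content. -/
structure AddBox (μ μ' : YoungDiagram) (b : ℕ × ℕ) : Prop where
  mem_iff : ∀ c, c ∈ μ'.cells ↔ c ∈ μ.cells ∨ c = b
  notMem : b ∉ μ.cells
  content_lt : ∀ c ∈ μ.cells, content c < content b

namespace AddBox

variable {n : ℕ} {μ μ' : YoungDiagram} {b : ℕ × ℕ} (H : AddBox μ μ' b)

/-- The inclusion of the boxes. -/
def emb (c : μ.cells) : μ'.cells := ⟨c.1, (H.mem_iff _).2 (Or.inl c.2)⟩

/-- The new box. -/
def box : μ'.cells := ⟨b, (H.mem_iff _).2 (Or.inr rfl)⟩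

theorem emb_or_box (c : μ'.cells) : (∃ d, H.emb d = c) ∨ H.box = c := by
  rcases (H.mem_iff c.1).1 c.2 with h | h
  · exact Or.inl ⟨⟨c.1, h⟩, rfl⟩
  · exact Or.inr (Subtype.ext h.symm)

theorem emb_injective : Function.Injective H.emb := fun _ _ h =>
  Subtype.ext (congrArg (fun x : μ'.cells => x.1) h)

theorem emb_ne_box (c : μ.cells) : H.emb c ≠ H.box := fun h =>
  H.notMem (by
    have : c.1 = b := congrArg (fun x : μ'.cells => x.1) h
    rw [← this]
    exact c.2)

/-- A box to the right would have larger content, and a box below would force the new box into the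
smaller diagram. -/
theorem box_not_before (H : AddBox μ μ' b) (d : μ'.cells) : ¬ (RowBefore b d ∨ ColBefore b d) := by
  intro h
  rcases H.emb_or_box d with ⟨c, rfl⟩ | rfl
  · have h1 := H.content_lt c.1 c.2
    rcases h with h | h
    · have h2 : b.1 = c.1.1 := h.1
      have h3 : b.2 < c.1.2 := h.2
      unfold content at h1
      omega
    · exact H.notMem (μ.isLowerSet (show b ≤ c.1 from ⟨h.2.le, h.1.le⟩) c.2)
  · rcases h with h | h
    · exact lt_irrefl _ h.2
    · exact lt_irrefl _ h.2

/-- Extension of a labelling by the largest number in the new box. -/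
def extendEquiv (e : μ.cells ≃ Fin n) : μ'.cells ≃ Fin (n + 1) where
  toFun c := if h : c.1 ∈ μ.cells then (e ⟨c.1, h⟩).castSucc else Fin.last n
  invFun i := if h : (i : ℕ) < n then H.emb (e.symm ⟨i, h⟩) else H.box
  left_inv c := by
    rcases H.emb_or_box c with ⟨c, rfl⟩ | rfl
    · have h : (H.emb c).1 ∈ μ.cells := c.2
      dsimp only
      rw [dif_pos h]
      refine (dif_pos (e ⟨(H.emb c).1, h⟩).2).trans ?_
      exact congrArg H.emb (e.symm_apply_apply c)
    · dsimp only
      rw [dif_neg (show H.box.1 ∉ μ.cells from H.notMem), dif_neg (by simp)]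
  right_inv i := by
    dsimp only
    split_ifs with h1 h2 h3
    · refine Fin.ext ?_
      have : (⟨(H.emb (e.symm ⟨i, h1⟩)).1, h2⟩ : μ.cells) = e.symm ⟨i, h1⟩ := rfl
      rw [this, Equiv.apply_symm_apply]
      rfl
    · exact absurd (e.symm ⟨i, h1⟩).2 h2
    · exact absurd h3 H.notMem
    · refine Fin.ext ?_
      have := i.2
      simp
      omega

theorem extendEquiv_emb (e : μ.cells ≃ Fin n) (c : μ.cells) :
    H.extendEquiv e (H.emb c) = (e c).castSucc := dif_pos c.2

theorem extendEquiv_box (e : μ.cells ≃ Fin n) : H.extendEquiv e H.box = Fin.last n :=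
  dif_neg H.notMem

/-- Extension of a labelling by zero. -/
theorem exists_extendWt (H : AddBox μ μ' b) (T : μ.cells → ℕ) :
    ∃ T' : μ'.cells → ℕ, (∀ c, T' (H.emb c) = T c) ∧ T' H.box = 0 := by
  classical
  exact ⟨fun c => if h : c.1 ∈ μ.cells then T ⟨c.1, h⟩ else 0, fun c => dif_pos c.2,
    dif_neg H.notMem⟩

/-- Extension of a labelling by zero. -/
def extendWt (T : μ.cells → ℕ) : μ'.cells → ℕ := (H.exists_extendWt T).choose

theorem extendWt_emb (T : μ.cells → ℕ) (c : μ.cells) : H.extendWt T (H.emb c) = T c :=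
  (H.exists_extendWt T).choose_spec.1 c

theorem extendWt_box (T : μ.cells → ℕ) : H.extendWt T H.box = 0 :=
  (H.exists_extendWt T).choose_spec.2

theorem eq_extendWt {T : μ.cells → ℕ} {T' : μ'.cells → ℕ} (h : ∀ c, T' (H.emb c) = T c)
    (h' : T' H.box = 0) : T' = H.extendWt T := by
  funext c
  rcases H.emb_or_box c with ⟨c, rfl⟩ | rfl
  · rw [h, extendWt_emb]
  · rw [h', extendWt_box]

/-- Extension of a tableau by the largest number in the new box. -/
def hat (τ : PSYT n μ) : PSYT (n + 1) μ' where
  idx := H.extendEquiv τ.idx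
  wt := H.extendWt τ.wt
  strict c d h := by
    rcases H.emb_or_box c with ⟨c, rfl⟩ | rfl
    · rcases H.emb_or_box d with ⟨d, rfl⟩ | rfl
      · have := τ.strict c d h
        rw [extendEquiv_emb, extendEquiv_emb, extendWt_emb, extendWt_emb]
        exact this
      · rw [extendEquiv_emb, extendEquiv_box, extendWt_emb, extendWt_box]
        rcases Nat.eq_zero_or_pos (τ.wt c) with h1 | h1
        · exact Or.inr ⟨h1, Fin.castSucc_lt_last _⟩
        · exact Or.inl h1
    · exact absurd h (H.box_not_before d)

theorem hat_idx_emb (τ : PSYT n μ) (c : μ.cells) :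
    (H.hat τ).idx (H.emb c) = (τ.idx c).castSucc := H.extendEquiv_emb _ _

theorem hat_idx_box (τ : PSYT n μ) : (H.hat τ).idx H.box = Fin.last n := H.extendEquiv_box _

theorem hat_wt_emb (τ : PSYT n μ) (c : μ.cells) : (H.hat τ).wt (H.emb c) = τ.wt c :=
  H.extendWt_emb _ _

theorem hat_wt_box (τ : PSYT n μ) : (H.hat τ).wt H.box = 0 := H.extendWt_box _

theorem hat_symm_castSucc (τ : PSYT n μ) (i : Fin n) :
    (H.hat τ).idx.symm i.castSucc = H.emb (τ.idx.symm i) := by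
  rw [Equiv.symm_apply_eq, hat_idx_emb, Equiv.apply_symm_apply]

theorem hat_wc (τ : PSYT n μ) (i : Fin n) : (H.hat τ).wc i.castSucc = τ.wc i := by
  rw [PSYT.wc, PSYT.wc, PSYT.w, PSYT.w, PSYT.c, PSYT.c, hat_symm_castSucc, hat_wt_emb]
  rfl

theorem eq_hat {τ : PSYT n μ} {τ' : PSYT (n + 1) μ'}
    (h : ∀ c, (τ'.idx (H.emb c) : ℕ) = τ.idx c ∧ τ'.wt (H.emb c) = τ.wt c)
    (h' : (τ'.idx H.box : ℕ) = n ∧ τ'.wt H.box = 0) : τ' = H.hat τ := by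
  refine PSYT.ext (Equiv.ext fun c => ?_) (H.eq_extendWt (fun c => (h c).2) h'.2)
  rcases H.emb_or_box c with ⟨c, rfl⟩ | rfl
  · rw [hat_idx_emb]; exact Fin.ext (h c).1
  · rw [hat_idx_box]; exact Fin.ext h'.1

theorem hat_injective : Function.Injective (H.hat (n := n)) := fun τ σ h => by
  refine PSYT.ext (Equiv.ext fun c => ?_) (funext fun c => ?_)
  · have h1 := congrArg (fun x => x.idx (H.emb c)) h
    rw [hat_idx_emb, hat_idx_emb] at h1
    exact Fin.castSucc_injective _ h1
  · rw [← H.hat_wt_emb τ, h, hat_wt_emb]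

theorem exists_hat {τ' : PSYT (n + 1) μ'} (h : τ'.idx H.box = Fin.last n) (h' : τ'.wt H.box = 0) :
    ∃ τ, H.hat τ = τ' := by
  have hlt : ∀ c, (τ'.idx (H.emb c) : ℕ) < n := fun c => by
    have h1 : τ'.idx (H.emb c) ≠ Fin.last n := fun e =>
      H.emb_ne_box c (τ'.idx.injective (e.trans h.symm))
    exact Fin.val_lt_last h1
  let f : μ.cells → Fin n := fun c => ⟨τ'.idx (H.emb c), hlt c⟩
  have hf : Function.Bijective f := by
    refine ⟨fun c d hcd => H.emb_injective (τ'.idx.injective (Fin.ext ?_)), fun i => ?_⟩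
    · simpa [f] using hcd
    · rcases H.emb_or_box (τ'.idx.symm i.castSucc) with ⟨c, hc⟩ | hc
      · refine ⟨c, Fin.ext ?_⟩
        simp only [f, hc, Equiv.apply_symm_apply, Fin.val_castSucc]
      · rw [Equiv.eq_symm_apply, h] at hc
        exact absurd hc.symm (Fin.castSucc_lt_last i).ne
  refine ⟨⟨Equiv.ofBijective f hf, fun c => τ'.wt (H.emb c), fun c d hcd => ?_⟩, ?_⟩
  · exact τ'.strict (H.emb c) (H.emb d) hcd
  · refine (H.eq_hat (fun c => ⟨rfl, rfl⟩) ⟨?_, h'⟩).symm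
    rw [h]
    rfl

/-- The index `i`, for a larger number of variables. -/
def up (i : Fin (n - 1)) : Fin (n + 1 - 1) := ⟨i, by omega⟩

theorem lo_up (i : Fin (n - 1)) : lo (up i) = (lo i).castSucc := rfl

theorem hi_up (i : Fin (n - 1)) : hi (up i) = (hi i).castSucc := rfl

theorem simpleRefl_up (i : Fin (n - 1)) (j : Fin n) :
    simpleRefl (up i) j.castSucc = (simpleRefl i j).castSucc := by
  refine Fin.ext ?_
  rw [Labelling.simpleRefl_val_of_ne, Fin.val_castSucc, Fin.val_castSucc,
    Labelling.simpleRefl_val_of_ne]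
  rfl

theorem simpleRefl_up_last (i : Fin (n - 1)) : simpleRefl (up i) (Fin.last n) = Fin.last n :=
  simpleRefl_of_ne _ (by simp [Fin.ext_iff, lo, up]; omega) (by simp [Fin.ext_iff, hi, up]; omega)

theorem isSwap_hat {i : Fin (n - 1)} {τ σ : PSYT n μ} (h : PSYT.IsSwap i τ σ) :
    PSYT.IsSwap (up i) (H.hat τ) (H.hat σ) := by
  refine ⟨Equiv.ext fun c => ?_, congrArg H.extendWt h.2⟩
  change _ = simpleRefl (up i) ((H.hat τ).idx c)
  rcases H.emb_or_box c with ⟨c, rfl⟩ | rfl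
  · rw [hat_idx_emb, hat_idx_emb, simpleRefl_up, h.1]
    rfl
  · rw [hat_idx_box, hat_idx_box, simpleRefl_up_last]

theorem sw_idx_box_iff (i : Fin (n - 1)) (τ' : PSYT (n + 1) μ') :
    (PSYT.sw (up i) τ').idx H.box = Fin.last n ↔ τ'.idx H.box = Fin.last n := by
  by_cases h : ∃ σ, PSYT.IsSwap (up i) τ' σ
  · rw [(PSYT.isSwap_sw h).1]
    change simpleRefl (up i) (τ'.idx H.box) = _ ↔ _
    rw [← simpleRefl_up_last i, (simpleRefl (up i)).apply_eq_iff_eq, simpleRefl_up_last]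
  · rw [PSYT.sw, dif_neg h]

/-- An exchange below `n` leaves `n + 1` in the new box, so its result on an extended tableau is
again an extension, and one side is defined exactly when the other is. -/
theorem sw_hat (i : Fin (n - 1)) (τ : PSYT n μ) :
    PSYT.sw (up i) (H.hat τ) = H.hat (PSYT.sw i τ) := by
  by_cases h : ∃ σ, PSYT.IsSwap i τ σ
  · exact PSYT.sw_eq (H.isSwap_hat (PSYT.isSwap_sw h))
  · have h' : ¬ ∃ σ, PSYT.IsSwap (up i) (H.hat τ) σ := by
      rintro ⟨σ', hσ⟩
      have h1 : σ'.idx H.box = Fin.last n := by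
        have := (H.sw_idx_box_iff i (H.hat τ)).2 (H.hat_idx_box τ)
        rwa [PSYT.sw_eq hσ] at this
      obtain ⟨σ, rfl⟩ := H.exists_hat h1 (by rw [hσ.2, hat_wt_box])
      refine h ⟨σ, Equiv.ext fun c => ?_, funext fun c => ?_⟩
      · have h2 := Equiv.congr_fun hσ.1 (H.emb c)
        change _ = simpleRefl (up i) ((H.hat τ).idx (H.emb c)) at h2
        rw [hat_idx_emb, hat_idx_emb, simpleRefl_up] at h2
        exact Fin.castSucc_injective _ h2
      · rw [← H.hat_wt_emb σ, hσ.2, hat_wt_emb]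
    rw [PSYT.sw, dif_neg h', PSYT.sw, dif_neg h]

theorem up_hat {i : Fin (n - 1)} {τ : PSYT n μ} (h : PSYT.Up i τ) :
    PSYT.Up (up i) (H.hat τ) := by
  have h1 : UpPair (τ.wc (lo i)) (τ.wc (hi i)) := h
  rw [← H.hat_wc, ← H.hat_wc] at h1
  exact h1

/-- The exchange that involves the largest number. -/
def lastRefl (hn : 0 < n) : Fin (n + 1 - 1) := ⟨n - 1, by omega⟩

/-- The larger shift lowers the number of the new box to `n` and sends `1` to `n + 1`; exchanging
`n` and `n + 1` restores the extension of the smaller shift. -/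
theorem isSwap_psi_hat (hn : 0 < n) (τ : PSYT n μ) :
    PSYT.IsSwap (lastRefl hn) (H.hat τ).psi (H.hat τ.psi) := by
  refine ⟨Equiv.ext fun c => Fin.ext ?_, funext fun c => ?_⟩
  · change _ = ((simpleRefl (lastRefl hn) (rotDown (n + 1) ((H.hat τ).idx c)) : Fin (n + 1)) : ℕ)
    rw [Labelling.simpleRefl_val_of_ne, Labelling.rotDown_val]
    rcases H.emb_or_box c with ⟨c, rfl⟩ | rfl
    · rw [hat_idx_emb, hat_idx_emb]
      change ((rotDown n (τ.idx c) : Fin n) : ℕ) = _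
      rw [Labelling.rotDown_val, Fin.val_castSucc]
      have := (τ.idx c).2
      simp only [lastRefl]
      split_ifs <;> omega
    · rw [hat_idx_box, hat_idx_box]
      simp only [lastRefl, Fin.val_last]
      split_ifs <;> omega
  · rcases H.emb_or_box c with ⟨c, rfl⟩ | rfl
    · rw [hat_wt_emb]
      change _ = (H.hat τ).wt (H.emb c) + if ((H.hat τ).idx (H.emb c) : ℕ) = 0 then 1 else 0
      rw [hat_wt_emb, hat_idx_emb]
      rfl
    · rw [hat_wt_box]
      change _ = (H.hat τ).wt H.box + if ((H.hat τ).idx H.box : ℕ) = 0 then 1 else 0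
      rw [hat_wt_box, hat_idx_box, if_neg (by simp; omega)]

/-- The new box, now numbered `n`, has exponent zero, while the number `n + 1` has just had its
exponent raised. -/
theorem swapUp_psi_hat (hn : 0 < n) (τ : PSYT n μ) :
    PSYT.SwapUp (lastRefl hn) (H.hat τ).psi (H.hat τ.psi) := by
  refine ⟨H.isSwap_psi_hat hn τ, Or.inl ?_⟩
  have h := H.isSwap_psi_hat hn τ
  have h1 := h.w_eq (lo (lastRefl hn))
  have h2 := h.w_eq (hi (lastRefl hn))
  rw [simpleRefl_lo] at h1
  rw [simpleRefl_hi] at h2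
  rw [← h1, ← h2]
  have e1 : (H.hat τ.psi).w (hi (lastRefl hn)) = 0 := by
    have : hi (lastRefl hn) = Fin.last n := Fin.ext (by simp [hi, lastRefl]; omega)
    rw [PSYT.w, this, ← H.hat_idx_box τ.psi, Equiv.symm_apply_apply, hat_wt_box]
  have e2 : (H.hat τ.psi).w (lo (lastRefl hn)) = τ.psi.w ⟨n - 1, Nat.sub_lt hn one_pos⟩ := by
    have := H.hat_wc τ.psi ⟨n - 1, Nat.sub_lt hn one_pos⟩
    exact congrArg Prod.fst this
  have e3 : τ.psi.w ⟨n - 1, Nat.sub_lt hn one_pos⟩ = τ.w ⟨0, hn⟩ + 1 := by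
    have := τ.toLabelling.wc_psi_last ⟨n - 1, Nat.sub_lt hn one_pos⟩ ⟨0, hn⟩ rfl
      (by simp; omega)
    exact congrArg Prod.fst this
  rw [e1, e2, e3]
  omega

/-- With exponent zero and the largest content, the new box comes last in the sorting order.
Consequently `Top` is compatible with adding the box. -/
theorem sorted_hat {τ : PSYT n μ} (h : τ.Sorted) : (H.hat τ).Sorted := by
  intro i j hij
  obtain ⟨i, rfl⟩ : ∃ i' : Fin n, i'.castSucc = i :=
    Fin.exists_castSucc_eq.2 (ne_of_lt (lt_of_lt_of_le hij (Fin.le_last j)))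
  rw [PSYT.w, PSYT.c, PSYT.w, PSYT.c, hat_symm_castSucc, hat_wt_emb]
  induction j using Fin.lastCases with
  | last =>
    rw [← H.hat_idx_box τ, Equiv.symm_apply_apply, hat_wt_box]
    have h1 : content (H.emb (τ.idx.symm i)) < content H.box :=
      H.content_lt _ (τ.idx.symm i).2
    omega
  | cast j =>
    rw [hat_symm_castSucc, hat_wt_emb]
    exact h i j (by simpa using hij)

/-- Extension of a standard tableau by the largest number in the new box. -/
def hatSYT (τ : SYT n μ) : SYT (n + 1) μ' where
  idx := H.extendEquiv τ.idx
  strict c d h := by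
    have h1 := (H.hat τ.toPSYT).strict c d h
    have h2 : (H.hat τ.toPSYT).wt = fun _ => 0 :=
      (H.eq_extendWt (T := fun _ => 0) (fun _ => rfl) rfl).symm
    rw [h2] at h1
    exact (h1.resolve_left (lt_irrefl _)).2

theorem hatSYT_toPSYT (τ : SYT n μ) : (H.hatSYT τ).toPSYT = H.hat τ.toPSYT :=
  PSYT.ext rfl (H.eq_extendWt (T := fun _ => 0) (fun _ => rfl) rfl)

theorem hatSYT_injective : Function.Injective (H.hatSYT (n := n)) := fun τ σ h => by
  have h1 : H.hat τ.toPSYT = H.hat σ.toPSYT := by rw [← hatSYT_toPSYT, h, hatSYT_toPSYT]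
  exact SYT.ext (congrArg PSYT.idx (H.hat_injective h1))

end AddBox

end Murnaghan

end

noncomputable section

namespace Murnaghan

/-! # The connecting map -/

namespace AddBox

variable {n : ℕ} {μ μ' : YoungDiagram} {b : ℕ × ℕ} (H : AddBox μ μ' b)

open Classical in
variable (n) in
/-- The connecting map. -/
def conn : V (n + 1) μ' →ₗ[Kqt] V n μ :=
  (V.monoBasis (n + 1) μ').constr Kqt fun x =>
    if h : x.1 (Fin.last n) = 0 ∧ ∃ τ, H.hatSYT τ = x.2 then
      V.mono (fun i => x.1 i.castSucc, h.2.choose) else 0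

open Classical in
theorem conn_mono (x : (Fin (n + 1) → ℕ) × SYT (n + 1) μ') : H.conn n (V.mono x) =
    if h : x.1 (Fin.last n) = 0 ∧ ∃ τ, H.hatSYT τ = x.2 then
      V.mono (fun i => x.1 i.castSucc, h.2.choose) else 0 := by
  rw [← V.monoBasis_apply, conn, Module.Basis.constr_basis]

theorem conn_mono_hat (α : Fin (n + 1) → ℕ) (τ : SYT n μ) : H.conn n (V.mono (α, H.hatSYT τ)) =
    if α (Fin.last n) = 0 then V.mono (fun i => α i.castSucc, τ) else 0 := by
  rw [conn_mono]
  by_cases h : α (Fin.last n) = 0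
  · have h1 : α (Fin.last n) = 0 ∧ ∃ σ, H.hatSYT σ = H.hatSYT τ := ⟨h, τ, rfl⟩
    rw [dif_pos h1, if_pos h, H.hatSYT_injective h1.2.choose_spec]
  · rw [dif_neg fun h' => h h'.1, if_neg h]

theorem conn_mono_of_not_hat (α : Fin (n + 1) → ℕ) {τ' : SYT (n + 1) μ'}
    (h : ¬ ∃ τ : SYT n μ, H.hatSYT τ = τ') : H.conn n (V.mono (α, τ')) = 0 := by
  rw [conn_mono, dif_neg fun h' => h h'.2]

/-- Linear maps on the induced module that agree on monomials are equal. -/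
theorem linearMap_ext_mono {M : Type} [AddCommGroup M] [Module Kqt M] {f g : V n μ →ₗ[Kqt] M}
    (h : ∀ x, f (V.mono x) = g (V.mono x)) : f = g :=
  (V.monoBasis n μ).ext fun x => by rw [V.monoBasis_apply, h]

theorem conn_X (i : Fin n) (v : V (n + 1) μ') :
    H.conn n (DAHA.X i.castSucc • v) = DAHA.X i • H.conn n v := by
  have : H.conn n ∘ₗ act μ' (DAHA.X i.castSucc) = act μ (DAHA.X i) ∘ₗ H.conn n := by
    refine linearMap_ext_mono fun x => ?_
    obtain ⟨α, τ'⟩ := x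
    rw [LinearMap.comp_apply, LinearMap.comp_apply, V.act_apply, V.act_apply, V.X_smul_mono]
    by_cases h : ∃ τ : SYT n μ, H.hatSYT τ = τ'
    · obtain ⟨τ, rfl⟩ := h
      rw [conn_mono_hat, conn_mono_hat]
      have h1 : (α + Pi.single i.castSucc 1 : Fin (n + 1) → ℕ) (Fin.last n) = α (Fin.last n) := by
        rw [Pi.add_apply, Pi.single_eq_of_ne (Fin.castSucc_lt_last i).ne', add_zero]
      have h2 : (fun j : Fin n => (α + Pi.single i.castSucc 1 : Fin (n + 1) → ℕ) j.castSucc) =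
          (fun j => α j.castSucc) + Pi.single i 1 := by
        funext j
        simp only [Pi.add_apply, Pi.single_apply, Fin.castSucc_inj]
      rw [h1, h2]
      split_ifs
      · rw [V.X_smul_mono]
      · rw [smul_zero]
    · rw [H.conn_mono_of_not_hat _ h, H.conn_mono_of_not_hat _ h, smul_zero]
  exact LinearMap.congr_fun this v

theorem conn_X_last (v : V (n + 1) μ') : H.conn n (DAHA.X (Fin.last n) • v) = 0 := by
  have : H.conn n ∘ₗ act μ' (DAHA.X (Fin.last n)) = 0 := by
    refine linearMap_ext_mono fun x => ?_
    obtain ⟨α, τ'⟩ := x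
    rw [LinearMap.comp_apply, V.act_apply, V.X_smul_mono]
    by_cases h : ∃ τ : SYT n μ, H.hatSYT τ = τ'
    · obtain ⟨τ, rfl⟩ := h
      rw [conn_mono_hat, if_neg (by simp)]
      rfl
    · rw [H.conn_mono_of_not_hat _ h]
      rfl
  exact LinearMap.congr_fun this v

theorem conn_emb_hat (τ : SYT n μ) :
    H.conn n (V.emb (Specht.of (H.hatSYT τ))) = V.emb (Specht.of τ) := by
  have h := H.conn_mono_hat 0 τ
  rw [if_pos (show (0 : Fin (n + 1) → ℕ) (Fin.last n) = 0 from rfl)] at h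
  rw [← V.monoTensor_zero, ← V.monoTensor_zero]
  exact h

theorem conn_emb_of_not_hat {τ' : SYT (n + 1) μ'} (h : ¬ ∃ τ : SYT n μ, H.hatSYT τ = τ') :
    H.conn n (V.emb (Specht.of τ')) = 0 := by
  rw [← V.monoTensor_zero]
  exact H.conn_mono_of_not_hat 0 h

theorem conn_F_hat_std {τ : PSYT n μ} (h : τ.wt = fun _ => 0) :
    H.conn n (V.F (H.hat τ)) = V.F τ := by
  obtain ⟨τ, rfl⟩ := Specht.exists_toPSYT h
  rw [← hatSYT_toPSYT, V.F_std, V.F_std, conn_emb_hat]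

theorem conn_F_std_of_ne {τ' : PSYT (n + 1) μ'} (h : τ'.wt = fun _ => 0)
    (h' : τ'.idx H.box ≠ Fin.last n) : H.conn n (V.F τ') = 0 := by
  obtain ⟨τ', rfl⟩ := Specht.exists_toPSYT h
  rw [V.F_std]
  refine H.conn_emb_of_not_hat ?_
  rintro ⟨τ, rfl⟩
  rw [hatSYT_toPSYT] at h'
  exact h' (H.hat_idx_box _)

/-- The connecting map commutes with the operators `T_i`. -/
theorem conn_T (i : Fin (n - 1)) (v : V (n + 1) μ') :
    H.conn n (DAHA.T (up i) • v) = DAHA.T i • H.conn n v := by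
  let P : Submodule Kqt (V (n + 1) μ') :=
    LinearMap.eqLocus (H.conn n ∘ₗ act μ' (DAHA.T (up i))) (act μ (DAHA.T i) ∘ₗ H.conn n)
  have hP : ∀ {v : V (n + 1) μ'}, v ∈ P ↔
      H.conn n (DAHA.T (up i) • v) = DAHA.T i • H.conn n v := Iff.rfl
  suffices h : P = ⊤ from hP.1 (h ▸ Submodule.mem_top)
  refine V.eq_top_of_X (fun τ' => ?_) fun j v hv => ?_
  · rw [hP, ← V.F_std, V.T_smul, V.T_smul, V.R_F]
    have hw : (PSYT.sw (up i) τ'.toPSYT).wt = fun _ => 0 := PSYT.sw_wt _ _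
    rw [map_sub, map_add, map_smul, map_smul, map_smul]
    by_cases h : τ'.toPSYT.idx H.box = Fin.last n
    · obtain ⟨τ, hτ⟩ := H.exists_hat h rfl
      have hτ0 : τ.wt = fun _ => 0 := funext fun c => by rw [← H.hat_wt_emb, hτ]; rfl
      rw [← hτ, sw_hat, H.conn_F_hat_std hτ0, H.conn_F_hat_std ((PSYT.sw_wt i τ).trans hτ0),
        V.R_F, lo_up, hi_up, hat_wc, hat_wc]
    -- If `n + 1` is not in the new box, the same holds after the exchange, and every term maps to
    -- zero.
    · rw [H.conn_F_std_of_ne rfl h, H.conn_F_std_of_ne hw fun e => h ((H.sw_idx_box_iff i _).1 e)]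
      simp
  · rw [hP] at hv ⊢
    induction j using Fin.lastCases with
    | last =>
      have h1 : (Fin.last n) ≠ lo (up i) ∧ (Fin.last n) ≠ hi (up i) := by
        simp only [ne_eq, Fin.ext_iff, lo, hi, up, Fin.val_last]
        omega
      rw [← mul_smul, DAHA.T_mul_X_of_ne _ _ h1, mul_smul, conn_X_last, conn_X_last, smul_zero]
    | cast j =>
      by_cases h : j ≠ lo i ∧ j ≠ hi i
      · have h' : j.castSucc ≠ lo (up i) ∧ j.castSucc ≠ hi (up i) := by
          rw [lo_up, hi_up, ne_eq, ne_eq, Fin.castSucc_inj, Fin.castSucc_inj]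
          exact h
        rw [← mul_smul, DAHA.T_mul_X_of_ne _ _ h', mul_smul, conn_X, conn_X, hv, ← mul_smul,
          ← mul_smul, DAHA.T_mul_X_of_ne _ _ h]
      · by_cases h' : j = lo i
        · rw [h', ← lo_up, ← mul_smul, DAHA.T_mul_X_lo, add_smul, mul_smul, smul_assoc, map_add,
            map_smul (H.conn n) (1 - t), lo_up, hi_up, conn_X, conn_X, hv, ← mul_smul, ← mul_smul,
            DAHA.T_mul_X_lo,
            add_smul, smul_assoc]
        · have h'' : j = hi i := by tauto
          rw [h'', ← hi_up, ← mul_smul, DAHA.T_mul_X_hi', add_smul, mul_smul, smul_assoc, map_add,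
            map_smul (H.conn n) (t - 1), lo_up, hi_up, conn_X, conn_X, conn_X, hv, ← mul_smul,
            ← mul_smul, DAHA.T_mul_X_hi',
            add_smul, smul_assoc]

theorem conn_tInv (i : Fin (n - 1)) (v : V (n + 1) μ') :
    H.conn n (tInv (DAHA.T (up i)) • v) = tInv (DAHA.T i) • H.conn n v := by
  have h := H.conn_T i (tInv (DAHA.T (up i)) • v)
  rw [← mul_smul, DAHA.T_mul_tInv, one_smul] at h
  rw [h, ← mul_smul, DAHA.tInv_mul_T, one_smul]

end AddBox

end Murnaghan

end

noncomputable section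

namespace Murnaghan

/-! ### Compatibility of the connecting map with `π` and the `θ_i` -/

namespace AddBox

variable {n N : ℕ} {μ μ' : YoungDiagram} {b : ℕ × ℕ} (H : AddBox μ μ' b)

theorem conn_smul (a : Kqt) (v : V (n + 1) μ') : H.conn n (a • v) = a • H.conn n v :=
  map_smul (H.conn n) a v

/-- The product of the inverses of the first `k` generators `T_i`. -/
def tInvProd (N k : ℕ) : DAHA (N + 1) :=
  prodUpTo (extendFin fun i : Fin N => tInv (DAHA.T (n := N + 1) i)) k

theorem tInvProd_succ {k : ℕ} (hk : k < N) :
    tInvProd N (k + 1) = tInvProd N k * tInv (DAHA.T (n := N + 1) ⟨k, hk⟩) := by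
  rw [tInvProd, prodUpTo_succ, extendFin_of_lt (fun i : Fin N => tInv (DAHA.T (n := N + 1) i)) hk]
  rfl

theorem exists_tInvProd_mul {k : ℕ} (hk : k ≤ N) : ∃ u, tInvProd N k * u = 1 := by
  induction k with
  | zero => exact ⟨1, one_mul _⟩
  | succ k ih =>
    obtain ⟨u, hu⟩ := ih (by omega)
    refine ⟨DAHA.T (n := N + 1) ⟨k, hk⟩ * u, ?_⟩
    rw [tInvProd_succ hk, mul_assoc, ← mul_assoc _ _ u, DAHA.tInv_mul_T, one_mul, hu]

theorem π_eq_tInvProd (hN : 0 < N + 1) :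
    (DAHA.π hN : DAHA (N + 1)) = t ^ N • (DAHA.θ ⟨0, hN⟩ * tInvProd N N) := by
  rw [DAHA.π, piElt_eq (N := N), extendFin_of_lt _ hN]
  rfl

theorem conn_tInvProd {k : ℕ} (hk : k ≤ N) (v : V (N + 2) μ') :
    H.conn (N + 1) (tInvProd (N + 1) k • v) = tInvProd N k • H.conn (N + 1) v := by
  induction k generalizing v with
  | zero =>
    have h1 : tInvProd (N + 1) 0 = 1 := rfl
    have h2 : tInvProd N 0 = 1 := rfl
    rw [h1, h2, one_smul, one_smul]
  | succ k ih =>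
    have h1 := H.conn_tInv (n := N + 1) ⟨k, hk⟩ v
    have h2 := ih (by omega) (tInv (DAHA.T (n := N + 2) (up (n := N + 1) ⟨k, hk⟩)) • v)
    rw [h1, ← mul_smul, ← mul_smul] at h2
    rw [tInvProd_succ (N := N + 1) (by omega), tInvProd_succ (N := N) hk]
    exact h2

/-- The generator `T` with the largest index. -/
def lastT (N : ℕ) : DAHA (N + 2) := DAHA.T (n := N + 2) ⟨N, Nat.lt_succ_self N⟩

theorem tInv_lastT_mul : tInv (lastT N) * lastT N = 1 := DAHA.tInv_mul_T _

theorem lastT_mul_tInv : lastT N * tInv (lastT N) = 1 := DAHA.T_mul_tInv _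

/-- The last inverse generator cancels. What remains is `t` times the expression for `π` with one
variable less, now read in the larger algebra. -/
theorem π_mul_lastT : (DAHA.π (Nat.succ_pos (N + 1)) : DAHA (N + 2)) * lastT N =
    t • t ^ N • (DAHA.θ 0 * tInvProd (N + 1) N) := by
  rw [π_eq_tInvProd, smul_mul_assoc, tInvProd_succ (N := N + 1) (Nat.lt_succ_self N), mul_assoc,
    mul_assoc]
  have h : tInv (DAHA.T (n := N + 2) ⟨N, Nat.lt_succ_self N⟩) * lastT N = 1 := tInv_lastT_mul
  rw [h, mul_one, smul_smul, pow_succ']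
  rfl

theorem conn_emb (v : Specht (n + 1) μ') : ∃ w : Specht n μ, H.conn n (V.emb v) = V.emb w := by
  have hv : v ∈ Submodule.span Kqt (Set.range (Specht.of (n := n + 1) (μ := μ'))) := by
    rw [Specht.span_of]; trivial
  induction hv using Submodule.span_induction with
  | mem v hv =>
    obtain ⟨τ', rfl⟩ := hv
    by_cases h : ∃ τ : SYT n μ, H.hatSYT τ = τ'
    · obtain ⟨τ, rfl⟩ := h
      exact ⟨_, H.conn_emb_hat τ⟩
    · exact ⟨0, by rw [H.conn_emb_of_not_hat h, map_zero]⟩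
  | zero => exact ⟨0, by rw [map_zero, map_zero, map_zero]⟩
  | add v w _ _ hv hw =>
    obtain ⟨v', hv⟩ := hv
    obtain ⟨w', hw⟩ := hw
    exact ⟨v' + w', by rw [map_add, map_add, map_add, hv, hw]⟩
  | smul a v _ hv =>
    obtain ⟨v', hv⟩ := hv
    exact ⟨a • v', by rw [map_smul, map_smul, map_smul, hv]⟩

theorem θ_zero_smul_emb (v : Specht (N + 1) μ) : (DAHA.θ 0 : DAHA (N + 1)) • V.emb v = V.emb v := by
  rw [V.θ_smul_emb]
  exact congrArg V.emb (one_smul _ v)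

theorem tInvProd_smul_emb {k : ℕ} (hk : k ≤ N) (v : Specht (N + 1) μ) :
    ∃ w : Specht (N + 1) μ, tInvProd N k • V.emb v = V.emb w := by
  induction k generalizing v with
  | zero => exact ⟨v, one_smul _ _⟩
  | succ k ih =>
    have h1 : tInv (DAHA.T (n := N + 1) ⟨k, hk⟩) • V.emb v =
        V.emb (tInv (Hecke.T (n := N + 1) ⟨k, hk⟩) • v) := by
      rw [← V.affineToDAHA_T, ← map_tInv, V.affine_smul_emb, map_tInv, V.rho_T]
    rw [tInvProd_succ hk, mul_smul, h1]
    exact ih (by omega) _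

theorem π_mul_X_castSucc (i : Fin (N + 1)) :
    (DAHA.π (Nat.succ_pos (N + 1)) * DAHA.X i.castSucc : DAHA (N + 2)) =
      DAHA.X i.succ * DAHA.π (Nat.succ_pos (N + 1)) :=
  DAHA.π_mul_X_lo (n := N + 2) _ i

theorem π_mul_X_last : (DAHA.π (Nat.succ_pos (N + 1)) * DAHA.X (Fin.last (N + 1)) : DAHA (N + 2)) =
    q • (DAHA.X 0 * DAHA.π (Nat.succ_pos (N + 1))) :=
  DAHA.π_mul_X_last (n := N + 2) (Nat.succ_pos (N + 1))

/-- The element `π T` for the generator `T` with the largest index. -/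
def πT (N : ℕ) : DAHA (N + 2) := DAHA.π (Nat.succ_pos (N + 1)) * lastT N

/-- The last variable reappears on the left, so both sides of the intertwining relation vanish on
its image. -/
theorem πT_mul_X_last : πT N * DAHA.X (Fin.last (N + 1)) =
    DAHA.X (Fin.last (N + 1)) * (πT N + (t - 1) • DAHA.π (Nat.succ_pos (N + 1))) := by
  have h1 : lastT N * DAHA.X (Fin.last (N + 1)) = DAHA.X (Fin.last N).castSucc * lastT N +
      (t - 1) • DAHA.X (Fin.last N).castSucc := DAHA.T_mul_X_hi' (n := N + 2) ⟨N, _⟩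
  rw [πT, mul_assoc, h1, mul_add, mul_smul_comm, ← mul_assoc, π_mul_X_castSucc, mul_add,
    mul_smul_comm, mul_assoc]
  rfl

/-- The first term is the relation of `π` with the last variable of the smaller algebra; the second
begins with the additional variable and is killed by the connecting map. -/
theorem πT_mul_X_castSucc_last : πT N * DAHA.X (Fin.last N).castSucc =
    q • (DAHA.X (Fin.castSucc 0) * πT N) +
      (1 - t) • (DAHA.X (Fin.last (N + 1)) * DAHA.π (Nat.succ_pos (N + 1))) := by
  have h1 : lastT N * DAHA.X (Fin.last N).castSucc = DAHA.X (Fin.last (N + 1)) * lastT N +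
      (1 - t) • DAHA.X (Fin.last N).castSucc := DAHA.T_mul_X_lo (n := N + 2) ⟨N, _⟩
  rw [πT, mul_assoc, h1, mul_add, mul_smul_comm, ← mul_assoc, π_mul_X_last, π_mul_X_castSucc,
    smul_mul_assoc, mul_assoc]
  rfl

theorem πT_mul_X_castSucc (j : Fin N) :
    πT N * DAHA.X j.castSucc.castSucc = DAHA.X j.succ.castSucc * πT N := by
  have h1 : lastT N * DAHA.X j.castSucc.castSucc = DAHA.X j.castSucc.castSucc * lastT N := by
    refine DAHA.T_mul_X_of_ne (n := N + 2) _ _ ⟨?_, ?_⟩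
    · simp only [ne_eq, Fin.ext_iff, lo, Fin.val_castSucc]
      omega
    · simp only [ne_eq, Fin.ext_iff, hi, Fin.val_castSucc]
      omega
  rw [πT, mul_assoc, h1, ← mul_assoc, π_mul_X_castSucc, mul_assoc]
  rfl

/-- In degree zero `θ_1` is the identity for both sizes, and the connecting map commutes with the
remaining product of the `T_i⁻¹`. -/
theorem conn_πT_emb (τ' : SYT (N + 2) μ') : H.conn (N + 1) (πT N • V.emb (Specht.of τ')) =
    t • DAHA.π (Nat.succ_pos N) • H.conn (N + 1) (V.emb (Specht.of τ')) := by
  obtain ⟨w, hw⟩ := H.conn_emb (n := N + 1) (Specht.of τ')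
  obtain ⟨w', hw'⟩ := tInvProd_smul_emb (N := N + 1) (Nat.le_succ N) (Specht.of τ')
  obtain ⟨w'', hw''⟩ := tInvProd_smul_emb le_rfl w
  have h1 := H.conn_tInvProd le_rfl (V.emb (Specht.of τ'))
  rw [hw, hw', hw''] at h1
  rw [πT, π_mul_lastT, smul_assoc, smul_assoc, mul_smul, hw', θ_zero_smul_emb, hw, conn_smul,
    conn_smul, h1, π_eq_tInvProd, smul_assoc, mul_smul, hw'']
  congr 2
  exact (θ_zero_smul_emb _).symm

/-- The connecting map intertwines `t⁻¹ π T` with `π`. -/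
theorem conn_πT (v : V (N + 2) μ') :
    H.conn (N + 1) (πT N • v) = t • DAHA.π (Nat.succ_pos N) • H.conn (N + 1) v := by
  let P : Submodule Kqt (V (N + 2) μ') :=
    LinearMap.eqLocus (H.conn (N + 1) ∘ₗ act μ' (πT N))
      (t • (act μ (DAHA.π (Nat.succ_pos N)) ∘ₗ H.conn (N + 1)))
  have hP : ∀ {v : V (N + 2) μ'}, v ∈ P ↔
      H.conn (N + 1) (πT N • v) = t • DAHA.π (Nat.succ_pos N) • H.conn (N + 1) v := Iff.rfl
  suffices h : P = ⊤ from hP.1 (h ▸ Submodule.mem_top)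
  refine V.eq_top_of_X (fun τ' => H.conn_πT_emb τ') fun j v hv => ?_
  rw [hP] at hv ⊢
  induction j using Fin.lastCases with
  | last =>
    rw [← mul_smul, πT_mul_X_last, mul_smul, conn_X_last, conn_X_last, smul_zero, smul_zero]
  | cast j =>
    rw [conn_X]
    induction j using Fin.lastCases with
    | last =>
      have h3 : (DAHA.π (Nat.succ_pos N) * DAHA.X (Fin.last N) : DAHA (N + 1)) =
          q • (DAHA.X 0 * DAHA.π (Nat.succ_pos N)) :=
        DAHA.π_mul_X_last (n := N + 1) (Nat.succ_pos N)
      have h4 : ∀ w : V (N + 1) μ, DAHA.π (Nat.succ_pos N) • DAHA.X (Fin.last N) • w =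
          q • (DAHA.X 0 : DAHA (N + 1)) • DAHA.π (Nat.succ_pos N) • w := fun w => by
        rw [← mul_smul, h3, smul_assoc, mul_smul]
      rw [← mul_smul, πT_mul_X_castSucc_last, add_smul, smul_assoc, smul_assoc, mul_smul (DAHA.X _),
        mul_smul (DAHA.X _), map_add, conn_smul, conn_smul, conn_X_last, smul_zero, add_zero, conn_X,
        hv, h4, V.smul_smul_comm _ t, smul_comm q t]
    | cast j =>
      have h3 : (DAHA.π (Nat.succ_pos N) * DAHA.X j.castSucc : DAHA (N + 1)) =
          DAHA.X j.succ * DAHA.π (Nat.succ_pos N) := DAHA.π_mul_X_lo (n := N + 1) _ j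
      rw [← mul_smul, πT_mul_X_castSucc, mul_smul, conn_X, hv, ← mul_smul (DAHA.π _), h3, mul_smul,
        V.smul_smul_comm]

/-- Expand both `π` in the intertwining relation. The map commutes with the product of the `T_i⁻¹`,
which has a right inverse and can be removed, as can the powers of `t`. -/
theorem conn_θ_zero (v : V (N + 2) μ') :
    H.conn (N + 1) ((DAHA.θ 0 : DAHA (N + 2)) • v) =
      (DAHA.θ 0 : DAHA (N + 1)) • H.conn (N + 1) v := by
  obtain ⟨u, hu⟩ := exists_tInvProd_mul (N := N + 1) (Nat.le_succ N)
  have h1 : v = tInvProd (N + 1) N • u • v := by rw [← mul_smul, hu, one_smul]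
  have h2 := H.conn_πT (u • v)
  rw [πT, π_mul_lastT, smul_assoc, smul_assoc, conn_smul, conn_smul, mul_smul, ← h1, π_eq_tInvProd,
    smul_assoc, mul_smul, ← H.conn_tInvProd le_rfl, ← h1] at h2
  exact smul_right_injective _ (pow_ne_zero N t_ne_zero)
    (smul_right_injective _ t_ne_zero h2)

/-- The connecting map commutes with the operators `θ_i`. -/
theorem conn_θ (i : Fin n) (v : V (n + 1) μ') :
    H.conn n (DAHA.θ i.castSucc • v) = DAHA.θ i • H.conn n v := by
  obtain ⟨i, hi'⟩ := i
  induction i generalizing v with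
  | zero =>
    obtain ⟨N, rfl⟩ : ∃ N, n = N + 1 := ⟨n - 1, by omega⟩
    exact H.conn_θ_zero v
  | succ i ih =>
    have e1 : (⟨i + 1, hi'⟩ : Fin n) = hi ⟨i, by omega⟩ := rfl
    rw [e1, ← hi_up, DAHA.θ_hi, DAHA.θ_hi, smul_assoc, conn_smul, smul_assoc, mul_smul, mul_smul,
      mul_smul, mul_smul, conn_tInv, ← H.conn_tInv _ v]
    congr 2
    exact ih _ (by omega)

/-! ## Non-symmetric Macdonald polynomials -/

/-- Induction along the recursions. The exchange step is immediate from equivariance. For the shift,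
the extension of `Ψ(τ)` is one upward exchange away from the shift of the extension. -/
theorem conn_F_hat (τ : PSYT n μ) : H.conn n (V.F (H.hat τ)) = V.F τ := by
  induction τ using PSYT.induction with
  | std τ => exact H.conn_F_hat_std rfl
  | swap i τ hτ ih =>
    rw [← sw_hat, V.F_of_up hτ.swapUp, V.F_of_up (H.up_hat hτ).swapUp, map_sub, conn_smul, conn_smul,
      conn_tInv, ih, lo_up, hi_up, hat_wc, hat_wc]
  | psi hn τ ih =>
    obtain ⟨N, rfl⟩ : ∃ N, n = N + 1 := ⟨n - 1, by omega⟩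
    obtain ⟨u, hu⟩ : ∃ u, u = Ring.inverse (act μ' (DAHA.π (Nat.succ_pos (N + 1))))
      (V.F (H.hat τ)) := ⟨_, rfl⟩
    have hu' : DAHA.π (Nat.succ_pos (N + 1)) • u = V.F (H.hat τ) := by
      rw [hu, V.π_smul_inverse]
    have h1 : V.F (H.hat τ).psi = q ^ (H.hat τ).w 0 • DAHA.X (Fin.last (N + 1)) • u :=
      V.X_last_smul_of_π _ hu'
    have h2 : (H.hat τ).w 0 = τ.w ⟨0, hn⟩ := congrArg Prod.fst (H.hat_wc τ ⟨0, hn⟩)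
    have h3 := V.F_of_up (H.swapUp_psi_hat hn τ)
    -- The shifted vector is a multiple of `X_{n+1} u` and dies under the map. Moving `t T_n⁻¹` past
    -- `X_{n+1}` produces the surviving term, which begins with `X_n`.
    have h4 : t • tInv (lastT N) * DAHA.X (Fin.last (N + 1)) =
        DAHA.X (Fin.last N).castSucc * t • tInv (lastT N) +
          (t - 1) • DAHA.X (Fin.last (N + 1)) := by
      have h5 : lastT N * DAHA.X (Fin.last (N + 1)) =
        t • (DAHA.X (Fin.last N).castSucc * tInv (lastT N)) := DAHA.T_mul_X_hi (n := N + 2) ⟨N, _⟩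
      conv_lhs => rw [DAHA.tInv_eq, add_mul, h5, smul_mul_assoc, one_mul]
      rw [mul_smul_comm]
    have h6 : t • DAHA.π (Nat.succ_pos N) • H.conn (N + 1) (tInv (lastT N) • u) = V.F τ := by
      -- The intertwining relation applied to `T_n⁻¹ u`: there `T_n` cancels, and `π u` is the
      -- extended vector, known by induction.
      rw [← conn_πT, πT, mul_smul, ← mul_smul (lastT N), lastT_mul_tInv, one_smul, hu', ih]
    have h7 : DAHA.π hn • H.conn (N + 1) (t • tInv (lastT N) • u) = V.F τ := by
      rw [conn_smul, V.smul_smul_comm]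
      exact h6
    have h8 : V.F τ.psi = q ^ τ.w ⟨0, hn⟩ • DAHA.X (Fin.last N) •
      H.conn (N + 1) (t • tInv (lastT N) • u) := V.X_last_smul_of_π hn h7
    have h9 : t • tInv (DAHA.T (lastRefl hn)) • V.F (H.hat τ).psi =
        q ^ τ.w ⟨0, hn⟩ • (DAHA.X (Fin.last N).castSucc • t • tInv (lastT N) • u +
          (t - 1) • DAHA.X (Fin.last (N + 1)) • u) := by
      rw [h1, h2, V.smul_smul_comm, smul_comm t]
      congr 1
      have : (_ : DAHA (N + 2)) • u = (_ : DAHA (N + 2)) • u := congrArg (· • u) h4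
      rw [mul_smul, add_smul, mul_smul, smul_assoc, smul_assoc, smul_assoc] at this
      exact this
    rw [h3, h9, h1, map_sub, conn_smul, conn_smul, conn_smul, map_add, conn_smul, conn_X_last, conn_X,
      h8]
    simp

theorem coef_θ (i : Fin n) (σ : PSYT n μ) (v : V n μ) :
    V.coef σ (DAHA.θ i • v) = qtp (σ.wc i) * V.coef σ v := by
  have : V.coef σ ∘ₗ act μ (DAHA.θ i) = qtp (σ.wc i) • V.coef σ := by
    refine V.linearMap_ext_F fun τ => ?_
    rw [LinearMap.comp_apply, V.act_apply, V.θ_F, map_smul, LinearMap.smul_apply, V.coef_F]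
    split_ifs with h
    · rw [h]
    · simp
  exact LinearMap.congr_fun this v

/-- Let `i ≤ n` be the number in the new box. The image is a `θ_i`-eigenvector whose power of `t` is
the content of the new box, larger than any content of the smaller diagram; so all its coefficients
vanish. -/
theorem conn_F_of_ne {τ' : PSYT (n + 1) μ'} (h : τ'.idx H.box ≠ Fin.last n) :
    H.conn n (V.F τ') = 0 := by
  obtain ⟨i, hi'⟩ := Fin.exists_castSucc_eq.2 h
  refine V.eq_zero_of_coef fun σ => ?_
  have h1 := congrArg (V.coef σ) (H.conn_θ i (V.F τ'))
  rw [V.θ_F, map_smul, map_smul, coef_θ, smul_eq_mul, ← sub_eq_zero, ← sub_mul] at h1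
  refine (mul_eq_zero.1 h1).resolve_left (sub_ne_zero.2 fun h2 => ?_)
  have h3 : τ'.c i.castSucc = σ.c i := congrArg Prod.snd (qtp_injective h2)
  rw [hi', PSYT.c, Equiv.symm_apply_apply, PSYT.c] at h3
  have h4 := H.content_lt _ (σ.idx.symm i).2
  have h5 : content (H.box : ℕ × ℕ) = content b := rfl
  omega

/-- Among the tableaux with exponent zero in the new box, the map sends extensions to the original
tableaux and all others to zero. -/
theorem coef_conn {v : V (n + 1) μ'} (hv : ∀ τ' : PSYT (n + 1) μ', τ'.wt H.box ≠ 0 →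
    V.coef τ' v = 0) (σ : PSYT n μ) : V.coef σ (H.conn n v) = V.coef (H.hat σ) v := by
  have h1 : v ∈ Submodule.span Kqt {x | ∃ τ' : PSYT (n + 1) μ', τ'.wt H.box = 0 ∧ x = V.F τ'} :=
    V.mem_span_iff_coef.2 hv
  clear hv
  induction h1 using Submodule.span_induction with
  | mem v hv =>
    obtain ⟨τ', h, rfl⟩ := hv
    by_cases h' : τ'.idx H.box = Fin.last n
    · obtain ⟨τ, rfl⟩ := H.exists_hat h' h
      rw [conn_F_hat, V.coef_F, V.coef_F]
      by_cases h2 : τ = σ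
      · rw [if_pos h2, if_pos (congrArg H.hat h2)]
      · rw [if_neg h2, if_neg fun e => h2 (H.hat_injective e)]
    · rw [H.conn_F_of_ne h', map_zero, V.coef_F, if_neg]
      rintro rfl
      exact h' (H.hat_idx_box σ)
  | zero => rw [map_zero, map_zero, map_zero]
  | add v w _ _ hv hw => rw [map_add, map_add, map_add, hv, hw]
  | smul a v _ hv => rw [map_smul, map_smul, map_smul, hv]

/-! ## Symmetric Macdonald polynomials -/

theorem conn_isInv {v : V (n + 1) μ'} (hv : V.IsInv v) : V.IsInv (H.conn n v) := fun i => by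
  rw [← conn_T, hv]

theorem conn_mem_W {v : V (n + 1) μ'} (hv : v ∈ W (n + 1) μ') : H.conn n v ∈ W n μ := by
  rw [V.mem_W_iff] at hv ⊢
  exact H.conn_isInv hv

theorem conn_mem_degLE {d : ℕ} {v : V (n + 1) μ'} (hv : v ∈ degLE (n + 1) μ' d) :
    H.conn n v ∈ degLE n μ d := by
  refine (Submodule.span_le.2 ?_ : degLE (n + 1) μ' d ≤ (degLE n μ d).comap (H.conn n)) hv
  rintro _ ⟨α, τ', hα, rfl⟩
  rw [SetLike.mem_coe, Submodule.mem_comap]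
  change H.conn n (V.mono (α, τ')) ∈ _
  by_cases h : ∃ τ : SYT n μ, H.hatSYT τ = τ'
  · obtain ⟨τ, rfl⟩ := h
    rw [conn_mono_hat]
    split_ifs with h1
    · refine Submodule.subset_span ⟨_, τ, ?_, rfl⟩
      rw [Fin.sum_univ_castSucc, h1, add_zero] at hα
      exact hα
    · exact zero_mem _
  · rw [H.conn_mono_of_not_hat _ h]
    exact zero_mem _

/-- Stability of the symmetric Macdonald polynomials. -/
theorem conn_symMacdonald (hn : μ.card = n) (hn' : μ'.card = n + 1) {T : μ.cells → ℕ}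
    {T' : μ'.cells → ℕ} (hT : IsRSSYT T) (hT' : IsRSSYT T') (h : ∀ c, T' (H.emb c) = T c)
    (h' : T' H.box = 0) : H.conn n (symMacdonald (n + 1) T') = symMacdonald n T := by
  obtain ⟨τ₀, rfl, h₀⟩ := PSYT.exists_sorted hT hn
  obtain rfl : T' = (H.hat τ₀).wt := H.eq_extendWt h h'
  have h1 := V.isSymMacdonald_symMacdonald hT hn
  have h2 := V.isSymMacdonald_symMacdonald hT' hn'
  refine V.isSymMacdonald_unique h₀ hT ?_ h1
  rw [V.isSymMacdonald_iff (H.sorted_hat h₀) hT'] at h2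
  have h3 : ∀ τ' : PSYT (n + 1) μ', τ'.wt H.box ≠ 0 →
      V.coef τ' (symMacdonald (n + 1) (H.hat τ₀).wt) = 0 := fun τ' hτ => by
    refine h2.2.1 τ' fun e => hτ ?_
    rw [e, h']
  rw [V.isSymMacdonald_iff h₀ hT]
  -- The image has the characterizing properties of `P_T`: invariance by equivariance, support and
  -- leading coefficient by reading coefficients at the extended tableaux.
  refine ⟨H.conn_isInv h2.1, fun σ hσ => ?_, ?_⟩
  · rw [H.coef_conn h3]
    refine h2.2.1 _ fun e => hσ (funext fun c => ?_)
    rw [← H.hat_wt_emb, e, hat_wt_emb]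
  · rw [H.coef_conn h3, h2.2.2]

end AddBox

end Murnaghan

end

noncomputable section

namespace Murnaghan

variable {lam : YoungDiagram} {n : ℕ}

/-! # The diagrams `λ^(n)` -/

theorem mem_ext_zero (h : nMin lam ≤ n) (j : ℕ) :
    (0, j) ∈ (ext lam n h).cells ↔ j < n - lam.card := by
  rw [YoungDiagram.mem_cells, ext, YoungDiagram.mem_ofRowLens]
  simp

theorem mem_ext_succ (h : nMin lam ≤ n) (i j : ℕ) :
    (i + 1, j) ∈ (ext lam n h).cells ↔ (i, j) ∈ lam.cells := by
  rw [YoungDiagram.mem_cells, YoungDiagram.mem_cells, ext, YoungDiagram.mem_ofRowLens]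
  simp only [List.length_cons, Nat.add_lt_add_iff_right, List.getElem_cons_succ,
    YoungDiagram.get_rowLens, YoungDiagram.length_rowLens, exists_prop]
  rw [← YoungDiagram.mem_iff_lt_colLen, ← YoungDiagram.mem_iff_lt_rowLen]
  exact ⟨fun h => h.2, fun h => ⟨lam.isLowerSet (show (i, 0) ≤ (i, j) from ⟨le_rfl, zero_le⟩) h, h⟩⟩

/-- The box is added at the end of the first row. Boxes of the lower rows have content below `λ_1`,
which is at most `n - |λ|` by the choice of `n_λ`. -/
theorem addBox_ext (h : nMin lam ≤ n) : AddBox (ext lam n h)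
    (ext lam (n + 1) (Nat.le_succ_of_le h)) (0, n - lam.card) where
  mem_iff := by
    rintro ⟨i, j⟩
    have h1 : lam.card ≤ n := le_trans (Nat.le_add_right _ _) h
    rcases i with _ | i
    · rw [mem_ext_zero, mem_ext_zero, Prod.mk.injEq]
      omega
    · rw [mem_ext_succ, mem_ext_succ, Prod.mk.injEq]
      simp
  notMem := by
    rw [mem_ext_zero]
    exact lt_irrefl _
  content_lt := by
    rintro ⟨i, j⟩ hc
    unfold content
    rcases i with _ | i
    · rw [mem_ext_zero] at hc
      simp only
      omega
    · rw [mem_ext_succ, YoungDiagram.mem_cells, YoungDiagram.mem_iff_lt_rowLen] at hc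
      have h1 := lam.rowLen_anti 0 i (Nat.zero_le i)
      unfold nMin at h
      push_cast
      omega

theorem card_ext (h : nMin lam ≤ n) : (ext lam n h).card = n := by
  have h1 : lam.card ≤ n := le_trans (Nat.le_add_right _ _) h
  have h2 : (ext lam n h).cells = (Finset.range (n - lam.card)).image (fun j => (0, j)) ∪
      lam.cells.image (fun c => (c.1 + 1, c.2)) := by
    ext ⟨i, j⟩
    rcases i with _ | i
    · rw [mem_ext_zero]
      simp
    · rw [mem_ext_succ]
      simp
  have h3 : Disjoint ((Finset.range (n - lam.card)).image (fun j => ((0 : ℕ), j)))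
      (lam.cells.image (fun c => (c.1 + 1, c.2))) := by
    rw [Finset.disjoint_left]
    rintro ⟨i, j⟩ h4 h5
    simp only [Finset.mem_image, Prod.mk.injEq] at h4 h5
    obtain ⟨_, _, rfl, _⟩ := h4
    obtain ⟨_, _, h6, _⟩ := h5
    omega
  rw [YoungDiagram.card, h2, Finset.card_union_of_disjoint h3, Finset.card_image_of_injective,
    Finset.card_image_of_injective, Finset.card_range]
  · change n - lam.card + lam.card = n
    omega
  · rintro ⟨a, b⟩ ⟨c, d⟩ h4
    simpa using h4
  · intro a b h4
    simpa using h4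

theorem ext_mono {m : ℕ} (h : nMin lam ≤ n) (h' : nMin lam ≤ m) (hnm : n ≤ m) {c : ℕ × ℕ}
    (hc : c ∈ (ext lam n h).cells) : c ∈ (ext lam m h').cells := by
  obtain ⟨i, j⟩ := c
  rcases i with _ | i
  · rw [mem_ext_zero] at hc ⊢
    omega
  · rw [mem_ext_succ] at hc ⊢
    exact hc

/-! # The connecting maps -/

theorem restricts_iff (h : nMin lam ≤ n)
    (τ' : SYT (n + 1) (ext lam (n + 1) (Nat.le_succ_of_le h))) (τ : SYT n (ext lam n h)) :
    Restricts h τ' τ ↔ (addBox_ext h).hatSYT τ = τ' := by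
  have H := addBox_ext h
  constructor
  · intro hr
    refine SYT.ext (Equiv.ext fun c => ?_)
    have h1 : ∀ c : (ext lam n h).cells, τ'.idx (H.emb c) = (τ.idx c).castSucc := fun c =>
      Fin.ext (hr c.1 c.2 (H.emb c).2)
    change H.extendEquiv τ.idx c = τ'.idx c
    rcases H.emb_or_box c with ⟨c, rfl⟩ | rfl
    · rw [H.extendEquiv_emb, h1]
    · rw [H.extendEquiv_box]
      -- If the new box carried a number `i ≤ n`, that number would already be used by a box of the
      -- smaller diagram.
      by_contra hne
      obtain ⟨i, hi'⟩ := Fin.exists_castSucc_eq.2 (Ne.symm hne)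
      have h2 := h1 (τ.idx.symm i)
      rw [Equiv.apply_symm_apply, hi'] at h2
      exact H.emb_ne_box _ (τ'.idx.injective h2)
  · rintro rfl c hc hc'
    exact congrArg Fin.val (H.extendEquiv_emb τ.idx ⟨c, hc⟩)

theorem isConnectingMap_conn (h : nMin lam ≤ n) :
    IsConnectingMap lam n h ((addBox_ext h).conn n) := by
  intro α τ' v hv
  change (addBox_ext h).conn n (V.mono (α, τ')) = _
  rcases hv with ⟨τ, hτ, rfl⟩ | ⟨hτ, rfl⟩
  · rw [restricts_iff] at hτ
    rw [← hτ, AddBox.conn_mono_hat]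
    rfl
  · simp only [restricts_iff] at hτ
    rw [AddBox.conn_mono_of_not_hat _ _ hτ, V.monoTensor_eq, map_zero, smul_zero, ite_self]

theorem eq_conn (h : nMin lam ≤ n) {Φ} (hΦ : IsConnectingMap lam n h Φ) :
    Φ = (addBox_ext h).conn n := by
  refine AddBox.linearMap_ext_mono fun x => ?_
  obtain ⟨α, τ'⟩ := x
  obtain ⟨v, hv⟩ : ∃ v, IsRestrictionValue h τ' v := by
    by_cases hτ : ∃ τ, Restricts h τ' τ
    · obtain ⟨τ, hτ⟩ := hτ
      exact ⟨_, Or.inl ⟨τ, hτ, rfl⟩⟩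
    · exact ⟨0, Or.inr ⟨hτ, rfl⟩⟩
  exact (hΦ α τ' v hv).trans (isConnectingMap_conn h α τ' v hv).symm

theorem connectingMap_eq (h : nMin lam ≤ n) : connectingMap lam n h = (addBox_ext h).conn n :=
  eq_conn h (Classical.epsilon_spec ⟨_, isConnectingMap_conn h⟩)

theorem connectingMap_symMacdonald (h : nMin lam ≤ n) {T : (ext lam n h).cells → ℕ}
    {T' : (ext lam (n + 1) (Nat.le_succ_of_le h)).cells → ℕ} (hT : IsRSSYT T) (hT' : IsRSSYT T')
    (h1 : ∀ (c : ℕ × ℕ) (hc : c ∈ (ext lam n h).cells)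
      (hc' : c ∈ (ext lam (n + 1) (Nat.le_succ_of_le h)).cells), T ⟨c, hc⟩ = T' ⟨c, hc'⟩)
    (h2 : ∀ (c : ℕ × ℕ) (hc' : c ∈ (ext lam (n + 1) (Nat.le_succ_of_le h)).cells),
      c ∉ (ext lam n h).cells → T' ⟨c, hc'⟩ = 0) :
    connectingMap lam n h (symMacdonald (n + 1) T') = symMacdonald n T := by
  rw [connectingMap_eq]
  exact (addBox_ext h).conn_symMacdonald (card_ext h) (card_ext _) hT hT'
    (fun c => (h1 c.1 c.2 _).symm) (h2 _ _ (addBox_ext h).notMem)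

/-! # The limits -/

section limits

variable (T : extInf lam → ℕ)

theorem isRSSYT_restrictTo {T : extInf lam → ℕ} (hT : IsOmega T) (h : nMin lam ≤ n) :
    IsRSSYT (restrictTo T n h) :=
  ⟨fun c d hcd => hT.2.1 ⟨c.1, n, h, c.2⟩ ⟨d.1, n, h, d.2⟩ hcd,
    fun c d hcd => hT.2.2 ⟨c.1, n, h, c.2⟩ ⟨d.1, n, h, d.2⟩ hcd⟩

/-- The labelling vanishes outside `λ^(n)`. -/
def VanishesOutside (n : ℕ) (h : nMin lam ≤ n) : Prop :=
  ∀ c : extInf lam, (c : ℕ × ℕ) ∉ (ext lam n h).cells → T c = 0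

variable {T}

theorem VanishesOutside.mono {m : ℕ} {h : nMin lam ≤ n} (hv : VanishesOutside T n h)
    (h' : nMin lam ≤ m) (hnm : n ≤ m) : VanishesOutside T m h' := fun c hc =>
  hv c fun hc' => hc (ext_mono h h' hnm hc')

/-- Each of the finitely many boxes of the support lies in some `λ^(n)`, and these diagrams
increase. -/
theorem exists_vanishesOutside (hT : {c | T c ≠ 0}.Finite) :
    ∃ (N : ℕ) (h : nMin lam ≤ N), VanishesOutside T N h := by
  choose m hm hc using fun c : extInf lam => c.2
  refine ⟨max (nMin lam) (hT.toFinset.sup m), le_max_left _ _, fun c hc' => ?_⟩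
  by_contra h0
  refine hc' (ext_mono (hm c) _ (le_trans ?_ (le_max_right _ _)) (hc c))
  exact Finset.le_sup (f := m) (hT.mem_toFinset.2 h0)

theorem symMacdonald_mem_W {h : nMin lam ≤ n} {T : (ext lam n h).cells → ℕ} (hT : IsRSSYT T) :
    symMacdonald n T ∈ W n (ext lam n h) := by
  obtain ⟨τ₀, rfl, h₀⟩ := PSYT.exists_sorted hT (card_ext h)
  have h1 := V.isSymMacdonald_symMacdonald hT (card_ext h)
  rw [V.isSymMacdonald_iff h₀ hT] at h1
  exact (V.mem_W_iff _).2 h1.1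

theorem degLE_mono {μ : YoungDiagram} {d d' : ℕ} (h : d ≤ d') : degLE n μ d ≤ degLE n μ d' :=
  Submodule.span_mono fun _ ⟨α, τ, h1, h2⟩ => ⟨α, τ, h1.trans h, h2⟩

theorem symMacdonald_mem_degLE {h : nMin lam ≤ n} {T : (ext lam n h).cells → ℕ} (hT : IsRSSYT T) :
    symMacdonald n T ∈ degLE n (ext lam n h) (∑ c, T c) := by
  obtain ⟨τ₀, rfl, h₀⟩ := PSYT.exists_sorted hT (card_ext h)
  have h1 := V.isSymMacdonald_symMacdonald hT (card_ext h)
  rw [V.isSymMacdonald_iff h₀ hT] at h1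
  have h2 := V.mem_span_iff_coef.2 h1.2.1
  refine Submodule.span_le.2 ?_ h2
  rintro _ ⟨τ, hτ, rfl⟩
  rw [← hτ]
  exact V.F_mem_degLE τ

/-- The bound does not depend on `n`; it gives bounded degree of the limit. -/
theorem sum_restrictTo_le (hT : {c | T c ≠ 0}.Finite) (h : nMin lam ≤ n) :
    ∑ c, restrictTo T n h c ≤ ∑ c ∈ hT.toFinset, T c := by
  let i : (ext lam n h).cells ↪ extInf lam :=
    ⟨fun c => ⟨c.1, n, h, c.2⟩, fun c d hcd => Subtype.ext (Subtype.mk.inj hcd)⟩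
  have h1 : ∑ c, restrictTo T n h c = ∑ c ∈ Finset.univ.map i, T c :=
    (Finset.sum_map Finset.univ i T).symm
  rw [h1, ← Finset.sum_filter_ne_zero]
  refine Finset.sum_le_sum_of_subset fun c hc => ?_
  exact hT.mem_toFinset.2 (Finset.mem_filter.1 hc).2

/-- The operator that replaces the components of a family by the images of the next ones. -/
def descend (f : VFamily lam) : VFamily lam := fun m =>
  connectingMap lam m.1 m.2 (f ⟨m.1 + 1, Nat.le_succ_of_le m.2⟩)

variable (T) in
/-- The family of the symmetric Macdonald polynomials. -/
def symFamily : VFamily lam := fun m => symMacdonald m.1 (restrictTo T m.1 m.2)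

theorem descend_symFamily (hT : IsOmega T) {h : nMin lam ≤ n} (hv : VanishesOutside T n h) :
    descend (symFamily T) ⟨n, h⟩ = symFamily T ⟨n, h⟩ :=
  connectingMap_symMacdonald h (isRSSYT_restrictTo hT h) (isRSSYT_restrictTo hT _)
    (fun _ _ _ => rfl) fun _ _ hc => hv _ hc

theorem iterate_descend_symFamily (hT : IsOmega T) (k : ℕ) {h : nMin lam ≤ n}
    (hv : VanishesOutside T n h) : descend^[k] (symFamily T) ⟨n, h⟩ = symFamily T ⟨n, h⟩ := by
  induction k generalizing n with
  | zero => rfl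
  | succ k ih =>
    rw [Function.iterate_succ_apply']
    change connectingMap lam n h (descend^[k] (symFamily T) ⟨n + 1, _⟩) = _
    rw [ih (hv.mono _ (Nat.le_succ n))]
    exact descend_symFamily hT hv

/-- Component `n` after `k` descents is the image of the component `n + k` of the original family,
where stability already holds; one further descent changes nothing. -/
theorem iterate_descend_stable (hT : IsOmega T) (k : ℕ) (h : nMin lam ≤ n)
    (hv : VanishesOutside T (n + k) (h.trans (Nat.le_add_right n k))) :
    descend^[k + 1] (symFamily T) ⟨n, h⟩ = descend^[k] (symFamily T) ⟨n, h⟩ := by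
  induction k generalizing n with
  | zero => exact descend_symFamily hT hv
  | succ k ih =>
    have h1 := ih (n := n + 1) (Nat.le_succ_of_le h) (hv.mono _ (by omega))
    rw [Function.iterate_succ_apply' _ (k + 1), Function.iterate_succ_apply' _ k (symFamily T)]
    rw [Function.iterate_succ_apply'] at h1
    exact congrArg (connectingMap lam n h) h1

theorem iterate_descend_mem {P : (m : {n : ℕ // nMin lam ≤ n}) →
    Submodule Kqt (V m.1 (ext lam m.1 m.2))}
    (hP : ∀ (n : ℕ) (h : nMin lam ≤ n), ∀ v ∈ P ⟨n + 1, Nat.le_succ_of_le h⟩,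
      connectingMap lam n h v ∈ P ⟨n, h⟩) (k : ℕ) {f : VFamily lam} (hf : ∀ m, f m ∈ P m)
    (m : {n : ℕ // nMin lam ≤ n}) : descend^[k] f m ∈ P m := by
  induction k generalizing m with
  | zero => exact hf m
  | succ k ih =>
    rw [Function.iterate_succ_apply']
    exact hP m.1 m.2 _ (ih _)

/-- In an inverse limit the higher components determine the lower ones. -/
theorem eq_of_eventually_eq {f g : VFamily lam} (hf : f ∈ Winf lam) (hg : g ∈ Winf lam) (N : ℕ)
    (h : ∀ (n : ℕ) (h : nMin lam ≤ n), N ≤ n → f ⟨n, h⟩ = g ⟨n, h⟩) : f = g := by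
  have key : ∀ k n (h : nMin lam ≤ n), N ≤ n + k → f ⟨n, h⟩ = g ⟨n, h⟩ := by
    intro k
    induction k with
    | zero => exact fun n h' hn => h n h' hn
    | succ k ih =>
      intro n h' hn
      rw [← hf.2 n h', ← hg.2 n h', ih (n + 1) _ (by omega)]
  funext m
  exact key N m.1 m.2 (Nat.le_add_left _ _)

/-- If `T` vanishes outside `λ^(N)`, descending `N` times reaches the stable range from every `n`.
It leaves the components that are already stable unchanged and preserves both invariance and the
degree bound. -/
theorem exists_limit (hT : IsOmega T) : ∃ f ∈ Wtilde lam, IsMacDLimit T f ∧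
    ∀ (n : ℕ) (h : nMin lam ≤ n), VanishesOutside T n h →
      f ⟨n, h⟩ = symMacdonald n (restrictTo T n h) := by
  obtain ⟨N, hN, hv⟩ := exists_vanishesOutside hT.1
  have key := fun (n : ℕ) (h : nMin lam ≤ n) => iterate_descend_symFamily (h := h) hT N
  refine ⟨descend^[N] (symFamily T), ⟨⟨?_, fun n h => ?_⟩, ∑ c ∈ hT.1.toFinset, T c, ?_⟩,
    ⟨N, fun n h hn => key n h (hv.mono h hn)⟩, key⟩
  · refine iterate_descend_mem (P := fun m => W m.1 (ext lam m.1 m.2)) (fun n h v hv => ?_) N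
      fun m => symMacdonald_mem_W (isRSSYT_restrictTo hT m.2)
    rw [connectingMap_eq]
    exact (addBox_ext h).conn_mem_W hv
  · have := iterate_descend_stable hT N h (hv.mono _ (Nat.le_add_left N n))
    rwa [Function.iterate_succ_apply'] at this
  · refine iterate_descend_mem
      (P := fun m => degLE m.1 (ext lam m.1 m.2) (∑ c ∈ hT.1.toFinset, T c)) (fun n h v hv => ?_) N
      fun m => degLE_mono (sum_restrictTo_le hT.1 m.2)
        (symMacdonald_mem_degLE (isRSSYT_restrictTo hT m.2))
    rw [connectingMap_eq]
    exact (addBox_ext h).conn_mem_degLE hv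

end limits

end Murnaghan

end

/-! ### The main theorem -/

open Murnaghan

theorem mainTheorem12 (lam : YoungDiagram) :
    -- the objects involved are well defined
    (∀ (n : ℕ) (h : nMin lam ≤ n),
      (∀ hn : 0 < n, IsUnit (act (ext lam n h) (DAHA.π hn))) ∧
      (∃! F, IsNonsymMacdonald n (ext lam n h) F) ∧
      (∀ T : (ext lam n h).cells → ℕ, IsRSSYT T → ∃! P, IsSymMacdonald n T P) ∧
      (∃! Φ, IsConnectingMap lam n h Φ)) ∧
    -- stability
    (∀ (n : ℕ) (h : nMin lam ≤ n) (T : (ext lam n h).cells → ℕ)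
      (T' : (ext lam (n + 1) (Nat.le_succ_of_le h)).cells → ℕ),
      IsRSSYT T → IsRSSYT T' →
      (∀ (c : ℕ × ℕ) (hc : c ∈ (ext lam n h).cells)
        (hc' : c ∈ (ext lam (n + 1) (Nat.le_succ_of_le h)).cells), T ⟨c, hc⟩ = T' ⟨c, hc'⟩) →
      (∀ (c : ℕ × ℕ) (hc' : c ∈ (ext lam (n + 1) (Nat.le_succ_of_le h)).cells),
        c ∉ (ext lam n h).cells → T' ⟨c, hc'⟩ = 0) →
      connectingMap lam n h (symMacdonald (n + 1) T') = symMacdonald n T) ∧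
    -- the stable limits exist, are unique, and have the expected components
    (∀ T : extInf lam → ℕ, IsOmega T →
      (∀ (n : ℕ) (h : nMin lam ≤ n), IsRSSYT (restrictTo T n h)) ∧
      ∃ f ∈ Wtilde lam, IsMacDLimit T f ∧
        (∀ (n : ℕ) (h : nMin lam ≤ n),
          (∀ c : extInf lam, (c : ℕ × ℕ) ∉ (ext lam n h).cells → T c = 0) →
          f ⟨n, h⟩ = symMacdonald n (restrictTo T n h)) ∧
        ∀ g ∈ Winf lam, IsMacDLimit T g → g = f) := by
  refine ⟨fun n h => ⟨fun hn => V.isUnit_act_π hn, ⟨V.F, V.isNonsymMacdonald_F, fun G hG =>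
    V.eq_F hG⟩, fun T hT => V.existsUnique_isSymMacdonald hT (card_ext h),
    ⟨_, isConnectingMap_conn h, fun Φ hΦ => eq_conn h hΦ⟩⟩,
    fun n h T T' hT hT' h1 h2 => connectingMap_symMacdonald h hT hT' h1 h2,
    fun T hT => ⟨fun n h => isRSSYT_restrictTo hT h, ?_⟩⟩
  obtain ⟨f, hf, ⟨N, hN⟩, hf'⟩ := exists_limit hT
  refine ⟨f, hf, ⟨N, hN⟩, hf', fun g hg hg' => ?_⟩
  obtain ⟨M, hM⟩ := hg'
  refine eq_of_eventually_eq hg hf.1 (max M N) fun n h hn => ?_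
  rw [hM n h (le_trans (le_max_left _ _) hn), hN n h (le_trans (le_max_right _ _) hn)]
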